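/- Throughout, algorithms are deterministic programs for a unit-cost random access machine whose memory cells and registers hold non-negative integers of $O(\log s)$ bits (that is, at most $(s+2)^k$ for a constant $k$), where $s$ is the size parameter of the instance; one addition, truncated subtraction, multiplication, integer division, indirect memory access or conditional jump takes one step, and memory not occupied by the input is initially $0$. Call a real number $\tau$ a feasible exponent for matrix multiplication if for every constant $c$ there is an algorithm (with size parameter $n$) that multiplies any two $n\times n$ matrices with entries in $\{0,1,\dots,n^c\}$ in $O(n^\tau)$ time, and let the matrix multiplication exponent $\omega$ be the infimum of all feasible exponents. For a vertex $v$ of a finite simple graph $G$, let $N[v]$ consist of $v$ and its neighbours. Closed neighbourhood containment is the problem of deciding, given $G$, whether there are vertices $x\neq y$ with $N[x]\subseteq N[y]$. Here a graph with $n$ vertices $0,\dots,n-1$ and $m$ edges is given by $n$, $m$ and a list of its edges (each edge once, in any order and orientation), and the size parameter is $n+m$. **Theorem.** Closed neighbourhood containment can be solved in $O(m^{2\omega/(\omega+1)})$ time, in the following sense. 1. For every feasible exponent $\tau$ for matrix multiplication, closed neighbourhood containment can be solved in $O(m^{2\tau/(\tau+1)})$ time. (In particular, if $\omega$ itself is feasible,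 that is, if matrices can be multiplied in $O(n^{\omega})$ time, then the bound is $O(m^{2\omega/(\omega+1)})$.) 2. For every $\varepsilon>0$, closed neighbourhood containment can be solved in $O(m^{2\omega/(\omega+1)+\varepsilon})$ time. (The bounds hold for all $n$, uniformly; for $m=0$, respectively $n=0$ for matrices, $m$ and $n$ are replaced by $1$ in the bounds.) -/

import Mathlib

namespace RAM

/-- The arithmetic operations of the machine on natural numbers
(subtraction is truncated at `0`, division is rounded down). -/
inductive Op where
  | add
  | sub
  | mul
  | div

/-- The value of an arithmetic operation. -/
def Op.eval : Op → ℕ → ℕ → ℕ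
  | .add, a, b => a + b
  | .sub, a, b => a - b
  | .mul, a, b => a * b
  | .div, a, b => a / b

/-- The instructions of a random access machine with registers `R 0, R 1, …` and a memory
`M 0, M 1, …`. -/
inductive Instr where
  /-- `R d := c` -/
  | const (d c : ℕ)
  /-- `R d := R a ∘ R b` for an arithmetic operation `∘` -/
  | arith (op : Op) (d a b : ℕ)
  /-- `R d := M (R a)` -/
  | load (d a : ℕ)
  /-- `M (R a) := R b` -/
  | store (a b : ℕ)
  /-- if `R a = 0`, continue with instruction number `l` -/
  | jumpIfZero (a l : ℕ)

/-- A program is a finite list of instructions, numbered from `0`. -/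
abbrev Program := List Instr

/-- A configuration: program counter, registers, memory. -/
@[ext] structure Config where
  pc : ℕ
  reg : ℕ → ℕ
  mem : ℕ → ℕ

/-- The effect of one instruction. -/
def Instr.exec : Instr → Config → Config
  | .const d c, s => ⟨s.pc + 1, Function.update s.reg d c, s.mem⟩
  | .arith op d a b, s =>
      ⟨s.pc + 1, Function.update s.reg d (op.eval (s.reg a) (s.reg b)), s.mem⟩
  | .load d a, s => ⟨s.pc + 1, Function.update s.reg d (s.mem (s.reg a)), s.mem⟩
  | .store a b, s => ⟨s.pc + 1, s.reg, Function.update s.mem (s.reg a) (s.reg b)⟩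
  | .jumpIfZero a l, s => ⟨if s.reg a = 0 then l else s.pc + 1, s.reg, s.mem⟩

/-- The machine has halted when the program counter has left the program. -/
def Halted (P : Program) (s : Config) : Prop := P.length ≤ s.pc

/-- One step of a program; nothing happens once the machine has halted. -/
def step (P : Program) (s : Config) : Config :=
  match P[s.pc]? with
  | some i => i.exec s
  | none => s

/-- Initially the input occupies the first memory cells; all other cells and all registers
are `0`. -/
def init (input : List ℕ) : Config := ⟨0, fun _ => 0, fun i => input.getD i 0⟩

/-- The configuration after `t` steps on the given input. -/
def run (P : Program) (input : List ℕ) (t : ℕ) : Config := (step P)^[t] (init input)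

/-- On the given input, the program halts after at most `time` steps with `output` in the first
memory cells, and no register or memory cell ever holds a number greater than `bound`. -/
def ComputesWithin (P : Program) (input output : List ℕ) (time : ℝ) (bound : ℕ) : Prop :=
  ∃ t : ℕ, (t : ℝ) ≤ time ∧ Halted P (run P input t) ∧
    (∀ i (hi : i < output.length), (run P input t).mem i = output[i]) ∧
    ∀ t' ≤ t, ∀ i, (run P input t').reg i ≤ bound ∧ (run P input t').mem i ≤ bound

/-- A problem, whose instances `x : ι` are presented to the machine as `input x` and have the
answer `output x`, is solvable in time `O(time x)` on a random access machine with words of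
`O(log (size x))` bits: one program solves all instances in at most `C * time x` steps, and all
numbers in the run are at most `(size x + 2) ^ k`, with `C` and `k` not depending on `x`. -/
def SolvableInTime {ι : Type} (input output : ι → List ℕ) (size : ι → ℕ) (time : ι → ℝ) : Prop :=
  ∃ (P : Program) (k : ℕ) (C : ℝ), ∀ x : ι,
    ComputesWithin P (input x) (output x) (C * time x) ((size x + 2) ^ k)

end RAM

/-- An instance of matrix multiplication: two `n × n` matrices of natural numbers that are at
most `n ^ c`, that is, numbers of `O(log n)` bits. -/
structure MatMulInstance (c : ℕ) where
  n : ℕ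
  A : Matrix (Fin n) (Fin n) ℕ
  B : Matrix (Fin n) (Fin n) ℕ
  hA : ∀ i j, A i j ≤ n ^ c
  hB : ∀ i j, B i j ≤ n ^ c

/-- The entries of a matrix, row by row. -/
def matrixEntries {n : ℕ} (A : Matrix (Fin n) (Fin n) ℕ) : List ℕ :=
  (List.finRange n).flatMap fun i => List.ofFn (A i)

/-- `τ` is a feasible exponent for matrix multiplication if `n × n` matrices with entries of
`O(log n)` bits can be multiplied in time `O(n ^ τ)`. -/
def IsMatMulExponent (τ : ℝ) : Prop :=
  ∀ c : ℕ, RAM.SolvableInTime (ι := MatMulInstance c)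
    (fun x => x.n :: (matrixEntries x.A ++ matrixEntries x.B))
    (fun x => matrixEntries (x.A * x.B))
    (fun x => x.n)
    (fun x => (max (x.n : ℝ) 1) ^ τ)

/-- The exponent `ω` of matrix multiplication. -/
noncomputable def matMulOmega : ℝ := sInf {τ : ℝ | IsMatMulExponent τ}

/-- A finite simple graph together with a list of its edges, in which each edge occurs exactly
once (in either orientation, and in any order). -/
structure EdgeListGraph where
  n : ℕ
  G : SimpleGraph (Fin n)
  edges : List (Fin n × Fin n)
  nodup : (edges.map fun e => s(e.1, e.2)).Nodup
  mem_iff : ∀ e : Sym2 (Fin n), e ∈ edges.map (fun e => s(e.1, e.2)) ↔ e ∈ G.edgeSet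

/-- The number of edges. -/
noncomputable def EdgeListGraph.m (x : EdgeListGraph) : ℕ := x.G.edgeSet.ncard

/-- The input `n, m, u₁, v₁, …, uₘ, vₘ` that presents a graph with vertices `0, …, n - 1` and
edges `{uᵢ, vᵢ}`. -/
def EdgeListGraph.encode (x : EdgeListGraph) : List ℕ :=
  x.n :: x.edges.length :: x.edges.flatMap fun e => [(e.1 : ℕ), (e.2 : ℕ)]

/-- The closed neighbourhood `N[v]`. -/
def SimpleGraph.closedNbhd {V : Type*} (G : SimpleGraph V) (v : V) : Set V :=
  insert v (G.neighborSet v)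

/-- Some closed neighbourhood is contained in the closed neighbourhood of another vertex. -/
def SimpleGraph.HasClosedNbhdContainment {V : Type*} (G : SimpleGraph V) : Prop :=
  ∃ x y : V, x ≠ y ∧ G.closedNbhd x ⊆ G.closedNbhd y

open Classical in
/-- Closed neighbourhood containment can be decided (answer `1` for yes, `0` for no) in time
`O(m ^ e)` for graphs with `n` vertices and `m` edges, given as edge lists, on a random access
machine with words of `O(log (n + m))` bits. -/
noncomputable def ClosedNbhdContainmentInTime (e : ℝ) : Prop :=
  RAM.SolvableInTime (ι := EdgeListGraph)
    (fun x => x.encode)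
    (fun x => [if x.G.HasClosedNbhdContainment then 1 else 0])
    (fun x => x.n + x.m)
    (fun x => (max (x.m : ℝ) 1) ^ e)

/-! If N[x] ⊆ N[y] with x ≠ y, then x lies in N[y], so x and y are adjacent. For adjacent x and y,
the containment holds exactly when they have deg x - 1 common neighbours, and it forces deg x ≤ deg
y (`Darts.good_iff`, `Darts.Good.deg_le_deg`). So it suffices to count common neighbours of the two
ends of edges; isolated vertices play no role, which is why the time does not depend on n.

Let L = 2m be the number of oriented edges, and fix a degree threshold D. Scanning the neighbours of
x for every oriented edge xy with deg x ≤ D takes O(L * D) steps. This settles containment for such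
x, and by crediting x to all pairs of its neighbours the same scan counts, for every pair, the
common neighbours of low degree. The remaining containments have both ends of degree above D. There
are at most L / D vertices of that kind (`Darts.Numbering.mul_le`), and their common neighbours of
high degree are counted by the square of an adjacency matrix (`Darts.Numbering.entry_mul`).
Multiplication in time C * (L / D) ^ τ costs no more than L * D once D ≥ C * L ^ ((τ - 1) / (τ + 1))
(`mul_rpow_le_mul`), and for this D the product L * D is O(m ^ (2τ / (τ + 1))).

The program never computes this threshold, which depends on the real numbers C and τ. Instead D runs
through the powers of two; in each stage the multiplication program is given L * D steps, and the
first stage in which it halts yields the answer (`RAM.stage_wp`). The costs of the stages form a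
geometric series (`RAM.containment_wp`).

The algorithm is written in a small structured language with a clock and a weakest precondition
calculus. Its compiler is proved correct with exact step counts (`RAM.Stmt.outcome`), which turns
verified statements into machine programs (`RAM.solvableInTime_of_wp`). Matrix multiplication is
only given as some machine program, so it is interpreted inside the language with constant overhead
per step (`RAM.rep_simStep_wp`).

For the infimum ω, the set of feasible exponents must be nonempty (`isMatMulExponent_three`) and
bounded below (`IsMatMulExponent.one_le`); then a feasible τ close to ω suffices, because 2τ / (τ +
1) is Lipschitz in τ (`div_add_one_le`). -/

namespace RAM

/-! ### States of the structured language -/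

/-- Abstract memory of the structured language: variables, eight families of tables, the raw
memory cells that hold input and output, and a clock. -/
structure State where
  var : ℕ → ℕ
  tab : Fin 8 → ℕ → ℕ → ℕ
  low : ℕ → ℕ
  time : ℕ

namespace State

def setVar (σ : State) (v x c : ℕ) : State :=
  ⟨Function.update σ.var v x, σ.tab, σ.low, σ.time + c⟩

def setLow (σ : State) (a x c : ℕ) : State :=
  ⟨σ.var, σ.tab, Function.update σ.low a x, σ.time + c⟩

def setTab (σ : State) (t : Fin 8) (b i x c : ℕ) : State :=
  ⟨σ.var, fun t' b' i' => if t' = t ∧ b' = b ∧ i' = i then x else σ.tab t' b' i', σ.low, σ.time + c⟩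

def tick (σ : State) (c : ℕ) : State := ⟨σ.var, σ.tab, σ.low, σ.time + c⟩

variable (σ : State) (t : Fin 8) (v a b i x c : ℕ)

@[simp] theorem setVar_var (w : ℕ) : (σ.setVar v x c).var w = if w = v then x else σ.var w := by
  simp [setVar, Function.update_apply]
@[simp] theorem setVar_tab : (σ.setVar v x c).tab = σ.tab := rfl
@[simp] theorem setVar_low : (σ.setVar v x c).low = σ.low := rfl
@[simp] theorem setVar_time : (σ.setVar v x c).time = σ.time + c := rfl
@[simp] theorem setLow_var : (σ.setLow a x c).var = σ.var := rfl
@[simp] theorem setLow_tab : (σ.setLow a x c).tab = σ.tab := rfl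
@[simp] theorem setLow_low (a' : ℕ) :
    (σ.setLow a x c).low a' = if a' = a then x else σ.low a' := by
  simp [setLow, Function.update_apply]
@[simp] theorem setLow_time : (σ.setLow a x c).time = σ.time + c := rfl
@[simp] theorem setTab_var : (σ.setTab t b i x c).var = σ.var := rfl
@[simp] theorem setTab_tab (t' : Fin 8) (b' i' : ℕ) : (σ.setTab t b i x c).tab t' b' i' =
    if t' = t ∧ b' = b ∧ i' = i then x else σ.tab t' b' i' := rfl
@[simp] theorem setTab_low : (σ.setTab t b i x c).low = σ.low := rfl
@[simp] theorem setTab_time : (σ.setTab t b i x c).time = σ.time + c := rfl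
@[simp] theorem tick_var : (σ.tick c).var = σ.var := rfl
@[simp] theorem tick_tab : (σ.tick c).tab = σ.tab := rfl
@[simp] theorem tick_low : (σ.tick c).low = σ.low := rfl
@[simp] theorem tick_time : (σ.tick c).time = σ.time + c := rfl

end State

/-! ### Syntax and semantics of the structured language -/

inductive Exp where
  | var (v : ℕ)
  | const (c : ℕ)
  | op (o : Op) (a b : Exp)
  | low (a : Exp)
  | get (t : Fin 8) (b i : Exp)

namespace Exp

instance : Add Exp := ⟨op .add⟩
instance : Sub Exp := ⟨op .sub⟩
instance : Mul Exp := ⟨op .mul⟩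
instance : Div Exp := ⟨op .div⟩
instance (n : ℕ) : OfNat Exp n := ⟨const n⟩

def eval (σ : State) : Exp → ℕ
  | var v => σ.var v
  | const c => c
  | op o a b => o.eval (a.eval σ) (b.eval σ)
  | low a => σ.low (a.eval σ)
  | get t b i => σ.tab t (b.eval σ) (i.eval σ)

/-- All accesses to the raw memory are below `off`. -/
def Safe (off : ℕ) (σ : State) : Exp → Prop
  | var _ => True
  | const _ => True
  | op _ a b => a.Safe off σ ∧ b.Safe off σ
  | low a => a.Safe off σ ∧ a.eval σ < off
  | get _ b i => b.Safe off σ ∧ i.Safe off σ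

def cost : Exp → ℕ
  | var _ => 2
  | const _ => 1
  | op _ a b => a.cost + b.cost + 1
  | low a => a.cost + 1
  | get _ b i => 2 * b.cost + 3 * i.cost + 16

/-- A bound for all numbers in the evaluation, if the state is bounded by `M`. -/
def bd (M : ℕ) : Exp → ℕ
  | var _ => M
  | const c => c
  | op _ a b => a.bd M + b.bd M + a.bd M * b.bd M
  | low a => a.bd M + M
  | get _ b i => M + (8 * b.bd M + 8 + i.bd M) * (8 * b.bd M + 8 + i.bd M) + i.bd M

section
variable (σ : State) (off : ℕ) (a b : Exp) (n : ℕ)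
@[simp] theorem eval_var : (var n).eval σ = σ.var n := rfl
@[simp] theorem eval_const : (const n).eval σ = n := rfl
@[simp] theorem eval_low : (low a).eval σ = σ.low (a.eval σ) := rfl
@[simp] theorem eval_get (t : Fin 8) : (get t a b).eval σ = σ.tab t (a.eval σ) (b.eval σ) := rfl
@[simp] theorem eval_add : (a + b).eval σ = a.eval σ + b.eval σ := rfl
@[simp] theorem eval_sub : (a - b).eval σ = a.eval σ - b.eval σ := rfl
@[simp] theorem eval_mul : (a * b).eval σ = a.eval σ * b.eval σ := rfl
@[simp] theorem eval_div : (a / b).eval σ = a.eval σ / b.eval σ := rfl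
@[simp] theorem eval_ofNat : (ofNat(n) : Exp).eval σ = n := rfl
@[simp] theorem cost_var : (var n).cost = 2 := rfl
@[simp] theorem cost_const : (const n).cost = 1 := rfl
@[simp] theorem cost_ofNat : (ofNat(n) : Exp).cost = 1 := rfl
@[simp] theorem cost_low : (low a).cost = a.cost + 1 := rfl
@[simp] theorem cost_get (t : Fin 8) : (get t a b).cost = 2 * a.cost + 3 * b.cost + 16 := rfl
@[simp] theorem cost_add : (a + b).cost = a.cost + b.cost + 1 := rfl
@[simp] theorem cost_sub : (a - b).cost = a.cost + b.cost + 1 := rfl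
@[simp] theorem cost_mul : (a * b).cost = a.cost + b.cost + 1 := rfl
@[simp] theorem cost_div : (a / b).cost = a.cost + b.cost + 1 := rfl
@[simp] theorem safe_var : (var n).Safe off σ ↔ True := Iff.rfl
@[simp] theorem safe_const : (const n).Safe off σ ↔ True := Iff.rfl
@[simp] theorem safe_low : (low a).Safe off σ ↔ a.Safe off σ ∧ a.eval σ < off := Iff.rfl
@[simp] theorem safe_get (t : Fin 8) :
    (get t a b).Safe off σ ↔ a.Safe off σ ∧ b.Safe off σ := Iff.rfl
@[simp] theorem safe_add : (a + b).Safe off σ ↔ a.Safe off σ ∧ b.Safe off σ := Iff.rfl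
@[simp] theorem safe_sub : (a - b).Safe off σ ↔ a.Safe off σ ∧ b.Safe off σ := Iff.rfl
@[simp] theorem safe_mul : (a * b).Safe off σ ↔ a.Safe off σ ∧ b.Safe off σ := Iff.rfl
@[simp] theorem safe_div : (a / b).Safe off σ ↔ a.Safe off σ ∧ b.Safe off σ := Iff.rfl
@[simp] theorem safe_ofNat : (ofNat(n) : Exp).Safe off σ ↔ True := Iff.rfl
end

end Exp

inductive Stmt where
  | skip
  | assign (v : ℕ) (e : Exp)
  | write (a e : Exp)
  | put (t : Fin 8) (b i e : Exp)
  | seq (s s' : Stmt)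
  /-- the first branch is taken if the value is not `0` -/
  | branch (e : Exp) (s s' : Stmt)
  /-- the number of repetitions is evaluated once, before the loop -/
  | rep (e : Exp) (s : Stmt)

/-! ### Program logic: weakest preconditions, frames and loop rules -/

namespace Stmt

infixr:30 " ;; " => Stmt.seq

/-- Weakest precondition: the statement runs safely, all assigned values are at most `M`,
and the final state satisfies `Q`. -/
def wp (off M : ℕ) : Stmt → (State → Prop) → State → Prop
  | skip, Q, σ => Q σ
  | assign v e, Q, σ => e.Safe off σ ∧ e.eval σ ≤ M ∧ Q (σ.setVar v (e.eval σ) (e.cost + 2))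
  | write a e, Q, σ => a.Safe off σ ∧ e.Safe off σ ∧ a.eval σ < off ∧ e.eval σ ≤ M ∧
      Q (σ.setLow (a.eval σ) (e.eval σ) (a.cost + e.cost + 1))
  | put t b i e, Q, σ => b.Safe off σ ∧ i.Safe off σ ∧ e.Safe off σ ∧ e.eval σ ≤ M ∧
      Q (σ.setTab t (b.eval σ) (i.eval σ) (e.eval σ) (2 * b.cost + 3 * i.cost + e.cost + 16))
  | seq s s', Q, σ => s.wp off M (s'.wp off M Q) σ
  | branch e s s', Q, σ => e.Safe off σ ∧
      (e.eval σ ≠ 0 → s.wp off M (fun τ => Q (τ.tick 2)) (σ.tick (e.cost + 1))) ∧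
      (e.eval σ = 0 → s'.wp off M Q (σ.tick (e.cost + 1)))
  | rep e s, Q, σ => e.Safe off σ ∧
      (fun R τ => s.wp off M (fun τ' => R (τ'.tick 4)) (τ.tick 1))^[e.eval σ]
        (fun τ => Q (τ.tick 1)) (σ.tick e.cost)

/-- Adding up the bounds of the parts is enough, without compounding over the rounds of a loop,
because `wp` keeps every stored value at most `M`; only intermediate results and addresses can be
larger. -/
def bd (M : ℕ) : Stmt → ℕ
  | skip => 0
  | assign _ e => e.bd M
  | write a e => a.bd M + e.bd M
  | put t b i e => (Exp.get t b i).bd M + e.bd M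
  | seq s s' => s.bd M + s'.bd M
  | branch e s s' => e.bd M + s.bd M + s'.bd M
  | rep e s => e.bd M + s.bd M + 1

section
variable {off M : ℕ} {Q : State → Prop} {σ : State}
@[simp] theorem wp_skip : skip.wp off M Q σ ↔ Q σ := Iff.rfl
@[simp] theorem wp_assign {v : ℕ} {e : Exp} : (assign v e).wp off M Q σ ↔
    e.Safe off σ ∧ e.eval σ ≤ M ∧ Q (σ.setVar v (e.eval σ) (e.cost + 2)) := Iff.rfl
@[simp] theorem wp_write {a e : Exp} : (write a e).wp off M Q σ ↔
    a.Safe off σ ∧ e.Safe off σ ∧ a.eval σ < off ∧ e.eval σ ≤ M ∧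
      Q (σ.setLow (a.eval σ) (e.eval σ) (a.cost + e.cost + 1)) := Iff.rfl
@[simp] theorem wp_put {t : Fin 8} {b i e : Exp} : (put t b i e).wp off M Q σ ↔
    b.Safe off σ ∧ i.Safe off σ ∧ e.Safe off σ ∧ e.eval σ ≤ M ∧
      Q (σ.setTab t (b.eval σ) (i.eval σ) (e.eval σ)
        (2 * b.cost + 3 * i.cost + e.cost + 16)) := Iff.rfl
@[simp] theorem wp_seq_iff {s s' : Stmt} :
    (seq s s').wp off M Q σ ↔ s.wp off M (s'.wp off M Q) σ := Iff.rfl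
@[simp] theorem wp_branch {e : Exp} {s s' : Stmt} : (branch e s s').wp off M Q σ ↔ e.Safe off σ ∧
    (e.eval σ ≠ 0 → s.wp off M (fun τ => Q (τ.tick 2)) (σ.tick (e.cost + 1))) ∧
    (e.eval σ = 0 → s'.wp off M Q (σ.tick (e.cost + 1))) := Iff.rfl
end

theorem wp_mono {off M : ℕ} {s : Stmt} {Q Q' : State → Prop} (h : ∀ τ, Q τ → Q' τ) {σ : State}
    (hs : s.wp off M Q σ) : s.wp off M Q' σ := by
  induction s generalizing Q Q' σ with
  | skip => exact h _ hs
  | assign v e => exact ⟨hs.1, hs.2.1, h _ hs.2.2⟩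
  | write a e => exact ⟨hs.1, hs.2.1, hs.2.2.1, hs.2.2.2.1, h _ hs.2.2.2.2⟩
  | put t b i e => exact ⟨hs.1, hs.2.1, hs.2.2.1, hs.2.2.2.1, h _ hs.2.2.2.2⟩
  | seq s s' ih ih' => exact ih (fun τ hτ => ih' h hτ) hs
  | branch e s s' ih ih' =>
    exact ⟨hs.1, fun he => ih (fun τ hτ => h _ hτ) (hs.2.1 he), fun he => ih' h (hs.2.2 he)⟩
  | rep e s ih =>
    refine ⟨hs.1, ?_⟩
    have key : ∀ n : ℕ, ∀ {R R' : State → Prop}, (∀ τ, R τ → R' τ) → ∀ τ,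
        (fun R τ => s.wp off M (fun τ' => R (τ'.tick 4)) (τ.tick 1))^[n] R τ →
        (fun R τ => s.wp off M (fun τ' => R (τ'.tick 4)) (τ.tick 1))^[n] R' τ := by
      intro n
      induction n with
      | zero => intro R R' hR τ; exact hR τ
      | succ n ihn =>
        intro R R' hR τ hτ
        rw [Function.iterate_succ_apply] at hτ ⊢
        exact ihn (fun τ hτ => ih (fun τ' hτ' => hR _ hτ') hτ) _ hτ
    exact key _ (fun τ hτ => h _ hτ) _ hs.2

/-- The number of rounds is fixed on entry, so the precondition is a known iterate of one predicate
transformer, and induction on the number of remaining rounds applies. The ticks are part of the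
statement so that invariants may speak about the clock. -/
theorem wp_rep_of_invariant {off M : ℕ} {e : Exp} {s : Stmt} {Q : State → Prop} {σ : State}
    (I : ℕ → State → Prop) (he : e.Safe off σ) (h0 : I 0 (σ.tick e.cost))
    (hs : ∀ k τ, k < e.eval σ → I k τ → s.wp off M (fun τ' => I (k + 1) (τ'.tick 4)) (τ.tick 1))
    (hQ : ∀ τ, I (e.eval σ) τ → Q (τ.tick 1)) : (rep e s).wp off M Q σ := by
  refine ⟨he, ?_⟩
  suffices h : ∀ l k : ℕ, k + l = e.eval σ → ∀ τ, I k τ →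
      (fun R τ => s.wp off M (fun τ' => R (τ'.tick 4)) (τ.tick 1))^[l]
        (fun τ => Q (τ.tick 1)) τ from h _ 0 (by omega) _ h0
  intro l
  induction l with
  | zero => intro k hk τ hτ; exact hQ τ (hk ▸ hτ)
  | succ l ih =>
    intro k hk τ hτ
    rw [Function.iterate_succ_apply']
    exact wp_mono (fun τ' hτ' => ih (k + 1) (by omega) _ hτ') (hs k τ (by omega) hτ)

/-- The variables a statement may change. -/
def modsVar : Stmt → ℕ → Bool
  | skip, _ => false
  | assign w _, v => v == w
  | write _ _, _ => false
  | put _ _ _ _, _ => false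
  | seq s s', v => s.modsVar v || s'.modsVar v
  | branch _ s s', v => s.modsVar v || s'.modsVar v
  | rep _ s, v => s.modsVar v

/-- The families of tables a statement may change. -/
def modsTab : Stmt → Fin 8 → Bool
  | skip, _ => false
  | assign _ _, _ => false
  | write _ _, _ => false
  | put t' _ _ _, t => t == t'
  | seq s s', t => s.modsTab t || s'.modsTab t
  | branch _ s s', t => s.modsTab t || s'.modsTab t
  | rep _ s, t => s.modsTab t

def modsLow : Stmt → Bool
  | write _ _ => true
  | seq s s' => s.modsLow || s'.modsLow
  | branch _ s s' => s.modsLow || s'.modsLow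
  | rep _ s => s.modsLow
  | _ => false

def flat : Stmt → Bool
  | rep _ _ => false
  | seq s s' => s.flat && s'.flat
  | branch _ s s' => s.flat && s'.flat
  | _ => true

/-- An upper bound for the running time of statements without loops. -/
def cost : Stmt → ℕ
  | skip => 0
  | assign _ e => e.cost + 2
  | write a e => a.cost + e.cost + 1
  | put _ b i e => 2 * b.cost + 3 * i.cost + e.cost + 16
  | seq s s' => s.cost + s'.cost
  | branch e s s' => e.cost + s.cost + s'.cost + 3
  | rep e s => e.cost + s.cost

/-- What a run of `s` from `σ` to `τ` leaves unchanged. -/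
structure Frame (s : Stmt) (σ τ : State) : Prop where
  var : ∀ v, s.modsVar v = false → τ.var v = σ.var v
  tab : ∀ t, s.modsTab t = false → τ.tab t = σ.tab t
  low : s.modsLow = false → τ.low = σ.low
  le_time : σ.time ≤ τ.time
  time : s.flat = true → τ.time ≤ σ.time + s.cost

/-- Specifications can stay silent about everything a statement does not touch. What it may touch is
computed from the syntax, so each later appeal to the frame is closed by `rfl`; for statements
without loops the frame also bounds the time. -/
theorem wp_and_frame {off M : ℕ} {s : Stmt} {Q : State → Prop} {σ : State}
    (hs : s.wp off M Q σ) : s.wp off M (fun τ => Q τ ∧ s.Frame σ τ) σ := by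
  induction s generalizing Q σ with
  | skip => exact ⟨hs, fun _ _ => rfl, fun _ _ => rfl, fun _ => rfl, le_rfl, fun _ => le_rfl⟩
  | assign v e =>
    refine ⟨hs.1, hs.2.1, hs.2.2, ?_, fun _ _ => rfl, fun _ => rfl, by simp, fun _ => le_rfl⟩
    intro w hw
    simp only [modsVar, beq_eq_false_iff_ne] at hw
    simp [hw]
  | write a e =>
    exact ⟨hs.1, hs.2.1, hs.2.2.1, hs.2.2.2.1, hs.2.2.2.2, fun _ _ => rfl, fun _ _ => rfl,
      fun h => by simp [modsLow] at h, by simp, fun _ => le_rfl⟩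
  | put t b i e =>
    refine ⟨hs.1, hs.2.1, hs.2.2.1, hs.2.2.2.1, hs.2.2.2.2, fun _ _ => rfl, fun t' h => ?_,
      fun _ => rfl, by simp, fun _ => le_rfl⟩
    simp only [modsTab, beq_eq_false_iff_ne] at h
    funext b' i'
    simp [h]
  | seq s s' ih ih' =>
    refine wp_mono (s := s) ?_ (ih hs)
    rintro τ ⟨hτ, hf⟩
    refine wp_mono ?_ (ih' hτ)
    rintro τ' ⟨hτ', hf'⟩
    refine ⟨hτ', fun v hv => ?_, fun t ht => ?_, fun h => ?_, hf.le_time.trans hf'.le_time,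
      fun h => ?_⟩
    · simp only [modsVar, Bool.or_eq_false_iff] at hv
      rw [hf'.var v hv.2, hf.var v hv.1]
    · simp only [modsTab, Bool.or_eq_false_iff] at ht
      rw [hf'.tab t ht.2, hf.tab t ht.1]
    · simp only [modsLow, Bool.or_eq_false_iff] at h
      rw [hf'.low h.2, hf.low h.1]
    · simp only [flat, Bool.and_eq_true] at h
      have := hf'.time h.2
      have := hf.time h.1
      simp only [cost]; omega
  | branch e s s' ih ih' =>
    refine ⟨hs.1, fun he => wp_mono ?_ (ih (hs.2.1 he)), fun he => wp_mono ?_ (ih' (hs.2.2 he))⟩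
    all_goals
      rintro τ ⟨hτ, hf⟩
      refine ⟨hτ, fun v hv => ?_, fun t ht => ?_, fun h => ?_, ?_, fun h => ?_⟩
      · simp only [modsVar, Bool.or_eq_false_iff] at hv
        first | exact hf.var v hv.1 | exact hf.var v hv.2
      · simp only [modsTab, Bool.or_eq_false_iff] at ht
        first | exact hf.tab t ht.1 | exact hf.tab t ht.2
      · simp only [modsLow, Bool.or_eq_false_iff] at h
        first | exact hf.low h.1 | exact hf.low h.2
      · have := hf.le_time
        simp only [State.tick_time] at this ⊢; omega
      · simp only [flat, Bool.and_eq_true] at h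
        have := hf.time (by first | exact h.1 | exact h.2)
        simp only [State.tick_time] at this ⊢
        simp only [cost]; omega
  | rep e s ih =>
    set F : (State → Prop) → State → Prop :=
      fun R τ => s.wp off M (fun τ' => R (τ'.tick 4)) (τ.tick 1) with hF
    refine wp_rep_of_invariant (fun k τ => F^[e.eval σ - k] (fun τ => Q (τ.tick 1)) τ ∧
        (∀ v, s.modsVar v = false → τ.var v = σ.var v) ∧
        (∀ t, s.modsTab t = false → τ.tab t = σ.tab t) ∧
        (s.modsLow = false → τ.low = σ.low) ∧ σ.time ≤ τ.time) hs.1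
      ⟨hs.2, fun _ _ => rfl, fun _ _ => rfl, fun _ => rfl, by simp⟩ ?_ ?_
    · rintro k τ hk ⟨h, hv, ht, hl, hti⟩
      rw [show e.eval σ - k = (e.eval σ - (k + 1)) + 1 by omega,
        Function.iterate_succ_apply'] at h
      refine wp_mono ?_ (ih h)
      rintro τ' ⟨h', hf⟩
      refine ⟨h', fun v h => ?_, fun t h => ?_, fun h => ?_, ?_⟩
      · simpa [hf.var v h] using hv v h
      · simpa [hf.tab t h] using ht t h
      · simpa [hf.low h] using hl h
      · have := hf.le_time
        simp only [State.tick_time] at this ⊢; omega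
    · rintro τ ⟨h, hv, ht, hl, hti⟩
      rw [Nat.sub_self] at h
      exact ⟨h, hv, ht, hl, hti.trans (by simp), fun h => by simp [flat] at h⟩

theorem wp_seq {off M : ℕ} {s s' : Stmt} {Q R : State → Prop} {σ : State}
    (h : s.wp off M R σ) (h' : ∀ τ, R τ → s.Frame σ τ → s'.wp off M Q τ) :
    (s.seq s').wp off M Q σ :=
  wp_mono (s := s) (fun τ hτ => h' τ hτ.1 hτ.2) (wp_and_frame h)

/-- The rule for loops with a bound `c` for the time of one iteration. -/
theorem wp_rep {off M : ℕ} {e : Exp} {s : Stmt} {Q : State → Prop} {σ : State}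
    (I : ℕ → State → Prop) (c : ℕ) (he : e.Safe off σ)
    (hI : ∀ k τ t, I k τ → I k (τ.tick t))
    (h0 : I 0 σ)
    (hs : ∀ k τ, k < e.eval σ → I k τ → (rep e s).Frame σ τ →
      s.wp off M (fun τ' => I (k + 1) τ' ∧ τ'.time ≤ τ.time + c) τ)
    (hQ : ∀ τ, I (e.eval σ) τ → (rep e s).Frame σ τ →
      τ.time ≤ σ.time + e.cost + 1 + e.eval σ * (c + 5) → Q τ) :
    (rep e s).wp off M Q σ := by
  suffices h : (rep e s).wp off M (fun τ => I (e.eval σ) τ ∧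
      τ.time ≤ σ.time + e.cost + 1 + e.eval σ * (c + 5)) σ from
    wp_mono (fun τ hτ => hQ τ hτ.1.1 hτ.2 hτ.1.2) (wp_and_frame h)
  -- Besides its body, a round costs one step for the test and four for decrementing the counter and
  -- jumping back, hence `c + 5`.
  refine wp_rep_of_invariant (fun k τ => I k τ ∧ (rep e s).Frame σ τ ∧
    τ.time ≤ σ.time + e.cost + k * (c + 5)) he
    ⟨hI _ _ _ h0, ⟨fun _ _ => rfl, fun _ _ => rfl, fun _ => rfl, by simp,
      fun h => by simp [flat] at h⟩, by simp⟩ ?_ ?_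
  · rintro k τ hk ⟨hIk, hf, hti⟩
    have hf1 : (rep e s).Frame σ (τ.tick 1) := ⟨hf.var, hf.tab, hf.low,
      hf.le_time.trans (by simp), fun h => by simp [flat] at h⟩
    refine wp_mono ?_ (wp_and_frame (hs k (τ.tick 1) hk (hI _ _ _ hIk) hf1))
    rintro τ' ⟨⟨h1, h2⟩, hf'⟩
    refine ⟨hI _ _ _ h1, ⟨fun v h => ?_, fun t h => ?_, fun h => ?_, ?_,
      fun h => by simp [flat] at h⟩, ?_⟩
    · rw [← hf1.var v h, ← hf'.var v h]; rfl
    · rw [← hf1.tab t h, ← hf'.tab t h]; rfl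
    · rw [← hf1.low h, ← hf'.low h]; rfl
    · have := hf1.le_time.trans hf'.le_time
      simp only [State.tick_time] at this ⊢; omega
    · simp only [State.tick_time] at h2 ⊢
      rw [add_one_mul]; omega
  · rintro τ ⟨hIk, hf, hti⟩
    exact ⟨hI _ _ _ hIk, by simp only [State.tick_time]; omega⟩

/-- The rule for loops whose body has no loops. -/
theorem wp_rep_flat {off M : ℕ} {e : Exp} {s : Stmt} {Q : State → Prop} {σ : State}
    (I : ℕ → State → Prop) (hfl : s.flat = true) (he : e.Safe off σ)
    (hI : ∀ k τ t, I k τ → I k (τ.tick t))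
    (h0 : I 0 σ)
    (hs : ∀ k τ, k < e.eval σ → I k τ → (rep e s).Frame σ τ → s.wp off M (I (k + 1)) τ)
    (hQ : ∀ τ, I (e.eval σ) τ → (rep e s).Frame σ τ →
      τ.time ≤ σ.time + e.cost + 1 + e.eval σ * (s.cost + 5) → Q τ) :
    (rep e s).wp off M Q σ :=
  wp_rep I s.cost he hI h0 (fun k τ hk hIk hf => wp_mono
    (fun _ hτ' => ⟨hτ'.1, hτ'.2.time hfl⟩) (wp_and_frame (hs k τ hk hIk hf))) hQ

end Stmt
end RAM
namespace RAM

/-! ### Compilation to machine code -/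

/-- The code `l` stands in the program `P` from position `pc` on. -/
def CodeAt (P : Program) (pc : ℕ) (l : List Instr) : Prop :=
  ∃ pre post, P = pre ++ l ++ post ∧ pre.length = pc

theorem CodeAt.left {P : Program} {pc : ℕ} {l l' : List Instr} (h : CodeAt P pc (l ++ l')) :
    CodeAt P pc l := by
  obtain ⟨pre, post, rfl, rfl⟩ := h
  exact ⟨pre, l' ++ post, by simp, rfl⟩

theorem CodeAt.right {P : Program} {pc : ℕ} {l l' : List Instr} (h : CodeAt P pc (l ++ l')) :
    CodeAt P (pc + l.length) l' := by
  obtain ⟨pre, post, rfl, rfl⟩ := h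
  exact ⟨pre ++ l, post, by simp, by simp⟩

theorem CodeAt.tail {P : Program} {pc : ℕ} {i : Instr} {l : List Instr}
    (h : CodeAt P pc (i :: l)) : CodeAt P (pc + 1) l :=
  CodeAt.right (l := [i]) h

theorem CodeAt.step {P : Program} {pc : ℕ} {i : Instr} {l : List Instr}
    (h : CodeAt P pc (i :: l)) {c : Config} (hc : c.pc = pc) : step P c = i.exec c := by
  obtain ⟨pre, post, rfl, rfl⟩ := h
  simp [RAM.step, hc]

/-- All numbers in a configuration are at most `B`. -/
def Config.Bounded (B : ℕ) (c : Config) : Prop := ∀ i, c.reg i ≤ B ∧ c.mem i ≤ B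

/-- `t` steps lead from `c` to `c'`, and all numbers are at most `B` on the way. -/
def Reach (P : Program) (B t : ℕ) (c c' : Config) : Prop :=
  (step P)^[t] c = c' ∧ ∀ t' ≤ t, ((step P)^[t'] c).Bounded B

theorem Reach.refl {P : Program} {B : ℕ} {c : Config} (h : c.Bounded B) : Reach P B 0 c c :=
  ⟨rfl, fun t' ht => by rw [Nat.le_zero.1 ht]; exact h⟩

theorem Reach.trans {P : Program} {B t t' : ℕ} {c c' c'' : Config} (h : Reach P B t c c')
    (h' : Reach P B t' c' c'') : Reach P B (t + t') c c'' := by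
  refine ⟨by rw [add_comm, Function.iterate_add_apply, h.1, h'.1], fun u hu => ?_⟩
  by_cases hut : u ≤ t
  · exact h.2 u hut
  · have := h'.2 (u - t) (by omega)
    rwa [← h.1, ← Function.iterate_add_apply, Nat.sub_add_cancel (by omega)] at this

theorem Reach.bounded {P : Program} {B t : ℕ} {c c' : Config} (h : Reach P B t c c') :
    c'.Bounded B := h.1 ▸ h.2 t le_rfl

theorem Reach.single {P : Program} {B pc : ℕ} {i : Instr} {l : List Instr} {c : Config}
    (h : CodeAt P pc (i :: l)) (hc : c.pc = pc) (hb : c.Bounded B) (hb' : (i.exec c).Bounded B) :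
    Reach P B 1 c (i.exec c) := by
  refine ⟨h.step hc, fun t' ht => ?_⟩
  interval_cases t'
  · exact hb
  · rw [Function.iterate_one, h.step hc]; exact hb'

theorem Config.Bounded.setReg {B : ℕ} {c : Config} (h : c.Bounded B) (pc d v : ℕ) (hv : v ≤ B) :
    Config.Bounded B ⟨pc, Function.update c.reg d v, c.mem⟩ := by
  intro i
  refine ⟨?_, (h i).2⟩
  by_cases hi : i = d
  · simp [hi, hv]
  · simp [hi, (h i).1]

theorem Config.Bounded.setMem {B : ℕ} {c : Config} (h : c.Bounded B) (pc d v : ℕ) (hv : v ≤ B) :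
    Config.Bounded B ⟨pc, c.reg, Function.update c.mem d v⟩ := by
  intro i
  refine ⟨(h i).1, ?_⟩
  by_cases hi : i = d
  · simp [hi, hv]
  · simp [hi, (h i).2]

theorem Config.Bounded.setPc {B : ℕ} {c : Config} (h : c.Bounded B) (pc : ℕ) :
    Config.Bounded B ⟨pc, c.reg, c.mem⟩ := h

/-- The address of a table entry, relative to the end of the raw memory. -/
def cell (t : Fin 8) (b i : ℕ) : ℕ := (8 * b + t + i) * (8 * b + t + i) + i

/-- With s = 8b + t + i one has i ≤ s, so s² + i lies below (s + 1)² and determines s and i; then 8b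
+ t is known, and t < 8 separates b from t. Polynomially large addresses thus hold unbounded
two-dimensional tables, and the zero initial memory makes it unnecessary to clear them. -/
theorem cell_inj {t t' : Fin 8} {b b' i i' : ℕ} :
    cell t b i = cell t' b' i' ↔ t = t' ∧ b = b' ∧ i = i' := by
  refine ⟨fun h => ?_, by rintro ⟨rfl, rfl, rfl⟩; rfl⟩
  unfold cell at h
  have hs : 8 * b + t + i = 8 * b' + t' + i' := by
    rcases lt_trichotomy (8 * b + t + i) (8 * b' + t' + i') with h' | h' | h'
    · have h1 := Nat.mul_self_le_mul_self (Nat.succ_le_of_lt h')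
      simp only [Nat.succ_eq_add_one] at h1
      nlinarith
    · exact h'
    · have h1 := Nat.mul_self_le_mul_self (Nat.succ_le_of_lt h')
      simp only [Nat.succ_eq_add_one] at h1
      nlinarith
  rw [hs] at h
  have := t.2
  have := t'.2
  refine ⟨Fin.ext ?_, ?_, ?_⟩ <;> omega

/-- The machine configuration `c` represents the state `σ`: variable `v` is register `2 * v`,
register `1` holds the size `off` of the raw memory, the other odd registers are temporary. -/
structure Rel (off : ℕ) (σ : State) (c : Config) : Prop where
  reg_off : c.reg 1 = off
  var : ∀ v, c.reg (2 * v) = σ.var v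
  low : ∀ a < off, c.mem a = σ.low a
  tab : ∀ t b i, c.mem (off + cell t b i) = σ.tab t b i

/-- The effect of code that computes `v` into the `d`-th temporary register. -/
structure Eff (d v : ℕ) (l : List Instr) (c c' : Config) : Prop where
  pc : c'.pc = c.pc + l.length
  mem : c'.mem = c.mem
  val : c'.reg (2 * d + 1) = v
  reg : ∀ r, r % 2 = 0 ∨ r < 2 * d + 1 → c'.reg r = c.reg r

theorem Eff.rel {off d v : ℕ} {l : List Instr} {c c' : Config} {σ : State} (h : Eff d v l c c')
    (hd : 1 ≤ d) (hr : Rel off σ c) : Rel off σ c' :=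
  ⟨by rw [h.reg 1 (by omega), hr.reg_off], fun v => by rw [h.reg _ (by omega), hr.var],
    fun a ha => by rw [h.mem, hr.low a ha], fun t b i => by rw [h.mem, hr.tab]⟩

/-- Code, depending on the number of the first free temporary register, that computes `v`. -/
def Computes (off B : ℕ) (σ : State) (f : ℕ → List Instr) (v : ℕ) : Prop :=
  ∀ d, 1 ≤ d → ∀ P pc c, CodeAt P pc (f d) → c.pc = pc → c.Bounded B → Rel off σ c →
    ∃ c', Reach P B (f d).length c c' ∧ Eff d v (f d) c c'

def constCode (n : ℕ) : ℕ → List Instr := fun d => [.const (2 * d + 1) n]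

/-- The machine has no move instruction, so the target is cleared and the source added to it; the
source must therefore differ from the target. -/
def regCode (r : ℕ) : ℕ → List Instr :=
  fun d => [.const (2 * d + 1) 0, .arith .add (2 * d + 1) r (2 * d + 1)]

/-- The second operand is computed with the next temporary register, so that the value of the first
survives. -/
def opCode (o : Op) (f g : ℕ → List Instr) : ℕ → List Instr :=
  fun d => f d ++ g (d + 1) ++ [.arith o (2 * d + 1) (2 * d + 1) (2 * (d + 1) + 1)]

def loadCode (f : ℕ → List Instr) : ℕ → List Instr :=
  fun d => f d ++ [.load (2 * d + 1) (2 * d + 1)]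

section
variable {off B : ℕ} {σ : State}

theorem computes_const {n : ℕ} (hn : n ≤ B) : Computes off B σ (constCode n) n := by
  intro d hd P pc c hcode hpc hb hr
  refine ⟨_, Reach.single hcode hpc hb (hb.setReg _ _ _ hn), rfl, rfl, ?_, fun r hrd => ?_⟩
  · simp [Instr.exec]
  · exact Function.update_of_ne (by omega) _ _

theorem computes_reg {r v : ℕ} (hv : ∀ c, Rel off σ c → c.reg r = v) (hr1 : r % 2 = 0 ∨ r = 1)
    (hvB : v ≤ B) : Computes off B σ (regCode r) v := by
  intro d hd P pc c hcode hpc hb hr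
  have h1 := Reach.single hcode hpc hb (hb.setReg _ _ _ (Nat.zero_le _))
  have hval : (Instr.exec (.arith .add (2 * d + 1) r (2 * d + 1))
      (Instr.exec (.const (2 * d + 1) 0) c)).reg (2 * d + 1) = v := by
    have : r ≠ 2 * d + 1 := by omega
    simp [Instr.exec, Op.eval, this, hv c hr]
  have h2 := Reach.single (c := (Instr.const (2 * d + 1) 0).exec c) hcode.tail
    (by simp [Instr.exec, hpc]) h1.bounded
    (h1.bounded.setReg _ _ _ (by
      simp only [Instr.exec, Function.update_self] at hval ⊢
      rw [hval]; exact hvB))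
  refine ⟨_, h1.trans h2, by simp [Instr.exec, regCode], rfl, hval, fun r' hrd => ?_⟩
  have : r' ≠ 2 * d + 1 := by omega
  simp [Instr.exec, this]

theorem computes_op {o : Op} {f g : ℕ → List Instr} {v w : ℕ} (hf : Computes off B σ f v)
    (hg : Computes off B σ g w) (hB : o.eval v w ≤ B) :
    Computes off B σ (opCode o f g) (o.eval v w) := by
  intro d hd P pc c hcode hpc hb hr
  obtain ⟨c1, h1, e1⟩ := hf d hd P pc c hcode.left.left hpc hb hr
  obtain ⟨c2, h2, e2⟩ := hg (d + 1) (by omega) P _ c1 hcode.left.right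
    (by rw [e1.pc, hpc]) h1.bounded (e1.rel hd hr)
  have hv : c2.reg (2 * d + 1) = v := by rw [e2.reg _ (by omega), e1.val]
  have h3 := Reach.single (c := c2) (i := .arith o (2 * d + 1) (2 * d + 1) (2 * (d + 1) + 1))
    hcode.right (by rw [e2.pc, e1.pc, hpc, List.length_append]; omega) h2.bounded
    (h2.bounded.setReg _ _ _ (by rw [hv, e2.val]; exact hB))
  refine ⟨_, by simpa [opCode, add_assoc] using (h1.trans h2).trans h3, ?_, ?_, ?_,
    fun r hrd => ?_⟩
  · simp [Instr.exec, opCode, e2.pc, e1.pc]; omega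
  · simp [Instr.exec, e2.mem, e1.mem]
  · simp [Instr.exec, hv, e2.val]
  · have : r ≠ 2 * d + 1 := by omega
    simp only [Instr.exec, Function.update_of_ne this]
    rw [e2.reg r (by omega), e1.reg r hrd]

theorem computes_load {f : ℕ → List Instr} {a v : ℕ} (hf : Computes off B σ f a)
    (hv : ∀ c, Rel off σ c → c.mem a = v) : Computes off B σ (loadCode f) v := by
  intro d hd P pc c hcode hpc hb hr
  obtain ⟨c1, h1, e1⟩ := hf d hd P pc c hcode.left hpc hb hr
  have h2 := Reach.single (c := c1) (i := .load (2 * d + 1) (2 * d + 1))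
    hcode.right (by rw [e1.pc, hpc]) h1.bounded
    (h1.bounded.setReg _ _ _ (h1.bounded _).2)
  refine ⟨_, by simpa [loadCode] using h1.trans h2, ?_, ?_, ?_, fun r hrd => ?_⟩
  · simp [Instr.exec, loadCode, e1.pc]; omega
  · simp [Instr.exec, e1.mem]
  · simp [Instr.exec, e1.val, hv c1 (e1.rel hd hr)]
  · have : r ≠ 2 * d + 1 := by omega
    simp only [Instr.exec, Function.update_of_ne this]
    rw [e1.reg r hrd]

/-- The code for the address of a table entry. -/
def addrCode (t : Fin 8) (f g : ℕ → List Instr) : ℕ → List Instr :=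
  let h := opCode .add (opCode .add (opCode .mul (constCode 8) f) (constCode t)) g
  opCode .add (regCode 1) (opCode .add (opCode .mul h h) g)

theorem computes_addr {t : Fin 8} {f g : ℕ → List Instr} {b i : ℕ} (hf : Computes off B σ f b)
    (hg : Computes off B σ g i)
    (hB : off + (8 * b + 8 + i) * (8 * b + 8 + i) + i ≤ B) :
    Computes off B σ (addrCode t f g) (off + cell t b i) := by
  have ht := t.2
  have hle := Nat.le_mul_self (8 * b + 8 + i)
  have hle' : (8 * b + t + i) * (8 * b + t + i) ≤ (8 * b + 8 + i) * (8 * b + 8 + i) :=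
    Nat.mul_self_le_mul_self (by omega)
  have h1 := computes_op (o := .mul) (computes_const (off := off) (B := B) (σ := σ) (n := 8)
    (by omega)) hf (by simp only [Op.eval]; omega)
  have h2 := computes_op (o := .add) h1 (computes_const (n := t) (by omega))
    (by simp only [Op.eval]; omega)
  have h3 := computes_op (o := .add) h2 hg (by simp only [Op.eval]; omega)
  have h4 := computes_op (o := .mul) h3 h3 (by simp only [Op.eval]; omega)
  have h5 := computes_op (o := .add) h4 hg (by simp only [Op.eval]; omega)
  simp only [Op.eval] at h5
  exact computes_op (o := .add) (computes_reg (r := 1) (fun c hr => hr.reg_off) (by omega)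
    (by omega)) h5 (by simp only [Op.eval]; unfold cell at *; omega)

end

def Exp.code : Exp → ℕ → List Instr
  | var v => regCode (2 * v)
  | const c => constCode c
  | op o a b => opCode o a.code b.code
  | low a => loadCode a.code
  | get t b i => loadCode (addrCode t b.code i.code)

/-- The square in the address is formed by evaluating its base twice, and `i` is added once more;
hence the code of `b` occurs twice and that of `i` three times. -/
theorem addrCode_length {t : Fin 8} {f g : ℕ → List Instr} {m n : ℕ} (hf : ∀ d, (f d).length = m)
    (hg : ∀ d, (g d).length = n) (d : ℕ) : (addrCode t f g d).length = 2 * m + 3 * n + 15 := by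
  simp [addrCode, opCode, constCode, regCode, hf, hg]; omega

theorem Exp.length_code (e : Exp) : ∀ d, (e.code d).length = e.cost := by
  induction e with
  | var v => intro d; rfl
  | const c => intro d; rfl
  | op o a b iha ihb => intro d; simp [code, opCode, cost, iha, ihb]; omega
  | low a ih => intro d; simp [code, loadCode, cost, ih]
  | get t b i ihb ihi => intro d; simp [code, loadCode, cost, addrCode_length ihb ihi]

/-- All numbers in a state are at most `M`. -/
structure State.Bounded (off M : ℕ) (σ : State) : Prop where
  off_le : off ≤ M
  var : ∀ v, σ.var v ≤ M
  low : ∀ a < off, σ.low a ≤ M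
  tab : ∀ t b i, σ.tab t b i ≤ M

theorem Op.eval_le (o : Op) {a b a' b' : ℕ} (ha : a ≤ a') (hb : b ≤ b') :
    o.eval a b ≤ a' + b' + a' * b' := by
  have := Nat.mul_le_mul ha hb
  have := Nat.div_le_self a b
  cases o <;> simp only [eval] <;> omega

theorem Exp.eval_le {off M : ℕ} {σ : State} (hσ : σ.Bounded off M) (e : Exp)
    (he : e.Safe off σ) : e.eval σ ≤ e.bd M := by
  induction e with
  | var v => exact hσ.var v
  | const c => exact le_rfl
  | op o a b iha ihb => exact o.eval_le (iha he.1) (ihb he.2)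
  | low a ih => exact (hσ.low _ he.2).trans (Nat.le_add_left _ _)
  | get t b i ihb ihi =>
    exact (hσ.tab t _ _).trans (by simp only [bd]; omega)

theorem Exp.get_bd_le {off M : ℕ} {σ : State} (hσ : σ.Bounded off M) {t : Fin 8} {b i : Exp}
    (hb : b.Safe off σ) (hi : i.Safe off σ) :
    off + (8 * b.eval σ + 8 + i.eval σ) * (8 * b.eval σ + 8 + i.eval σ) + i.eval σ ≤
      (get t b i).bd M := by
  have h1 := eval_le hσ b hb
  have h2 := eval_le hσ i hi
  have := hσ.off_le
  simp only [bd]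
  gcongr

theorem Exp.le_get_bd {M : ℕ} {t : Fin 8} {b i : Exp} :
    b.bd M ≤ (get t b i).bd M ∧ i.bd M ≤ (get t b i).bd M := by
  have := Nat.le_mul_self (8 * b.bd M + 8 + i.bd M)
  simp only [bd]
  omega

theorem Exp.computes {off M B : ℕ} {σ : State} (hσ : σ.Bounded off M) (e : Exp)
    (he : e.Safe off σ) (hB : e.bd M ≤ B) : Computes off B σ e.code (e.eval σ) := by
  induction e with
  | var v => exact computes_reg (fun c hr => hr.var v) (by omega) ((hσ.var v).trans hB)
  | const c => exact computes_const hB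
  | op o a b iha ihb =>
    simp only [bd] at hB
    exact computes_op (iha he.1 (by omega)) (ihb he.2 (by omega))
      ((o.eval_le (eval_le hσ a he.1) (eval_le hσ b he.2)).trans hB)
  | low a ih =>
    exact computes_load (ih he.1 ((Nat.le_add_right _ _).trans hB)) fun c hr => hr.low _ he.2
  | get t b i ihb ihi =>
    exact computes_load (computes_addr (ihb he.1 (le_get_bd.1.trans hB))
      (ihi he.2 (le_get_bd.2.trans hB)) ((get_bd_le hσ he.1 he.2).trans hB))
      fun c hr => hr.tab _ _ _

namespace Stmt

/-- An unconditional jump is a test of a register just set to `0`, which gives the two extra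
instructions between the branches. A loop body is followed by four: load `1`, subtract, load `0`,
jump back. These are the ticks in `wp`. -/
def len : Stmt → ℕ
  | skip => 0
  | assign _ e => e.cost + 2
  | write a e => a.cost + e.cost + 1
  | put _ b i e => 2 * b.cost + 3 * i.cost + e.cost + 16
  | seq s s' => s.len + s'.len
  | branch e s s' => e.cost + 1 + s.len + 2 + s'.len
  | rep e s => e.cost + 1 + s.len + 4

/-- The code of a statement, for the first free temporary register `d` and position `pc`. -/
def code : Stmt → ℕ → ℕ → List Instr
  | skip, _, _ => []
  | assign v e, d, _ => e.code d ++
      [.const (2 * (d + 1) + 1) 0, .arith .add (2 * v) (2 * d + 1) (2 * (d + 1) + 1)]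
  | write a e, d, _ => a.code d ++ e.code (d + 1) ++ [.store (2 * d + 1) (2 * (d + 1) + 1)]
  | put t b i e, d, _ => addrCode t b.code i.code d ++ e.code (d + 1) ++
      [.store (2 * d + 1) (2 * (d + 1) + 1)]
  | seq s s', d, pc => s.code d pc ++ s'.code d (pc + s.len)
  | branch e s s', d, pc => e.code d ++
      ([.jumpIfZero (2 * d + 1) (pc + e.cost + 1 + s.len + 2)] ++ (s.code d (pc + e.cost + 1) ++
        ([.const (2 * d + 1) 0, .jumpIfZero (2 * d + 1) (pc + e.cost + 1 + s.len + 2 + s'.len)] ++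
          s'.code d (pc + e.cost + 1 + s.len + 2))))
  | rep e s, d, pc => e.code d ++
      ([.jumpIfZero (2 * d + 1) (pc + e.cost + 1 + s.len + 4)] ++
        (s.code (d + 1) (pc + e.cost + 1) ++
          [.const (2 * (d + 1) + 1) 1, .arith .sub (2 * d + 1) (2 * d + 1) (2 * (d + 1) + 1),
            .const (2 * (d + 1) + 1) 0, .jumpIfZero (2 * (d + 1) + 1) (pc + e.cost)]))

theorem length_code (s : Stmt) : ∀ d pc, (s.code d pc).length = s.len := by
  induction s with
  | skip => intros; rfl
  | assign v e => intros; simp [code, len, Exp.length_code]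
  | write a e => intros; simp [code, len, Exp.length_code]; omega
  | put t b i e =>
    intros; simp [code, len, Exp.length_code, addrCode_length b.length_code i.length_code]; omega
  | seq s s' ih ih' => intros; simp [code, len, ih, ih']
  | branch e s s' ih ih' => intros; simp [code, len, ih, ih', Exp.length_code]; omega
  | rep e s ih => intros; simp [code, len, ih, Exp.length_code]; omega

end Stmt

end RAM
-- Correctness of the compiler
namespace RAM

theorem Rel.tick {off : ℕ} {σ : State} {c : Config} (h : Rel off σ c) (n : ℕ) :
    Rel off (σ.tick n) c := ⟨h.reg_off, h.var, h.low, h.tab⟩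

theorem Rel.setPc {off : ℕ} {σ : State} {c : Config} (h : Rel off σ c) (n : ℕ) :
    Rel off σ ⟨n, c.reg, c.mem⟩ := ⟨h.reg_off, h.var, h.low, h.tab⟩

theorem Rel.setTemp {off : ℕ} {σ : State} {c : Config} (h : Rel off σ c) (pc d v : ℕ)
    (hd : 1 ≤ d) : Rel off σ ⟨pc, Function.update c.reg (2 * d + 1) v, c.mem⟩ :=
  ⟨(Function.update_of_ne (by omega) _ _).trans h.reg_off,
    fun w => (Function.update_of_ne (by omega) _ _).trans (h.var w), h.low, h.tab⟩

theorem State.Bounded.tick {off M : ℕ} {σ : State} (h : σ.Bounded off M) (n : ℕ) :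
    (σ.tick n).Bounded off M := ⟨h.off_le, h.var, h.low, h.tab⟩

/-- The machine runs from `c`, which represents `σ`, to the position `pc'` and a configuration
that represents a state with `Q`. -/
def Outcome (off M B : ℕ) (P : Program) (d pc' : ℕ) (Q : State → Prop) (σ : State) (c : Config) :
    Prop :=
  ∃ t c' σ', Reach P B t c c' ∧ σ'.time = σ.time + t ∧ c'.pc = pc' ∧ Rel off σ' c' ∧
    σ'.Bounded off M ∧ Q σ' ∧ ∀ r, r % 2 = 1 → r < 2 * d + 1 → c'.reg r = c.reg r

theorem Outcome.of_reach {off M B : ℕ} {P : Program} {d d' pc' t : ℕ} {Q : State → Prop}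
    {σ σ' : State} {c c' : Config} (h : Reach P B t c c') (ht : σ'.time = σ.time + t)
    (hr : ∀ r, r % 2 = 1 → r < 2 * d + 1 → c'.reg r = c.reg r) (hd : d ≤ d')
    (ho : Outcome off M B P d' pc' Q σ' c') : Outcome off M B P d pc' Q σ c := by
  obtain ⟨t1, c1, σ1, h1, ht1, hpc, hrel, hb, hQ, hr1⟩ := ho
  exact ⟨t + t1, c1, σ1, h.trans h1, by omega, hpc, hrel, hb, hQ,
    fun r h2 h3 => by rw [hr1 r h2 (by omega), hr r h2 h3]⟩

theorem Outcome.bind {off M B : ℕ} {P : Program} {d d' pc' pc'' : ℕ} {Q R : State → Prop}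
    {σ : State} {c : Config} (ho : Outcome off M B P d' pc' R σ c) (hd : d ≤ d')
    (h : ∀ σ' c', c'.pc = pc' → c'.Bounded B → Rel off σ' c' → σ'.Bounded off M → R σ' →
      (∀ r, r % 2 = 1 → r < 2 * d' + 1 → c'.reg r = c.reg r) →
      Outcome off M B P d pc'' Q σ' c') : Outcome off M B P d pc'' Q σ c := by
  obtain ⟨t1, c1, σ1, h1, ht1, hpc, hrel, hb, hQ, hr1⟩ := ho
  exact Outcome.of_reach h1 ht1 (fun r h2 h3 => hr1 r h2 (by omega)) le_rfl
    (h σ1 c1 hpc h1.bounded hrel hb hQ hr1)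

/-- The clock of the state advances by exactly the number of machine steps, so time bounds proved
with `wp` transfer without loss. Temporary registers below the `d`-th are preserved, which is what
keeps the counters of enclosing loops intact. -/
theorem Stmt.outcome {off M B : ℕ} {P : Program} (hM : M ≤ B) (h1B : 1 ≤ B) (s : Stmt) :
    ∀ {d pc : ℕ} {c : Config} {σ : State} {Q : State → Prop}, 1 ≤ d →
      CodeAt P pc (s.code d pc) → c.pc = pc → c.Bounded B → Rel off σ c → σ.Bounded off M →
      s.bd M ≤ B → s.wp off M Q σ → Outcome off M B P d (pc + s.len) Q σ c := by
  induction s with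
  | skip =>
    intro d pc c σ Q hd hcode hpc hb hr hσ hB hw
    exact ⟨0, c, σ, Reach.refl hb, rfl, hpc, hr, hσ, hw, fun _ _ _ => rfl⟩
  | assign v e =>
    intro d pc c σ Q hd hcode hpc hb hr hσ hB ⟨hs, hle, hQ⟩
    obtain ⟨c1, h1, e1⟩ := e.computes hσ hs hB d hd P pc c hcode.left hpc hb hr
    have hcode2 := hcode.right
    have h2 := Reach.single hcode2 (by rw [e1.pc, hpc]) h1.bounded
      (h1.bounded.setReg _ _ _ (Nat.zero_le _))
    have h3 := Reach.single (c := (Instr.const (2 * (d + 1) + 1) 0).exec c1) hcode2.tail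
      (by simp [Instr.exec, e1.pc, hpc]) h2.bounded
      (h2.bounded.setReg _ _ _ (by simp [Instr.exec, Op.eval, e1.val, hle.trans hM]))
    have hrel := e1.rel hd hr
    refine ⟨_, _, σ.setVar v (e.eval σ) (e.cost + 2), (h1.trans h2).trans h3, ?_, ?_, ⟨?_, ?_,
      hrel.low, hrel.tab⟩, ⟨hσ.off_le, ?_, hσ.low, hσ.tab⟩, hQ, ?_⟩
    · simp [e.length_code, add_assoc]
    · simp [Instr.exec, e1.pc, e.length_code, hpc, len, add_assoc]
    · have h1 : (1 : ℕ) ≠ 2 * v := by omega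
      simp [Instr.exec, h1, show ¬ d = 0 by omega, hrel.reg_off]
    · intro w
      have hne : 2 * w ≠ 2 * (d + 1) + 1 := by omega
      by_cases hw : w = v
      · simp [Instr.exec, Op.eval, e1.val, hw]
      · simp [Instr.exec, hw, hne, hrel.var]
    · intro w
      by_cases hw : w = v
      · simp [hw, hle]
      · simp [hw, hσ.var]
    · intro r h1 h2
      have hne : r ≠ 2 * (d + 1) + 1 := by omega
      have hne' : r ≠ 2 * v := by omega
      simp [Instr.exec, hne, hne', e1.reg r (by omega)]
  | write a e =>
    intro d pc c σ Q hd hcode hpc hb hr hσ hB ⟨hsa, hs, ha, hle, hQ⟩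
    simp only [bd] at hB
    obtain ⟨c1, h1, e1⟩ := a.computes hσ hsa (by omega) d hd P pc c hcode.left.left hpc hb hr
    obtain ⟨c2, h2, e2⟩ := e.computes hσ hs (by omega) (d + 1) (by omega) P _ c1
      hcode.left.right (by rw [e1.pc, hpc]) h1.bounded (e1.rel hd hr)
    have hva : c2.reg (2 * d + 1) = a.eval σ := by rw [e2.reg _ (by omega), e1.val]
    have h3 := Reach.single (c := c2) hcode.right
      (by rw [e2.pc, e1.pc, hpc, List.length_append]; omega) h2.bounded
      (h2.bounded.setMem _ _ _ (h2.bounded _).1)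
    have hrel := e2.rel (by omega) (e1.rel hd hr)
    refine ⟨_, _, σ.setLow (a.eval σ) (e.eval σ) (a.cost + e.cost + 1), (h1.trans h2).trans h3,
      ?_, ?_, ⟨hrel.reg_off, hrel.var, ?_, ?_⟩, ⟨hσ.off_le, hσ.var, ?_, hσ.tab⟩, hQ, ?_⟩
    · simp [Exp.length_code, add_assoc]
    · simp [Instr.exec, e2.pc, e1.pc, Exp.length_code, hpc, len, add_assoc]
    · intro a' ha'
      simp [Instr.exec, hva, e2.val, Function.update_apply, hrel.low a' ha']
    · intro t b i
      have hne : off + cell t b i ≠ a.eval σ := by omega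
      simp [Instr.exec, hva, hne, hrel.tab]
    · intro a' ha'
      by_cases h : a' = a.eval σ
      · simp [h, hle]
      · simp [h, hσ.low a' ha']
    · intro r h1 h2
      simp only [Instr.exec]
      rw [e2.reg r (by omega), e1.reg r (by omega)]
  | put t b i e =>
    intro d pc c σ Q hd hcode hpc hb hr hσ hB ⟨hsb, hsi, hs, hle, hQ⟩
    simp only [bd] at hB
    have hlb := Exp.le_get_bd (M := M) (t := t) (b := b) (i := i)
    obtain ⟨c1, h1, e1⟩ := computes_addr (t := t) (b.computes hσ hsb (by omega))
      (i.computes hσ hsi (by omega))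
      ((Exp.get_bd_le (t := t) hσ hsb hsi).trans (by omega)) d hd P pc c hcode.left.left hpc hb hr
    obtain ⟨c2, h2, e2⟩ := e.computes hσ hs (by omega) (d + 1) (by omega) P _ c1
      hcode.left.right (by rw [e1.pc, hpc]) h1.bounded (e1.rel hd hr)
    have hva : c2.reg (2 * d + 1) = off + cell t (b.eval σ) (i.eval σ) := by
      rw [e2.reg _ (by omega), e1.val]
    have h3 := Reach.single (c := c2) hcode.right
      (by rw [e2.pc, e1.pc, hpc, List.length_append]; omega) h2.bounded
      (h2.bounded.setMem _ _ _ (h2.bounded _).1)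
    have hrel := e2.rel (by omega) (e1.rel hd hr)
    refine ⟨_, _, σ.setTab t (b.eval σ) (i.eval σ) (e.eval σ) _, (h1.trans h2).trans h3,
      ?_, ?_, ⟨hrel.reg_off, hrel.var, ?_, ?_⟩, ⟨hσ.off_le, hσ.var, hσ.low, ?_⟩, hQ, ?_⟩
    · simp [Exp.length_code, addrCode_length b.length_code i.length_code]; omega
    · simp [Instr.exec, e2.pc, e1.pc, Exp.length_code,
        addrCode_length b.length_code i.length_code, hpc, len]; omega
    · intro a' ha'
      have hne : a' ≠ off + cell t (b.eval σ) (i.eval σ) := by omega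
      simp [Instr.exec, hva, hne, hrel.low a' ha']
    · intro t' b' i'
      simp [Instr.exec, hva, e2.val, Function.update_apply, hrel.tab, cell_inj]
    · intro t' b' i'
      simp only [State.setTab_tab]
      split_ifs
      · exact hle
      · exact hσ.tab _ _ _
    · intro r h1 h2
      simp only [Instr.exec]
      rw [e2.reg r (by omega), e1.reg r (by omega)]
  | seq s s' ih ih' =>
    intro d pc c σ Q hd hcode hpc hb hr hσ hB hw
    simp only [bd] at hB
    refine (ih hd hcode.left hpc hb hr hσ (by omega) hw).bind le_rfl ?_
    intro σ' c' hpc' hb' hr' hσ' hw' _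
    have hcode2 := hcode.right
    rw [s.length_code] at hcode2
    have := ih' hd hcode2 hpc' hb' hr' hσ' (by omega) hw'
    rwa [add_assoc] at this
  | branch e s s' ih ih' =>
    intro d pc c σ Q hd hcode hpc hb hr hσ hB ⟨hs, hw1, hw2⟩
    simp only [bd] at hB
    obtain ⟨c1, h1, e1⟩ := e.computes hσ hs (by omega) d hd P pc c hcode.left hpc hb hr
    have hrel := e1.rel hd hr
    have hcode1 := hcode.right
    rw [e.length_code] at hcode1
    have h2 := Reach.single hcode1.left (by rw [e1.pc, hpc, e.length_code]) h1.bounded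
      (h1.bounded.setPc _)
    have hcode2 := hcode1.right
    by_cases he : e.eval σ = 0
    · have hcode3 := hcode2.right.right
      rw [s.length_code] at hcode3
      refine Outcome.of_reach (σ' := σ.tick (e.cost + 1)) (h1.trans h2) (by simp [e.length_code])
        (fun r h3 h4 => e1.reg r (by omega)) le_rfl ?_
      have := ih' (pc := pc + e.cost + 1 + s.len + 2) hd hcode3
        (by simp [Instr.exec, e1.val, he]) h2.bounded
        ((hrel.setPc _).tick _) (hσ.tick _) (by omega) (hw2 he)
      convert this using 1
      simp only [len]; omega
    · refine Outcome.of_reach (σ' := σ.tick (e.cost + 1)) (h1.trans h2) (by simp [e.length_code])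
        (fun r h3 h4 => e1.reg r (by omega)) le_rfl ?_
      have hexec := ih (pc := pc + e.cost + 1) hd hcode2.left
        (c := (Instr.jumpIfZero (2 * d + 1) (pc + e.cost + 1 + s.len + 2)).exec c1)
        (by simp [Instr.exec, e1.val, he, e1.pc, e.length_code, hpc]) h2.bounded
        ((hrel.setPc _).tick _) (hσ.tick _) (by omega) (hw1 he)
      refine hexec.bind le_rfl ?_
      intro σ' c' hpc' hb' hr' hσ' hQ _
      have hcode3 := hcode2.right.left
      rw [s.length_code] at hcode3
      have h3 := Reach.single hcode3 hpc' hb' (hb'.setReg _ _ _ (Nat.zero_le _))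
      have h4 := Reach.single (c := (Instr.const (2 * d + 1) 0).exec c') hcode3.tail
        (by simp [Instr.exec, hpc']) h3.bounded (h3.bounded.setPc _)
      refine ⟨2, _, σ'.tick 2, h3.trans h4, rfl, ?_, ((hr'.setTemp _ _ _ hd).setPc _).tick _,
        hσ'.tick _, hQ, fun r h5 h6 => ?_⟩
      · simp [Instr.exec, len]; omega
      · exact Function.update_of_ne (by omega) _ _
  | rep e s ih =>
    intro d pc c σ Q hd hcode hpc hb hr hσ hB ⟨hs, hw⟩
    simp only [bd] at hB
    obtain ⟨c1, h1, e1⟩ := e.computes hσ hs (by omega) d hd P pc c hcode.left hpc hb hr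
    have hrel := e1.rel hd hr
    have hcode1 := hcode.right
    rw [e.length_code] at hcode1
    have hcode2 := hcode1.right
    have hcode3 := hcode2.right
    rw [s.length_code] at hcode3
    refine Outcome.of_reach (σ' := σ.tick e.cost) h1 (by simp [e.length_code])
      (fun r h3 h4 => e1.reg r (by omega)) le_rfl ?_
    have hval := e1.val
    have hpc1 : c1.pc = pc + e.cost := by rw [e1.pc, hpc, e.length_code]
    have hb1 := h1.bounded
    have hle : e.eval σ ≤ B := (e.eval_le hσ hs).trans (by omega)
    -- From here on the remaining rounds are recorded only in the counter register, so the link to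
    -- `e` is forgotten and the induction runs over the value of the counter.
    generalize e.eval σ = n at hval hw hle
    generalize hσ1 : σ.tick e.cost = σ1 at hw ⊢
    have hr1 : Rel off σ1 c1 := hσ1 ▸ hrel.tick _
    have hs1 : σ1.Bounded off M := hσ1 ▸ hσ.tick _
    clear hr e1 hrel hσ1 h1 hs hpc hσ
    induction n generalizing c1 σ1 with
    | zero =>
      have h2 := Reach.single hcode1.left hpc1 hb1 (hb1.setPc _)
      refine ⟨1, _, σ1.tick 1, h2, rfl, ?_, (hr1.setPc _).tick _, hs1.tick _, hw,
        fun r h5 h6 => rfl⟩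
      simp [Instr.exec, hval, len]; omega
    | succ n ihn =>
      have h2 := Reach.single hcode1.left hpc1 hb1 (hb1.setPc _)
      rw [Function.iterate_succ_apply'] at hw
      refine Outcome.of_reach (σ' := σ1.tick 1) h2 rfl (fun _ _ _ => rfl) le_rfl ?_
      have hexec := ih (pc := pc + e.cost + 1) (d := d + 1) (by omega) hcode2.left
        (c := (Instr.jumpIfZero (2 * d + 1) (pc + e.cost + 1 + s.len + 4)).exec c1)
        (by simp [Instr.exec, hval, hpc1]) h2.bounded
        ((hr1.setPc _).tick _) (hs1.tick _) (by omega) hw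
      refine hexec.bind (by omega) ?_
      intro σ2 c2 hpc2 hb2 hr2 hσ2 hQ hreg
      have hv2 : c2.reg (2 * d + 1) = n + 1 := by
        rw [hreg _ (by omega) (by omega)]; exact hval
      have h3 := Reach.single hcode3 hpc2 hb2 (hb2.setReg _ _ _ h1B)
      have h4 := Reach.single (c := (Instr.const (2 * (d + 1) + 1) 1).exec c2) hcode3.tail
        (by simp [Instr.exec, hpc2]) h3.bounded (h3.bounded.setReg _ _ _ (by
          simp [Instr.exec, Op.eval, hv2]; omega))
      have h5 := Reach.single
        (c := (Instr.arith .sub (2 * d + 1) (2 * d + 1) (2 * (d + 1) + 1)).exec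
          ((Instr.const (2 * (d + 1) + 1) 1).exec c2)) hcode3.tail.tail
        (by simp [Instr.exec, hpc2]) h4.bounded (h4.bounded.setReg _ _ _ (Nat.zero_le _))
      have h6 := Reach.single
        (c := (Instr.const (2 * (d + 1) + 1) 0).exec
          ((Instr.arith .sub (2 * d + 1) (2 * d + 1) (2 * (d + 1) + 1)).exec
          ((Instr.const (2 * (d + 1) + 1) 1).exec c2))) hcode3.tail.tail.tail
        (by simp [Instr.exec, hpc2]) h5.bounded (h5.bounded.setPc _)
      refine Outcome.of_reach (σ' := σ2.tick 4) (((h3.trans h4).trans h5).trans h6) rfl ?_ le_rfl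
        (ihn (hle := by omega) (c1 := _) (σ1 := _) ?_ ?_ ?_ hQ ?_ ?_)
      · intro r h7 h8
        have hne : r ≠ 2 * (d + 1) + 1 := by omega
        have hne' : r ≠ 2 * d + 1 := by omega
        simp [Instr.exec, hne, hne']
      · simp [Instr.exec]
      · exact h6.bounded
      · simp [Instr.exec, Op.eval, hv2]
      · exact (((((hr2.setTemp _ _ _ (by omega)).setTemp _ _ _ hd).setTemp _ _ _
          (by omega)).setPc _).tick _)
      · exact hσ2.tick _

/-! ### Polynomial bounds -/

/-- Requiring `2 ≤ M` allows a pure power without a leading constant: c ≤ 2 ^ c ≤ M ^ c. -/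
def PolyBounded (f : ℕ → ℕ) : Prop := ∃ k, ∀ M, 2 ≤ M → f M ≤ M ^ k

theorem PolyBounded.id : PolyBounded fun M => M := ⟨1, fun M _ => by simp⟩

theorem PolyBounded.const (c : ℕ) : PolyBounded fun _ => c :=
  ⟨c, fun _ hM => (Nat.lt_two_pow_self).le.trans (Nat.pow_le_pow_left hM c)⟩

theorem PolyBounded.mul {f g : ℕ → ℕ} (hf : PolyBounded f) (hg : PolyBounded g) :
    PolyBounded fun M => f M * g M := by
  obtain ⟨k, hk⟩ := hf
  obtain ⟨l, hl⟩ := hg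
  exact ⟨k + l, fun M hM => by rw [pow_add]; exact Nat.mul_le_mul (hk M hM) (hl M hM)⟩

theorem PolyBounded.add {f g : ℕ → ℕ} (hf : PolyBounded f) (hg : PolyBounded g) :
    PolyBounded fun M => f M + g M := by
  obtain ⟨k, hk⟩ := hf
  obtain ⟨l, hl⟩ := hg
  refine ⟨k + l + 1, fun M hM => ?_⟩
  have h1 := (hk M hM).trans (Nat.pow_le_pow_right (by omega) (Nat.le_add_right k l))
  have h2 := (hl M hM).trans (Nat.pow_le_pow_right (by omega) (Nat.le_add_left l k))
  rw [pow_succ]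
  calc f M + g M ≤ M ^ (k + l) * 2 := by omega
    _ ≤ _ := Nat.mul_le_mul_left _ hM

theorem Exp.polyBounded_bd (e : Exp) : PolyBounded fun M => e.bd M := by
  induction e with
  | var v => exact .id
  | const c => exact .const c
  | op o a b iha ihb => exact (iha.add ihb).add (iha.mul ihb)
  | low a ih => exact ih.add .id
  | get t b i ihb ihi =>
    have h := (((PolyBounded.const 8).mul ihb).add (.const 8)).add ihi
    exact (PolyBounded.id.add (h.mul h)).add ihi

theorem Stmt.polyBounded_bd (s : Stmt) : PolyBounded fun M => s.bd M := by
  induction s with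
  | skip => exact .const 0
  | assign v e => exact e.polyBounded_bd
  | write a e => exact a.polyBounded_bd.add e.polyBounded_bd
  | put t b i e => exact (Exp.get t b i).polyBounded_bd.add e.polyBounded_bd
  | seq s s' ih ih' => exact ih.add ih'
  | branch e s s' ih ih' => exact (e.polyBounded_bd.add ih).add ih'
  | rep e s ih => exact (e.polyBounded_bd.add ih).add (.const 1)

/-! ### From verified statements to machine programs -/

/-- The size of the raw memory; it contains the inputs of all problems considered here. -/
def rawSize (input : List ℕ) : ℕ :=
  2 * (input.getD 0 0 * input.getD 0 0 + input.getD 1 0) + 2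

/-- Leaves `rawSize` in register `1`, where the compiled code expects it. Only the temporary
registers `3` and `5` are used otherwise, so all variables still have the value `0`. -/
def prologue : List Instr :=
  [.const 3 0, .load 3 3, .arith .mul 3 3 3, .const 5 1, .load 5 5, .arith .add 1 3 5,
    .arith .add 1 1 1, .const 5 2, .arith .add 1 1 5]

def Stmt.program (s : Stmt) : Program := prologue ++ s.code 1 9

/-- The state that corresponds to the start of a program. -/
def State.start (input : List ℕ) : State :=
  ⟨fun _ => 0, fun _ _ _ => 0, fun a => input.getD a 0, 0⟩

theorem reach_prologue {input : List ℕ} {B : ℕ} (s : Stmt) (hlen : input.length ≤ rawSize input)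
    (hB : rawSize input ≤ B) (hin : ∀ a ∈ input, a ≤ B) :
    ∃ c, Reach s.program B 9 (init input) c ∧ c.pc = 9 ∧
      Rel (rawSize input) (State.start input) c := by
  have hcode : CodeAt s.program 0 (prologue) := ⟨[], s.code 1 9, by simp [Stmt.program], rfl⟩
  have hb0 : (init input).Bounded B := by
    intro i
    refine ⟨Nat.zero_le _, ?_⟩
    simp only [init]
    by_cases hi : i < input.length
    · rw [List.getD_eq_getElem _ _ hi]; exact hin _ (List.getElem_mem hi)
    · rw [List.getD_eq_default _ _ (by omega)]; exact Nat.zero_le _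
  unfold prologue at hcode
  unfold rawSize at hB
  have h1 := Reach.single hcode rfl hb0 (hb0.setReg _ _ _ (by omega))
  have h2 := h1.trans <| Reach.single hcode.tail rfl h1.bounded
    (h1.bounded.setReg _ _ _ (h1.bounded _).2)
  have h3 := h2.trans <| Reach.single hcode.tail.tail rfl h2.bounded
    (h2.bounded.setReg _ _ _ (by simp [Instr.exec, Op.eval, init] at hB ⊢; omega))
  have h4 := h3.trans <| Reach.single hcode.tail.tail.tail rfl h3.bounded
    (h3.bounded.setReg _ _ _ (by omega))
  have h5 := h4.trans <| Reach.single hcode.tail.tail.tail.tail rfl h4.bounded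
    (h4.bounded.setReg _ _ _ (h4.bounded _).2)
  have h6 := h5.trans <| Reach.single hcode.tail.tail.tail.tail.tail rfl h5.bounded
    (h5.bounded.setReg _ _ _ (by simp [Instr.exec, Op.eval, init] at hB ⊢; omega))
  have h7 := h6.trans <| Reach.single hcode.tail.tail.tail.tail.tail.tail rfl h6.bounded
    (h6.bounded.setReg _ _ _ (by simp [Instr.exec, Op.eval, init] at hB ⊢; omega))
  have h8 := h7.trans <| Reach.single hcode.tail.tail.tail.tail.tail.tail.tail rfl h7.bounded
    (h7.bounded.setReg _ _ _ (by omega))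
  have h9 := h8.trans <| Reach.single hcode.tail.tail.tail.tail.tail.tail.tail.tail rfl h8.bounded
    (h8.bounded.setReg _ _ _ (by simp [Instr.exec, Op.eval, init] at hB ⊢; omega))
  refine ⟨_, h9, rfl, ?_, ?_, ?_, ?_⟩
  · simp [Instr.exec, Op.eval, init, rawSize]; omega
  · intro v
    have h1 : 2 * v ≠ 1 := by omega
    have h3 : 2 * v ≠ 3 := by omega
    have h5 : 2 * v ≠ 5 := by omega
    simp [Instr.exec, h1, h3, h5, init, State.start]
  · intro a _; rfl
  · intro t b i
    simp only [Instr.exec, init, State.start]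
    exact List.getD_eq_default _ _ (by omega)

/-- If the stored values are at most `M x`, all numbers of the compiled run are bounded by a power
of `M x`, hence by a power of the size. The nine steps of the prologue are absorbed into the
constant because the time bound is at least `1`. -/
theorem solvableInTime_of_wp {ι : Type} {input output : ι → List ℕ} {size : ι → ℕ} {time : ι → ℝ}
    (s : Stmt) (M : ι → ℕ) (k : ℕ) (C : ℝ) (hM : ∀ x, M x ≤ (size x + 2) ^ k)
    (htime : ∀ x, 1 ≤ time x)
    (hlen : ∀ x, (input x).length ≤ rawSize (input x))
    (houtlen : ∀ x, (output x).length ≤ rawSize (input x))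
    (hraw : ∀ x, rawSize (input x) ≤ M x) (hin : ∀ x, ∀ a ∈ input x, a ≤ M x)
    (hs : ∀ x, s.wp (rawSize (input x)) (M x) (fun τ => (τ.time : ℝ) ≤ C * time x ∧
      ∀ i (hi : i < (output x).length), τ.low i = (output x)[i]) (State.start (input x))) :
    SolvableInTime input output size time := by
  obtain ⟨l, hl⟩ := s.polyBounded_bd.add PolyBounded.id
  refine ⟨s.program, k * l, C + 9, fun x => ?_⟩
  have h2M : 2 ≤ M x := le_trans (by simp [rawSize]) (hraw x)
  set B := (size x + 2) ^ (k * l) with hBdef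
  have hB : s.bd (M x) + M x ≤ B := (hl _ h2M).trans (by
    rw [hBdef, pow_mul]; exact Nat.pow_le_pow_left (hM x) l)
  obtain ⟨c, hreach, hpc, hrel⟩ := reach_prologue (B := B) s (hlen x) ((hraw x).trans (by omega))
    (fun a ha => (hin x a ha).trans (by omega))
  have hcode : CodeAt s.program 9 (s.code 1 9) := ⟨prologue, [], by simp [Stmt.program], rfl⟩
  have hσ : (State.start (input x)).Bounded (rawSize (input x)) (M x) := by
    refine ⟨hraw x, fun _ => Nat.zero_le _, fun a _ => ?_, fun _ _ _ => Nat.zero_le _⟩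
    simp only [State.start]
    by_cases hi : a < (input x).length
    · rw [List.getD_eq_getElem _ _ hi]; exact hin x _ (List.getElem_mem hi)
    · rw [List.getD_eq_default _ _ (by omega)]; exact Nat.zero_le _
  obtain ⟨t, c', σ', hreach', ht, hpc', hrel', hσ', hQ, -⟩ := s.outcome (by omega) (by omega)
    le_rfl hcode hpc hreach.bounded hrel hσ (by omega) (hs x)
  have htot := hreach.trans hreach'
  refine ⟨9 + t, ?_, ?_, fun i hi => ?_, fun t' ht' i => htot.2 t' ht' i⟩
  · have h1 := hQ.1
    have h2 : σ'.time = t := by simpa [State.start] using ht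
    rw [h2] at h1
    have := htime x
    push_cast
    nlinarith
  · have h : run s.program (input x) (9 + t) = c' := htot.1
    rw [h, Halted, hpc', Stmt.program, List.length_append, s.length_code]
    rfl
  · have h : run s.program (input x) (9 + t) = c' := htot.1
    rw [h, hrel'.low i (by have := houtlen x; omega), hQ.2 i hi]

end RAM

/-! ### Matrices as lists of their entries -/

theorem length_matrixEntries {n : ℕ} (A : Matrix (Fin n) (Fin n) ℕ) :
    (matrixEntries A).length = n * n := by
  simp [matrixEntries, List.length_flatMap]

theorem matrixEntries_eq_ofFn {n : ℕ} (A : Matrix (Fin n) (Fin n) ℕ) :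
    matrixEntries A = List.ofFn fun p : Fin (n * n) => A p.divNat p.modNat := by
  rw [List.ofFn_mul, matrixEntries, List.flatMap, List.ofFn_eq_map]
  congr 1
  refine List.map_congr_left fun i _ => ?_
  congr 1
  funext j
  have hj := j.2
  congr 1
  · ext
    simp [Fin.divNat, Nat.add_comm _ (j : ℕ), Nat.add_mul_div_right _ _ (Nat.zero_lt_of_lt hj),
      Nat.div_eq_of_lt hj]
  · ext
    simp [Fin.modNat, Nat.mod_eq_of_lt hj]

theorem matrixEntries_getElem {n : ℕ} (A : Matrix (Fin n) (Fin n) ℕ) (p : ℕ)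
    (hp : p < (matrixEntries A).length) : (matrixEntries A)[p] =
      A ⟨p / n, Nat.div_lt_of_lt_mul (by rwa [length_matrixEntries] at hp)⟩
        ⟨p % n, Nat.mod_lt _ (by
          rw [length_matrixEntries] at hp
          exact Nat.pos_of_ne_zero (by rintro rfl; simp at hp))⟩ := by
  simp only [matrixEntries_eq_ofFn, List.getElem_ofFn]
  rfl

/-- A matrix as a function of natural numbers, `0` outside its range. -/
def Matrix.entry {n : ℕ} (A : Matrix (Fin n) (Fin n) ℕ) (i j : ℕ) : ℕ :=
  if h : i < n ∧ j < n then A ⟨i, h.1⟩ ⟨j, h.2⟩ else 0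

theorem matrixEntries_getD {n : ℕ} (A : Matrix (Fin n) (Fin n) ℕ) {p : ℕ} (hp : p < n * n) :
    (matrixEntries A).getD p 0 = A.entry (p / n) (p % n) := by
  have hn : 0 < n := Nat.pos_of_ne_zero (by rintro rfl; simp at hp)
  rw [List.getD_eq_getElem _ _ (by rwa [length_matrixEntries]), matrixEntries_getElem,
    Matrix.entry, dif_pos ⟨Nat.div_lt_of_lt_mul hp, Nat.mod_lt _ hn⟩]

theorem mul_add_lt_mul_self {n i j : ℕ} (hi : i < n) (hj : j < n) : i * n + j < n * n := by
  have := Nat.mul_le_mul_right n (Nat.succ_le_of_lt hi)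
  rw [Nat.succ_mul] at this
  omega

namespace MatMulInstance

variable {c : ℕ} (x : MatMulInstance c)

def input : List ℕ := x.n :: (matrixEntries x.A ++ matrixEntries x.B)

theorem length_input : x.input.length = 2 * (x.n * x.n) + 1 := by
  simp [input, length_matrixEntries]; omega

theorem input_zero : x.input.getD 0 0 = x.n := rfl

theorem input_left {i k : ℕ} (hi : i < x.n) (hk : k < x.n) :
    x.input.getD (1 + i * x.n + k) 0 = x.A.entry i k := by
  have h := mul_add_lt_mul_self hi hk
  rw [show 1 + i * x.n + k = (i * x.n + k) + 1 by ring, input, List.getD_cons_succ,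
    List.getD_append _ _ _ _ (by rwa [length_matrixEntries]), matrixEntries_getD _ h,
    Nat.add_comm, Nat.add_mul_div_right _ _ (by omega), Nat.div_eq_of_lt hk,
    Nat.add_mul_mod_self_right, Nat.mod_eq_of_lt hk, Nat.zero_add]

theorem input_right {k j : ℕ} (hk : k < x.n) (hj : j < x.n) :
    x.input.getD (1 + x.n * x.n + k * x.n + j) 0 = x.B.entry k j := by
  have h := mul_add_lt_mul_self hk hj
  rw [show 1 + x.n * x.n + k * x.n + j = (x.n * x.n + (k * x.n + j)) + 1 by ring, input,
    List.getD_cons_succ, List.getD_append_right _ _ _ _ (by rw [length_matrixEntries]; omega),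
    length_matrixEntries, Nat.add_sub_cancel_left, matrixEntries_getD _ h,
    Nat.add_comm, Nat.add_mul_div_right _ _ (by omega), Nat.div_eq_of_lt hj,
    Nat.add_mul_mod_self_right, Nat.mod_eq_of_lt hj, Nat.zero_add]

theorem le_of_mem_input {a : ℕ} (ha : a ∈ x.input) : a ≤ max x.n (x.n ^ c) := by
  simp only [input, List.mem_cons, List.mem_append, matrixEntries, List.mem_flatMap,
    List.mem_ofFn] at ha
  rcases ha with rfl | ⟨i, -, j, rfl⟩ | ⟨i, -, j, rfl⟩
  · exact le_max_left _ _
  · exact (x.hA i j).trans (le_max_right _ _)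
  · exact (x.hB i j).trans (le_max_right _ _)

end MatMulInstance

theorem Matrix.entry_le {n b : ℕ} {A : Matrix (Fin n) (Fin n) ℕ} (h : ∀ i j, A i j ≤ b)
    (i j : ℕ) : A.entry i j ≤ b := by
  unfold entry
  split_ifs
  · exact h _ _
  · exact Nat.zero_le _

theorem Matrix.entry_mul {n : ℕ} (A B : Matrix (Fin n) (Fin n) ℕ) {i j : ℕ} (hi : i < n)
    (hj : j < n) : (A * B).entry i j = ∑ k ∈ Finset.range n, A.entry i k * B.entry k j := by
  rw [Finset.sum_range]
  simp [entry, hi, hj, Matrix.mul_apply]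

namespace RAM

/-! ### Matrix multiplication by the definition -/

open Exp Stmt

/-- Variables: `0` position in the product, `1` dimension, `2` entry of the product,
`3` summation index. -/
def naiveMulBody : Stmt :=
  assign 2 0 ;; assign 3 0 ;;
  rep (.var 1)
    (assign 2 (.var 2 + .low (1 + .var 0 / .var 1 * .var 1 + .var 3) *
      .low (1 + .var 1 * .var 1 + .var 3 * .var 1 + (.var 0 - .var 1 * (.var 0 / .var 1)))) ;;
    assign 3 (.var 3 + 1)) ;;
  put 0 0 (.var 0) (.var 2) ;; assign 0 (.var 0 + 1)

/-- The product is collected in a table and copied only at the end, since the output cells are still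
occupied by the input. -/
def naiveMul : Stmt :=
  assign 1 (.low 0) ;;
  rep (.var 1 * .var 1) naiveMulBody ;;
  assign 0 0 ;;
  rep (.var 1 * .var 1) (write (.var 0) (.get 0 0 (.var 0)) ;; assign 0 (.var 0 + 1))

theorem naiveMulBody_wp {c off M : ℕ} (x : MatMulInstance c) (hoff : 2 * (x.n * x.n) + 1 ≤ off)
    (hM : x.n * (x.n ^ c * x.n ^ c) + x.n * x.n + x.n + 1 ≤ M) {σ : State} {p : ℕ}
    (hp : p < x.n * x.n) (h0 : σ.var 0 = p) (h1 : σ.var 1 = x.n)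
    (hlow : σ.low = fun a => x.input.getD a 0) :
    naiveMulBody.wp off M (fun τ => τ.var 0 = p + 1 ∧
      (∀ q, τ.tab 0 0 q = if q = p then (x.A * x.B).entry (p / x.n) (p % x.n) else σ.tab 0 0 q) ∧
      τ.time ≤ σ.time + (100 * x.n + 100)) σ := by
  have hn : 0 < x.n := Nat.pos_of_ne_zero (by rintro h; simp [h] at hp)
  have hdiv : p / x.n < x.n := Nat.div_lt_of_lt_mul hp
  have hmod : p % x.n < x.n := Nat.mod_lt _ hn
  have hmod' : p - x.n * (p / x.n) = p % x.n := by
    have := Nat.div_add_mod p x.n; omega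
  -- Every partial sum is stored in a variable and so has to respect the bound `M`, not only the
  -- final entry.
  have hsum : ∀ k ≤ x.n, ∑ k' ∈ Finset.range k,
      x.A.entry (p / x.n) k' * x.B.entry k' (p % x.n) ≤ x.n * (x.n ^ c * x.n ^ c) := by
    intro k hk
    refine (Finset.sum_le_card_nsmul _ _ (x.n ^ c * x.n ^ c) fun k' _ =>
      Nat.mul_le_mul (Matrix.entry_le x.hA _ _) (Matrix.entry_le x.hB _ _)).trans ?_
    simp only [Finset.card_range, smul_eq_mul]
    exact Nat.mul_le_mul_right _ hk
  simp only [naiveMulBody, wp_seq_iff, wp_assign, safe_ofNat, eval_ofNat, Nat.zero_le, true_and]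
  refine wp_rep_flat (fun k τ => τ.var 3 = k ∧ τ.var 2 = ∑ k' ∈ Finset.range k,
      x.A.entry (p / x.n) k' * x.B.entry k' (p % x.n)) rfl (by simp) (fun _ _ _ h => h)
      (by simp) ?_ ?_
  · rintro k τ hk ⟨h3, h2⟩ hf
    have hv0 : τ.var 0 = p := by rw [hf.var 0 rfl]; simpa using h0
    have hv1 : τ.var 1 = x.n := by rw [hf.var 1 rfl]; simpa using h1
    have hl : τ.low = fun a => x.input.getD a 0 := by rw [hf.low rfl]; simpa using hlow
    replace hk : k < x.n := by simpa [h1] using hk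
    have hs := hsum (k + 1) hk
    rw [Finset.sum_range_succ] at hs
    have ha := x.input_left hdiv hk
    have hb := x.input_right hk hmod
    have hla := mul_add_lt_mul_self hdiv hk
    have hlb := mul_add_lt_mul_self hk hmod
    simp [hv0, hv1, h3, h2, hl, hmod', ha, hb, Finset.sum_range_succ, -List.getD_eq_getElem?_getD]
    omega
  · rintro τ ⟨h3, h2⟩ hf hti
    have hv0 : τ.var 0 = p := by rw [hf.var 0 rfl]; simpa using h0
    have htab : τ.tab = σ.tab := funext fun t => by rw [hf.tab t rfl]; simp
    have hev : x.n = ((σ.setVar 2 0 (Exp.cost 0 + 2)).setVar 3 0 (Exp.cost 0 + 2)).var 1 := by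
      simp [h1]
    simp only [eval_var] at h2 hti
    rw [← hev] at h2 hti
    have hs := hsum x.n le_rfl
    rw [← h2] at hs
    rw [← Matrix.entry_mul _ _ hdiv hmod] at h2
    simp only [State.setVar_time, cost_ofNat, cost_var, Stmt.cost, cost_add, cost_low, cost_mul,
      cost_sub, cost_div] at hti
    simp [hv0, htab, h2] at hs ⊢
    refine ⟨by omega, by omega, by omega⟩

theorem naiveMul_wp {c M : ℕ} (x : MatMulInstance c) (hraw : rawSize x.input ≤ M)
    (hM : x.n * (x.n ^ c * x.n ^ c) + x.n * x.n + x.n + 1 ≤ M) :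
    naiveMul.wp (rawSize x.input) M (fun τ => τ.time ≤ 1000 * max x.n 1 ^ 3 ∧
      ∀ q < x.n * x.n, τ.low q = (x.A * x.B).entry (q / x.n) (q % x.n))
      (State.start x.input) := by
  have hoff : 2 * (x.n * x.n) + 1 < rawSize x.input := by
    rw [rawSize, x.input_zero]; omega
  simp only [naiveMul, wp_seq_iff, wp_assign, safe_low, safe_ofNat, eval_ofNat, true_and,
    eval_low]
  have h00 : (State.start x.input).low 0 = x.n := rfl
  refine ⟨by omega, by omega, ?_⟩
  rw [h00]
  refine wp_rep (fun k τ => τ.var 0 = k ∧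
      ∀ q < k, τ.tab 0 0 q = (x.A * x.B).entry (q / x.n) (q % x.n)) (100 * x.n + 100)
    (by simp) (fun _ _ _ h => h) (by simp [State.start]) ?_ ?_
  · rintro k τ hk ⟨h0, ht⟩ hf
    replace hk : k < x.n * x.n := by simpa using hk
    refine wp_mono ?_ (naiveMulBody_wp x (by omega) hM hk h0 (by rw [hf.var 1 rfl]; simp)
      (by rw [hf.low rfl]; rfl))
    rintro τ' ⟨h0', ht', hti⟩
    refine ⟨⟨h0', fun q hq => ?_⟩, hti⟩
    rw [ht']
    split_ifs with h
    · rw [h]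
    · exact ht q (by omega)
  rintro τ ⟨-, ht⟩ hf hti
  have h1 : τ.var 1 = x.n := by rw [hf.var 1 rfl]; simp
  simp only [eval_mul, eval_var, State.setVar_var, if_true] at ht
  refine ⟨by simp, by simp, ?_⟩
  refine wp_rep_flat (fun k τ' => τ'.var 0 = k ∧
      ∀ q < k, τ'.low q = (x.A * x.B).entry (q / x.n) (q % x.n)) rfl
    (by simp) (fun _ _ _ h => h) (by simp) ?_ ?_
  · rintro k τ' hk ⟨h0, hl⟩ hf'
    replace hk : k < x.n * x.n := by simpa [h1] using hk
    have htab : τ'.tab 0 0 k = (x.A * x.B).entry (k / x.n) (k % x.n) := by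
      rw [hf'.tab 0 rfl]; exact ht k hk
    have hent : (x.A * x.B).entry (k / x.n) (k % x.n) ≤ M := by
      refine (Matrix.entry_le (b := x.n * (x.n ^ c * x.n ^ c)) (fun i j => ?_) _ _).trans
        (by omega)
      rw [Matrix.mul_apply]
      refine (Finset.sum_le_card_nsmul _ _ _ fun l _ =>
        Nat.mul_le_mul (x.hA i l) (x.hB l j)).trans ?_
      simp
    simp only [wp_seq_iff, wp_write, wp_assign, safe_var, safe_get, safe_ofNat, eval_var, eval_get,
      eval_ofNat, h0, htab, true_and, safe_add, eval_add, State.setLow_var, State.setVar_var,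
      if_true, State.setVar_low, State.setLow_low]
    refine ⟨by omega, hent, by omega, fun q hq => ?_⟩
    split_ifs with h
    · rw [h]
    · exact hl q (by omega)
  · rintro τ' ⟨-, hl⟩ - hti'
    refine ⟨?_, by simpa [h1] using hl⟩
    simp only [eval_mul, eval_var, State.setVar_var, if_true, State.setVar_time, cost_ofNat,
      cost_var, Stmt.cost, cost_add, cost_low, cost_mul, cost_get, State.start, h1,
      if_neg (show (1 : ℕ) ≠ 0 by decide)] at hti hti'
    have e1 : x.n ≤ max x.n 1 := le_max_left _ _
    have e2 : 1 ≤ max x.n 1 := le_max_right _ _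
    generalize max x.n 1 = y at e1 e2 ⊢
    have e3 : x.n * x.n ≤ y * y := Nat.mul_le_mul e1 e1
    have e4 : x.n * x.n * x.n ≤ y * y * y := Nat.mul_le_mul e3 e1
    have e5 : y * y ≤ y * y * y := Nat.le_mul_of_pos_right _ (by omega)
    have e6 : 1 ≤ y * y * y := Nat.succ_le_of_lt (by positivity)
    have e7 : x.n * x.n * (100 * x.n + 100 + 5) = 100 * (x.n * x.n * x.n) + 105 * (x.n * x.n) := by
      ring
    rw [e7] at hti
    rw [show y ^ 3 = y * y * y by ring]
    omega

end RAM

/-- Matrices can be multiplied in cubic time. -/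
theorem isMatMulExponent_three : IsMatMulExponent 3 := by
  intro c
  have hmax : ∀ x : MatMulInstance c, ∀ a ∈ x.input, a ≤ x.n + x.n ^ c := fun x a ha =>
    (x.le_of_mem_input ha).trans (by omega)
  have hraw : ∀ x : MatMulInstance c, RAM.rawSize x.input ≤
      2 * (x.n * x.n + (x.n + x.n ^ c)) + 2 := by
    intro x
    rw [RAM.rawSize, x.input_zero]
    have : x.input.getD 1 0 ≤ x.n + x.n ^ c := by
      by_cases h : 1 < x.input.length
      · rw [List.getD_eq_getElem _ _ h]; exact hmax x _ (List.getElem_mem h)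
      · rw [List.getD_eq_default _ _ (by omega)]; exact Nat.zero_le _
    omega
  have hpoly : ∀ x : MatMulInstance c, 2 * (x.n * x.n + (x.n + x.n ^ c)) + 2 +
      (x.n * (x.n ^ c * x.n ^ c) + x.n * x.n + x.n + 1) ≤ (x.n + 2) ^ (2 * c + 7) := by
    intro x
    set y := x.n + 2 with hy
    have e0 : x.n ≤ y := by omega
    have e1 : x.n ^ c ≤ y ^ c := Nat.pow_le_pow_left e0 c
    have hle : ∀ k ≤ 2 * c + 2, y ^ k ≤ y ^ (2 * c + 2) := fun k hk =>
      Nat.pow_le_pow_right (by omega) hk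
    have f1 := hle 0 (by omega)
    have f2 := hle 1 (by omega)
    have f3 := hle 2 (by omega)
    have f4 := hle c (by omega)
    have f5 := hle (2 * c + 1) (by omega)
    have g1 : x.n * (x.n ^ c * x.n ^ c) ≤ y ^ (2 * c + 1) := by
      rw [show y ^ (2 * c + 1) = y * (y ^ c * y ^ c) by ring]
      gcongr
    have g2 : x.n * x.n ≤ y ^ 2 := by rw [sq]; gcongr
    -- The left side is a sum of a dozen terms, each at most y ^ (2c + 2); the five additional
    -- factors y pay for their number.
    have h32 : 32 ≤ y ^ 5 := Nat.pow_le_pow_left (show 2 ≤ y by omega) 5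
    rw [show y ^ (2 * c + 7) = y ^ (2 * c + 2) * y ^ 5 by ring]
    have := Nat.mul_le_mul_left (y ^ (2 * c + 2)) h32
    simp only [pow_zero, pow_one] at f1 f2
    omega
  refine RAM.solvableInTime_of_wp RAM.naiveMul (fun x => (x.n + 2) ^ (2 * c + 7)) (2 * c + 7) 1000
    (fun x => le_rfl) (fun x => ?_) (fun x => ?_) (fun x => ?_) (fun x => ?_) (fun x a ha => ?_)
    (fun x => ?_)
  · exact Real.one_le_rpow (le_max_right _ _) (by norm_num)
  · change x.input.length ≤ RAM.rawSize x.input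
    rw [x.length_input, RAM.rawSize, x.input_zero]; omega
  · change _ ≤ RAM.rawSize x.input
    rw [length_matrixEntries, RAM.rawSize, x.input_zero]; omega
  · have := hraw x; have := hpoly x; change RAM.rawSize x.input ≤ _; omega
  · have := hmax x a ha; have := hpoly x; omega
  · have h1 := hraw x
    have h2 := hpoly x
    refine RAM.Stmt.wp_mono ?_ (RAM.naiveMul_wp x (by omega) (by omega))
    rintro τ ⟨hti, hl⟩
    refine ⟨?_, fun i hi => ?_⟩
    · calc (τ.time : ℝ) ≤ ((1000 * max x.n 1 ^ 3 : ℕ) : ℝ) := by exact_mod_cast hti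
        _ = 1000 * (max (x.n : ℝ) 1) ^ (3 : ℝ) := by
          rw [show (3 : ℝ) = ((3 : ℕ) : ℝ) by norm_num, Real.rpow_natCast]; push_cast; rfl
    · have hi' : i < x.n * x.n := by rwa [length_matrixEntries] at hi
      rw [hl i hi', ← matrixEntries_getD _ hi', List.getD_eq_getElem _ _ hi]

/-! ### Feasible exponents are at least one -/

/-- Only a store changes the memory, and it changes one cell. -/
theorem RAM.card_mem_ne_le (P : RAM.Program) (input : List ℕ) (t n : ℕ) :
    ((Finset.range n).filter fun a =>
      (RAM.run P input t).mem a ≠ (RAM.init input).mem a).card ≤ t := by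
  induction t with
  | zero => simp [RAM.run]
  | succ t ih =>
    have hrun : RAM.run P input (t + 1) = RAM.step P (RAM.run P input t) := by
      simp only [RAM.run, Function.iterate_succ_apply']
    obtain ⟨b, hb⟩ : ∃ b, ∀ a, a ≠ b →
        (RAM.step P (RAM.run P input t)).mem a = (RAM.run P input t).mem a := by
      unfold RAM.step
      split
      · rename_i i _
        cases i with
        | store a b => exact ⟨_, fun a' ha' => Function.update_of_ne ha' _ _⟩
        | _ => exact ⟨0, fun _ _ => rfl⟩
      · exact ⟨0, fun _ _ => rfl⟩
    refine (Finset.card_le_card (t := insert b _) ?_).trans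
      ((Finset.card_insert_le b _).trans (Nat.succ_le_succ ih))
    intro a ha
    simp only [Finset.mem_filter, Finset.mem_insert] at ha ⊢
    by_cases h : a = b
    · exact Or.inl h
    · exact Or.inr ⟨ha.1, by rw [← hb a h, ← hrun]; exact ha.2⟩

/-- No exponent is less than `1`, since the product has to be written. -/
theorem IsMatMulExponent.one_le {τ : ℝ} (h : IsMatMulExponent τ) : 1 ≤ τ := by
  obtain ⟨P, k, C, hP⟩ := h 0
  by_contra! hτ
  have key : ∀ n : ℕ, 2 ≤ n → (n : ℝ) ≤ |C| + 1 := by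
    intro n hn
    let x : MatMulInstance 0 := ⟨n, fun _ _ => 1, fun _ _ => 1, by simp, by simp⟩
    obtain ⟨t, ht, -, hout, -⟩ := hP x
    have hlen := length_matrixEntries (x.A * x.B)
    -- All entries of the product equal n ≥ 2, while the input cells after the first hold at most
    -- `1`. Cell `0` is the exception: it already contains n.
    have hcard : n * n - 1 ≤ t := by
      refine le_trans ?_ (RAM.card_mem_ne_le P x.input t (n * n))
      have : (Finset.Ico 1 (n * n)).card = n * n - 1 := by simp
      rw [← this]
      refine Finset.card_le_card fun a ha => ?_
      simp only [Finset.mem_Ico, Finset.mem_filter, Finset.mem_range] at ha ⊢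
      refine ⟨ha.2, ?_⟩
      have h1 := hout a (by rw [hlen]; exact ha.2)
      have h2 : (RAM.init x.input).mem a ≤ 1 := by
        obtain ⟨b, rfl⟩ : ∃ b, a = b + 1 := ⟨a - 1, by omega⟩
        simp only [RAM.init, MatMulInstance.input, List.getD_cons_succ]
        have hb : b < (matrixEntries x.A).length := by
          rw [length_matrixEntries]; change b < n * n; omega
        rw [List.getD_append _ _ _ _ hb, List.getD_eq_getElem _ _ hb, matrixEntries_getElem]
      have h3 : (matrixEntries (x.A * x.B))[a]'(by rw [hlen]; exact ha.2) = n := by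
        rw [matrixEntries_getElem, Matrix.mul_apply]
        simp [x]
      have h4 : (RAM.run P x.input t).mem a = n := h1.trans h3
      omega
    have hn' : (2 : ℝ) ≤ n := by exact_mod_cast hn
    have h1 : ((n * n : ℕ) : ℝ) ≤ t + 1 := by exact_mod_cast (by omega : n * n ≤ t + 1)
    have h2 : (max (x.n : ℝ) 1) ^ τ ≤ n := by
      rw [max_eq_left (by change (1 : ℝ) ≤ n; linarith)]
      calc (n : ℝ) ^ τ ≤ (n : ℝ) ^ (1 : ℝ) :=
            Real.rpow_le_rpow_of_exponent_le (by linarith) hτ.le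
        _ = n := Real.rpow_one _
    have h3 : (t : ℝ) ≤ |C| * n := ht.trans <|
      (mul_le_mul_of_nonneg_right (le_abs_self C) (by positivity)).trans
        (mul_le_mul_of_nonneg_left h2 (abs_nonneg C))
    push_cast at h1
    nlinarith [abs_nonneg C]
  obtain ⟨n, hn⟩ := exists_nat_gt (|C| + 1)
  have := key (n + 2) (by omega)
  push_cast at this
  linarith
namespace RAM

open Exp Stmt

/-! ### Simulation of a machine program

Variable `8` holds the program counter; memory and registers are the tables `5` and `6`
at index `var 11`. -/

/-- Execute the instruction with number `k`. -/
def simInstr (k : ℕ) : Instr → Stmt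
  | .const d c => put 6 (.var 11) (.const d) (.const c) ;; assign 8 (.const (k + 1))
  | .arith o d a b => put 6 (.var 11) (.const d)
      (.op o (.get 6 (.var 11) (.const a)) (.get 6 (.var 11) (.const b))) ;;
      assign 8 (.const (k + 1))
  | .load d a => put 6 (.var 11) (.const d)
      (.get 5 (.var 11) (.get 6 (.var 11) (.const a))) ;; assign 8 (.const (k + 1))
  | .store a b => put 5 (.var 11) (.get 6 (.var 11) (.const a)) (.get 6 (.var 11) (.const b)) ;;
      assign 8 (.const (k + 1))
  | .jumpIfZero a l => branch (.get 6 (.var 11) (.const a)) (assign 8 (.const (k + 1)))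
      (assign 8 (.const l))

/-- One step of the program whose instructions from number `k` on are given; nothing happens if
the program counter is outside. -/
def simStep : List Instr → ℕ → Stmt
  | [], _ => skip
  | i :: l, k =>
    branch ((.var 8 - .const k) + (.const k - .var 8)) (simStep l (k + 1)) (simInstr k i)

theorem simStep_modsVar (l : List Instr) (k : ℕ) {v : ℕ} (hv : v ≠ 8) :
    (simStep l k).modsVar v = false := by
  induction l generalizing k with
  | nil => rfl
  | cons i l ih => cases i <;> simp [simStep, modsVar, ih, simInstr, hv]

theorem simStep_modsTab (l : List Instr) (k : ℕ) {t : Fin 8} (h5 : t ≠ 5) (h6 : t ≠ 6) :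
    (simStep l k).modsTab t = false := by
  induction l generalizing k with
  | nil => rfl
  | cons i l ih => cases i <;> simp [simStep, modsTab, ih, simInstr, h5, h6]

theorem simStep_modsLow (l : List Instr) (k : ℕ) : (simStep l k).modsLow = false := by
  induction l generalizing k with
  | nil => rfl
  | cons i l ih => cases i <;> simp [simStep, modsLow, ih, simInstr]

theorem simStep_flat (l : List Instr) (k : ℕ) : (simStep l k).flat = true := by
  induction l generalizing k with
  | nil => rfl
  | cons i l ih => cases i <;> simp [simStep, flat, ih, simInstr]

/-- The state holds the configuration `c` of the simulated machine, and the tables at indices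
above `j` are not used yet. -/
structure Simulates (j : ℕ) (σ : State) (c : Config) : Prop where
  pc : σ.var 8 = c.pc
  reg : ∀ r, σ.tab 6 j r = c.reg r
  mem : ∀ a, σ.tab 5 j a = c.mem a
  fresh : ∀ b, j < b → ∀ a, σ.tab 5 b a = 0 ∧ σ.tab 6 b a = 0

/-- A bound for the numbers of the instructions and the targets of jumps. -/
def Program.PcBound (P : Program) (M : ℕ) : Prop :=
  P.length ≤ M ∧ ∀ i ∈ P, ∀ a l, i = .jumpIfZero a l → l ≤ M

theorem Program.exists_pcBound (P : Program) : ∃ K, P.PcBound K := by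
  suffices h : ∃ K, ∀ i ∈ P, ∀ a l, i = .jumpIfZero a l → l ≤ K by
    obtain ⟨K, hK⟩ := h
    exact ⟨max P.length K, le_max_left _ _,
      fun i hi a l h => (hK i hi a l h).trans (le_max_right _ _)⟩
  induction P with
  | nil => exact ⟨0, by simp⟩
  | cons i P ih =>
    obtain ⟨K, hK⟩ := ih
    obtain ⟨K', hK'⟩ : ∃ K', ∀ a l, i = .jumpIfZero a l → l ≤ K' := by
      cases i with
      | jumpIfZero a l => exact ⟨l, by rintro _ _ ⟨⟩; exact le_rfl⟩
      | _ => exact ⟨0, by simp⟩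
    refine ⟨max K K', fun i' hi' a l h => ?_⟩
    rcases List.mem_cons.1 hi' with rfl | hi'
    · exact (hK' a l h).trans (le_max_right _ _)
    · exact (hK i' hi' a l h).trans (le_max_left _ _)

theorem Program.PcBound.mono {P : Program} {K M : ℕ} (h : P.PcBound K) (hM : K ≤ M) :
    P.PcBound M := ⟨h.1.trans hM, fun i hi a l hl => (h.2 i hi a l hl).trans hM⟩

theorem simInstr_wp {off M j k : ℕ} {i : Instr} {σ : State} {c : Config} (hk : k + 1 ≤ M)
    (hl : ∀ a l, i = .jumpIfZero a l → l ≤ M) (hpc : c.pc = k) (hj : σ.var 11 = j)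
    (hsim : Simulates j σ c) (hb : (i.exec c).Bounded M) :
    (simInstr k i).wp off M (fun τ => Simulates j τ (i.exec c)) σ := by
  have hr := hsim.reg
  have hm := hsim.mem
  have hn := hsim.fresh
  cases i with
  | const d n =>
    have := (hb d).1
    simp only [Instr.exec, Function.update_self] at this
    simp only [simInstr, wp_seq_iff, wp_put, wp_assign, safe_var, safe_const, eval_const, hk, this,
      eval_var, true_and, hj]
    refine ⟨by simp [Instr.exec, hpc], fun r => ?_, fun a => by simp [Instr.exec, hm],
      fun b hb a => by simp [hb.ne', hn b hb a]⟩
    simp [Instr.exec, Function.update_apply, hr]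
  | arith o d a b =>
    have := (hb d).1
    simp only [Instr.exec, Function.update_self] at this
    simp only [simInstr, wp_seq_iff, wp_put, wp_assign, hk, this, true_and, hj, Exp.Safe, Exp.eval,
      hr]
    refine ⟨by simp [Instr.exec, hpc], fun r => ?_, fun a => by simp [Instr.exec, hm],
      fun b hb a => by simp [hb.ne', hn b hb a]⟩
    simp [Instr.exec, Function.update_apply, hr]
  | load d a =>
    have := (hb d).1
    simp only [Instr.exec, Function.update_self] at this
    simp only [simInstr, wp_seq_iff, wp_put, wp_assign, safe_var, safe_const, eval_const, hk, this,
      eval_var, true_and, hj, safe_get, eval_get, hr, hm]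
    refine ⟨by simp [Instr.exec, hpc], fun r => ?_, fun a => by simp [Instr.exec, hm],
      fun b hb a => by simp [hb.ne', hn b hb a]⟩
    simp [Instr.exec, Function.update_apply, hr]
  | store a b =>
    have := (hb (c.reg a)).2
    simp only [Instr.exec, Function.update_self] at this
    simp only [simInstr, wp_seq_iff, wp_put, wp_assign, safe_var, safe_const, eval_const, hk, this,
      eval_var, true_and, hj, safe_get, eval_get, hr]
    refine ⟨by simp [Instr.exec, hpc], fun r => by simp [Instr.exec, hr], fun a => ?_,
      fun b hb a => by simp [hb.ne', hn b hb a]⟩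
    simp [Instr.exec, Function.update_apply, hm]
  | jumpIfZero a l =>
    have := hl a l rfl
    simp only [simInstr, wp_branch, wp_assign, safe_var, safe_const, eval_const, hk, this,
      eval_var, true_and, hj, safe_get, eval_get, hr]
    refine ⟨fun h => ⟨by simp [Instr.exec, h, hpc], fun r => by simp [Instr.exec, hr],
      fun a => by simp [Instr.exec, hm], hn⟩, fun h => ⟨by simp [Instr.exec, h],
      fun r => by simp [Instr.exec, hr], fun a => by simp [Instr.exec, hm], hn⟩⟩

theorem Simulates.tick {j : ℕ} {σ : State} {c : Config} (h : Simulates j σ c) (n : ℕ) :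
    Simulates j (σ.tick n) c := ⟨h.pc, h.reg, h.mem, h.fresh⟩

/-- Induction over the suffix of `P` still to be searched. As long as `k ≤ c.pc`, the current
instruction has not been passed; reaching the end of the list means that the machine has halted. The
sum of the two truncated differences in `simStep` vanishes exactly at equality. -/
theorem simStep_wp {P : Program} {off M j : ℕ} {σ : State} {c : Config} (hP : P.PcBound M)
    (hj : σ.var 11 = j) (hsim : Simulates j σ c) (hb : (step P c).Bounded M) :
    (simStep P 0).wp off M (fun τ => Simulates j τ (step P c)) σ := by
  suffices h : ∀ l k, P.drop k = l → k ≤ c.pc → ∀ σ, σ.var 11 = j → Simulates j σ c →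
      (simStep l k).wp off M (fun τ => Simulates j τ (step P c)) σ from
    h P 0 rfl (Nat.zero_le _) σ hj hsim
  intro l
  induction l with
  | nil =>
    intro k hk hkc σ hj hsim
    rw [List.drop_eq_nil_iff] at hk
    have : step P c = c := by simp [step, List.getElem?_eq_none (hk.trans hkc)]
    rw [this]
    exact hsim
  | cons i l ih =>
    intro k hk hkc σ hj hsim
    have hkP : k < P.length := by
      by_contra h
      rw [List.drop_eq_nil_of_le (by omega)] at hk
      simp at hk
    rw [List.drop_eq_getElem_cons hkP, List.cons.injEq] at hk
    have h8 := hsim.pc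
    simp only [simStep, wp_branch, safe_add, safe_sub, safe_var, safe_const, true_and, eval_add,
      eval_sub, eval_var, eval_const]
    refine ⟨fun h => wp_mono (fun τ hτ => hτ.tick _)
      (ih (k + 1) hk.2 (by omega) _ hj (hsim.tick _)), fun h => ?_⟩
    have hpc : c.pc = k := by omega
    have hstep : step P c = i.exec c := by simp [step, hpc, hkP, hk.1]
    rw [hstep] at hb ⊢
    exact simInstr_wp (by have := hP.1; omega)
      (hP.2 i (by rw [← hk.1]; exact List.getElem_mem hkP)) hpc hj (hsim.tick _) hb

/-- Simulating `e` steps. -/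
theorem rep_simStep_wp {P : Program} {off M j : ℕ} {σ : State} {input : List ℕ} {e : Exp}
    {Q : State → Prop} (he : e.Safe off σ) (hP : P.PcBound M)
    (hj : σ.var 11 = j) (hsim : Simulates j σ (init input))
    (hb : ∀ t, ∀ i, (run P input t).reg i ≤ M ∧ (run P input t).mem i ≤ M)
    (hQ : ∀ τ, Simulates j τ (run P input (e.eval σ)) → (rep e (simStep P 0)).Frame σ τ →
      τ.time ≤ σ.time + e.cost + 1 + e.eval σ * ((simStep P 0).cost + 5) → Q τ) :
    (rep e (simStep P 0)).wp off M Q σ := by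
  refine wp_rep_flat (fun k τ => Simulates j τ (run P input k)) (simStep_flat _ _) he
    (fun _ _ _ h => h.tick _) hsim (fun k τ hk hτ hf => ?_) hQ
  have hrun : run P input (k + 1) = step P (run P input k) := by
    simp only [run, Function.iterate_succ_apply']
  rw [hrun]
  refine simStep_wp hP ?_ hτ ?_
  · rw [hf.var 11 (simStep_modsVar _ _ (by decide)), hj]
  · rw [← hrun]; exact hb _

theorem step_of_halted {P : Program} {c : Config} (h : Halted P c) : step P c = c := by
  simp [step, List.getElem?_eq_none h]

/-- Because a halted machine stands still, a simulation may overshoot the running time, and the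
bounds and the output remain valid for every larger number of steps. -/
theorem run_of_halted {P : Program} {input : List ℕ} {t t' : ℕ} (h : Halted P (run P input t))
    (ht : t ≤ t') : run P input t' = run P input t := by
  induction t', ht using Nat.le_induction with
  | base => rfl
  | succ t' _ ih =>
    rw [← ih] at h ⊢
    simp only [run, Function.iterate_succ_apply'] at h ⊢
    exact step_of_halted h

/-- All configurations of a run that halts within its bound are bounded. -/
theorem ComputesWithin.bounded {P : Program} {input output : List ℕ} {T : ℝ} {B : ℕ}
    (h : ComputesWithin P input output T B) (t i : ℕ) :
    (run P input t).reg i ≤ B ∧ (run P input t).mem i ≤ B := by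
  obtain ⟨t', -, hh, -, hb⟩ := h
  rcases le_total t t' with ht | ht
  · exact hb t ht i
  · rw [run_of_halted hh ht]; exact hb t' le_rfl i

theorem ComputesWithin.mem_eq {P : Program} {input output : List ℕ} {T : ℝ} {B : ℕ}
    (h : ComputesWithin P input output T B) {t : ℕ} (ht : Halted P (run P input t)) {i : ℕ}
    (hi : i < output.length) : (run P input t).mem i = output[i] := by
  obtain ⟨t', -, hh, hout, -⟩ := h
  rw [← hout i hi]
  rcases le_total t t' with h | h
  · rw [run_of_halted ht h]
  · rw [run_of_halted hh h]

theorem ComputesWithin.halted {P : Program} {input output : List ℕ} {T : ℝ} {B : ℕ}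
    (h : ComputesWithin P input output T B) {t : ℕ} (ht : T ≤ t) : Halted P (run P input t) := by
  obtain ⟨t', ht', hh, -, -⟩ := h
  rwa [run_of_halted hh (by exact_mod_cast ht'.trans ht)]

end RAM

/-! ### Containment through counting common neighbours -/

/-- The oriented edges of a finite simple graph on natural numbers, numbered from `0`. -/
structure Darts where
  L : ℕ
  s : ℕ → ℕ
  t : ℕ → ℕ
  rev : ℕ → ℕ
  rev_lt : ∀ i < L, rev i < L
  s_rev : ∀ i < L, s (rev i) = t i
  t_rev : ∀ i < L, t (rev i) = s i
  inj : ∀ i < L, ∀ i' < L, s i = s i' → t i = t i' → i = i'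
  ne : ∀ i < L, s i ≠ t i

namespace Darts

open Classical Finset

variable (d : Darts)

def Adj (x y : ℕ) : Prop := ∃ i < d.L, d.s i = x ∧ d.t i = y

noncomputable def deg (x : ℕ) : ℕ := Nat.count (fun i => d.s i = x) d.L

/-- The neighbours of a vertex. -/
noncomputable def nb (x : ℕ) : Finset ℕ := ((range d.L).filter fun i => d.s i = x).image d.t

/-- `N[x] ⊆ N[y]` for neighbours `x` and `y`, expressed by the number of common neighbours. -/
def Good (x y : ℕ) : Prop := (d.nb x ∩ d.nb y).card + 1 = d.deg x

variable {d}

theorem Adj.symm {x y : ℕ} (h : d.Adj x y) : d.Adj y x := by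
  obtain ⟨i, hi, rfl, rfl⟩ := h
  exact ⟨d.rev i, d.rev_lt i hi, d.s_rev i hi, d.t_rev i hi⟩

theorem not_adj_self (x : ℕ) : ¬ d.Adj x x := by
  rintro ⟨i, hi, h, h'⟩
  exact d.ne i hi (h.trans h'.symm)

theorem adj_of_lt {i : ℕ} (hi : i < d.L) : d.Adj (d.s i) (d.t i) := ⟨i, hi, rfl, rfl⟩

theorem mem_nb {x y : ℕ} : y ∈ d.nb x ↔ d.Adj x y := by
  simp [nb, Adj, and_assoc]

/-- By `inj`, the target map is injective on the darts that start in `x`, so counting such darts is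
counting neighbours. -/
theorem count_out (x : ℕ) (p : ℕ → Prop) [DecidablePred p]
    [DecidablePred fun i => d.s i = x ∧ p (d.t i)] :
    Nat.count (fun i => d.s i = x ∧ p (d.t i)) d.L = ((d.nb x).filter p).card := by
  rw [Nat.count_eq_card_filter_range]
  have : (d.nb x).filter p =
      ((range d.L).filter fun i => d.s i = x ∧ p (d.t i)).image d.t := by
    ext y
    simp only [mem_filter, mem_nb, Adj, mem_image, mem_range]
    constructor
    · rintro ⟨⟨i, hi, rfl, rfl⟩, hp⟩; exact ⟨i, ⟨hi, rfl, hp⟩, rfl⟩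
    · rintro ⟨i, ⟨hi, rfl, hp⟩, rfl⟩; exact ⟨⟨i, hi, rfl, rfl⟩, hp⟩
  rw [this, card_image_of_injOn]
  intro i hi i' hi' h
  simp only [coe_filter, Set.mem_ofPred_eq, mem_range] at hi hi'
  exact d.inj i hi.1 i' hi'.1 (hi.2.1.trans hi'.2.1.symm) h

theorem count_in (x : ℕ) (p : ℕ → Prop) [DecidablePred p]
    [DecidablePred fun i => d.t i = x ∧ p (d.s i)] :
    Nat.count (fun i => d.t i = x ∧ p (d.s i)) d.L = ((d.nb x).filter p).card := by
  rw [Nat.count_eq_card_filter_range]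
  have : (d.nb x).filter p =
      ((range d.L).filter fun i => d.t i = x ∧ p (d.s i)).image d.s := by
    ext y
    simp only [mem_filter, mem_nb, mem_image, mem_range]
    constructor
    · rintro ⟨h, hp⟩
      obtain ⟨i, hi, rfl, rfl⟩ := h.symm
      exact ⟨i, ⟨hi, rfl, hp⟩, rfl⟩
    · rintro ⟨i, ⟨hi, rfl, hp⟩, rfl⟩; exact ⟨(adj_of_lt hi).symm, hp⟩
  rw [this, card_image_of_injOn]
  intro i hi i' hi' h
  simp only [coe_filter, Set.mem_ofPred_eq, mem_range] at hi hi'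
  exact d.inj i hi.1 i' hi'.1 h (hi.2.1.trans hi'.2.1.symm)

theorem card_nb (x : ℕ) : (d.nb x).card = d.deg x := by
  have := count_out (d := d) x fun _ => True
  simp only [and_true, filter_true] at this
  rw [← this, deg]

theorem deg_le (x : ℕ) : d.deg x ≤ d.L := Nat.count_le _

theorem deg_pos {i : ℕ} (hi : i < d.L) : 0 < d.deg (d.s i) := by
  rw [← card_nb]
  exact card_pos.2 ⟨d.t i, mem_nb.2 (adj_of_lt hi)⟩

theorem exists_of_deg_pos {x : ℕ} (h : 0 < d.deg x) : ∃ i < d.L, d.s i = x := by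
  rw [← card_nb, card_pos] at h
  obtain ⟨y, hy⟩ := h
  obtain ⟨i, hi, rfl, -⟩ := mem_nb.1 hy
  exact ⟨i, hi, rfl⟩

theorem card_inter_le (x y : ℕ) : (d.nb x ∩ d.nb y).card ≤ d.L :=
  (card_le_card inter_subset_left).trans ((card_nb x).le.trans (deg_le x))

theorem filter_adj (x y : ℕ) : (d.nb x).filter (d.Adj y) = d.nb x ∩ d.nb y := by
  ext z; simp [mem_nb]

theorem filter_eq (x z : ℕ) : ((d.nb x).filter (· = z)).card = if d.Adj x z then 1 else 0 := by
  rw [Finset.filter_eq']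
  split_ifs with h h' h' <;> simp_all [mem_nb]

/-- The common neighbours form a proper subset of the neighbours of `y`, since `x` is a neighbour of
`y` but not of itself. This is why no containment goes from a vertex of high degree to one of low
degree. -/
theorem Good.deg_le_deg {x y : ℕ} (h : d.Adj x y) (hg : d.Good x y) : d.deg x ≤ d.deg y := by
  rw [← hg, ← card_nb y]
  refine Nat.succ_le_of_lt (card_lt_card ?_)
  refine ⟨inter_subset_right, fun hs => ?_⟩
  have := hs (mem_nb.2 h.symm)
  exact not_adj_self x (mem_nb.1 (mem_inter.1 this).1)

/-- Containment of closed neighbourhoods, expressed by the number of common neighbours. -/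
theorem good_iff {x y : ℕ} (h : d.Adj x y) :
    d.Good x y ↔ ∀ z, d.Adj x z → z = y ∨ d.Adj y z := by
  have hy : y ∉ d.nb x ∩ d.nb y := fun hm => not_adj_self y (mem_nb.1 (mem_inter.1 hm).2)
  -- This inclusion always holds, so equality of cardinalities means equality of the sets, which is
  -- the containment.
  have hsub : insert y (d.nb x ∩ d.nb y) ⊆ d.nb x :=
    insert_subset (mem_nb.2 h) inter_subset_left
  rw [Good, ← card_nb x, ← card_insert_of_notMem hy]
  constructor
  · intro hc z hz
    rw [← mem_nb, ← eq_of_subset_of_card_le hsub hc.ge] at hz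
    rw [mem_insert, mem_inter, mem_nb, mem_nb] at hz
    exact hz.imp_right And.right
  · intro hz
    congr 1
    refine hsub.antisymm fun z hzm => ?_
    have := hz z (mem_nb.1 hzm)
    simp only [mem_insert, mem_inter, mem_nb] at hzm ⊢
    tauto

theorem card_filter_split (x y D : ℕ) :
    ((d.nb x ∩ d.nb y).filter fun z => d.deg z ≤ D).card +
      ((d.nb x ∩ d.nb y).filter fun z => D < d.deg z).card = (d.nb x ∩ d.nb y).card := by
  simpa using card_filter_add_card_filter_not (s := d.nb x ∩ d.nb y) fun z => d.deg z ≤ D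

/-- `f x` lists the neighbours of `x`. -/
theorem count_list {f : ℕ → ℕ → ℕ} (x : ℕ) (p : ℕ → Prop) [DecidablePred p]
    [DecidablePred fun k => p (f x k)]
    (hf : ∀ i < d.L, f (d.s i) (Nat.count (fun i' => d.s i' = d.s i) i) = d.t i) :
    Nat.count (fun k => p (f x k)) (d.deg x) = ((d.nb x).filter p).card := by
  rw [← count_out, deg]
  -- The darts before `l` with source `x` fill precisely an initial segment of the list of `x`, so
  -- both counts grow together along the dart list.
  suffices h : ∀ l ≤ d.L, Nat.count (fun k => p (f x k)) (Nat.count (fun i => d.s i = x) l) =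
      Nat.count (fun i => d.s i = x ∧ p (d.t i)) l from h _ le_rfl
  intro l
  induction l with
  | zero => simp
  | succ l ih =>
    intro hl
    rw [Nat.count_succ, Nat.count_succ]
    have hfl := hf l (by omega)
    by_cases hx : d.s l = x
    · subst hx
      simp [Nat.count_succ, ih (by omega), hfl]
    · simp [hx, ih (by omega)]

/-- Counting the list entries adjacent to `x` gives the full number `d.deg x` of entries, so every
entry qualifies. -/
theorem adj_list {f : ℕ → ℕ → ℕ}
    (hf : ∀ i < d.L, f (d.s i) (Nat.count (fun i' => d.s i' = d.s i) i) = d.t i) {x k : ℕ}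
    (hk : k < d.deg x) : d.Adj x (f x k) := by
  have h := count_list x (d.Adj x) hf
  rw [filter_adj, inter_self, card_nb, Nat.count_iff_forall] at h
  exact h k hk

/-! ### Vertices of high degree and the square of their adjacency matrix -/

/-- A numbering `1, …, N` of the vertices of degree more than `D`; the others have number `0`. -/
structure Numbering (d : Darts) (D N : ℕ) (f : ℕ → ℕ) : Prop where
  ne_zero : ∀ x, f x ≠ 0 ↔ D < d.deg x
  le : ∀ x, f x ≤ N
  surj : ∀ p, 1 ≤ p → p ≤ N → ∃ x, f x = p
  inj : ∀ x y, f x = f y → f x ≠ 0 → x = y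

/-- Each numbered vertex is the source of more than `D` darts, and different numbers have disjoint
sets of darts. -/
theorem Numbering.mul_le {D N : ℕ} {f : ℕ → ℕ} (h : Numbering d D N f) : N * D ≤ d.L := by
  have h1 : ((range d.L).filter fun i => f (d.s i) ≠ 0).card =
      ∑ p ∈ Icc 1 N, (((range d.L).filter fun i => f (d.s i) ≠ 0).filter
        fun i => f (d.s i) = p).card :=
    card_eq_sum_card_fiberwise fun i hi => by
      simp only [coe_filter, Set.mem_ofPred_eq] at hi
      simp only [coe_Icc, Set.mem_Icc]
      exact ⟨Nat.pos_of_ne_zero hi.2, h.le _⟩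
  have h2 : (Icc 1 N).card • D ≤ ∑ p ∈ Icc 1 N, (((range d.L).filter
      fun i => f (d.s i) ≠ 0).filter fun i => f (d.s i) = p).card := by
    refine card_nsmul_le_sum _ _ _ fun p hp => ?_
    rw [mem_Icc] at hp
    obtain ⟨x, rfl⟩ := h.surj p hp.1 hp.2
    have hx : f x ≠ 0 := by omega
    refine ((h.ne_zero x).1 hx).le.trans ?_
    rw [deg, Nat.count_eq_card_filter_range]
    refine card_le_card fun i hi => ?_
    simp only [mem_filter] at hi ⊢
    exact ⟨⟨hi.1, by rw [hi.2]; exact hx⟩, by rw [hi.2]⟩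
  rw [← h1] at h2
  simp only [Nat.card_Icc, Nat.add_sub_cancel, smul_eq_mul] at h2
  exact h2.trans ((card_filter_le _ _).trans (by simp))

/-- The adjacency matrix of the numbered vertices. -/
noncomputable def highMatrix (d : Darts) (N : ℕ) (f : ℕ → ℕ) : Matrix (Fin N) (Fin N) ℕ :=
  fun p q => if ∃ i < d.L, f (d.s i) = p + 1 ∧ f (d.t i) = q + 1 then 1 else 0

noncomputable def highInstance (d : Darts) (N : ℕ) (f : ℕ → ℕ) : MatMulInstance 0 :=
  ⟨N, d.highMatrix N f, d.highMatrix N f,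
    fun i j => by unfold highMatrix; split_ifs <;> simp,
    fun i j => by unfold highMatrix; split_ifs <;> simp⟩

theorem Numbering.entry {D N : ℕ} {f : ℕ → ℕ} (h : Numbering d D N f) {x y : ℕ} (hx : f x ≠ 0)
    (hy : f y ≠ 0) : (d.highMatrix N f).entry (f x - 1) (f y - 1) =
      if d.Adj x y then 1 else 0 := by
  have hx' := h.le x
  have hy' := h.le y
  rw [Matrix.entry, dif_pos ⟨by omega, by omega⟩, highMatrix]
  refine if_congr ?_ rfl rfl
  refine exists_congr fun i => and_congr_right fun _ => and_congr ?_ ?_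
  · refine ⟨fun e => h.inj _ _ (by simp at e; omega) (by simp at e; omega), fun e => ?_⟩
    rw [e]; simp; omega
  · refine ⟨fun e => h.inj _ _ (by simp at e; omega) (by simp at e; omega), fun e => ?_⟩
    rw [e]; simp; omega

/-- The square of the adjacency matrix counts common neighbours. -/
theorem Numbering.entry_mul {D N : ℕ} {f : ℕ → ℕ} (h : Numbering d D N f) {x y : ℕ}
    (hx : f x ≠ 0) (hy : f y ≠ 0) :
    (d.highMatrix N f * d.highMatrix N f).entry (f x - 1) (f y - 1) =
      ((d.nb x ∩ d.nb y).filter fun z => D < d.deg z).card := by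
  have hx' := h.le x
  have hy' := h.le y
  rw [Matrix.entry_mul _ _ (by omega) (by omega), card_eq_sum_ones]
  symm
  have hsub : ((d.nb x ∩ d.nb y).filter fun z => D < d.deg z).image (fun z => f z - 1) ⊆
      range N := by
    intro p hp
    simp only [mem_image, mem_filter] at hp
    obtain ⟨z, ⟨-, hz⟩, rfl⟩ := hp
    have := (h.ne_zero z).2 hz
    have := h.le z
    simp only [mem_range]; omega
  -- Every index of the sum is the number of some vertex; its term is `1` if that vertex is a common
  -- neighbour and `0` otherwise.
  rw [← sum_subset hsub, sum_image]
  · refine sum_congr rfl fun z hz => ?_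
    simp only [mem_filter, mem_inter, mem_nb] at hz
    have hz' := (h.ne_zero z).2 hz.2
    rw [h.entry hx hz', h.entry hz' hy, if_pos hz.1.1, if_pos hz.1.2.symm]
  · intro z hz z' hz' e
    simp only [coe_filter, Set.mem_ofPred_eq] at hz hz'
    have h1 := (h.ne_zero z).2 hz.2
    have h2 := (h.ne_zero z').2 hz'.2
    exact h.inj z z' (by simp only at e; omega) h1
  · intro p hp hpn
    rw [mem_range] at hp
    obtain ⟨z, hz⟩ := h.surj (p + 1) (by omega) (by omega)
    have hz0 : f z ≠ 0 := by omega
    have hpz : p = f z - 1 := by omega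
    rw [hpz, h.entry hx hz0, h.entry hz0 hy]
    by_contra hne
    apply hpn
    rw [mem_image]
    refine ⟨z, ?_, hpz.symm⟩
    rw [mem_filter, mem_inter, mem_nb, mem_nb]
    by_cases h1 : d.Adj x z
    · by_cases h2 : d.Adj z y
      · exact ⟨⟨h1, h2.symm⟩, (h.ne_zero z).1 hz0⟩
      · simp [h2] at hne
    · simp [h1] at hne

/-- The input for the multiplication of the adjacency matrix with itself. -/
theorem Numbering.input_getD {D N : ℕ} {f : ℕ → ℕ} (h : Numbering d D N f) {a : ℕ} (ha : a ≠ 0) :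
    (d.highInstance N f).input.getD a 0 =
      if ∃ i < d.L, f (d.s i) * f (d.t i) ≠ 0 ∧
        (a = 1 + (f (d.s i) - 1) * N + (f (d.t i) - 1) ∨
          a = 1 + N * N + (f (d.s i) - 1) * N + (f (d.t i) - 1)) then 1 else 0 := by
  have hlt : ∀ i, f (d.s i) * f (d.t i) ≠ 0 → f (d.s i) - 1 < N ∧ f (d.t i) - 1 < N ∧
      f (d.s i) ≠ 0 ∧ f (d.t i) ≠ 0 := by
    intro i hi
    have h1 := h.le (d.s i)
    have h2 := h.le (d.t i)
    have h3 := left_ne_zero_of_mul hi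
    have h4 := right_ne_zero_of_mul hi
    omega
  have hdec : ∀ u v u' v', u < N → v < N → u' < N → v' < N → u * N + v = u' * N + v' →
      u = u' ∧ v = v' := by
    intro u v u' v' _ hv _ hv' e
    have h1 := congrArg (· / N) e
    have h2 := congrArg (· % N) e
    simp only [Nat.add_comm _ v, Nat.add_comm _ v', Nat.add_mul_div_right _ _ (show 0 < N by omega),
      Nat.div_eq_of_lt hv, Nat.div_eq_of_lt hv', Nat.add_mul_mod_self_right, Nat.mod_eq_of_lt hv,
      Nat.mod_eq_of_lt hv', Nat.zero_add] at h1 h2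
    exact ⟨h1, h2⟩
  have hent : ∀ u v, u < N → v < N → (d.highMatrix N f).entry u v =
      if ∃ i < d.L, f (d.s i) * f (d.t i) ≠ 0 ∧ u = f (d.s i) - 1 ∧ v = f (d.t i) - 1
        then 1 else 0 := by
    intro u v hu hv
    rw [Matrix.entry, dif_pos ⟨hu, hv⟩, highMatrix]
    refine if_congr (exists_congr fun i => and_congr_right fun _ => ?_) rfl rfl
    constructor
    · rintro ⟨e1, e2⟩
      simp only at e1 e2
      rw [e1, e2]
      exact ⟨by positivity, by omega, by omega⟩
    · rintro ⟨e0, e1, e2⟩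
      have := hlt i e0
      exact ⟨by simp only; omega, by simp only; omega⟩
  have hn : (d.highInstance N f).n = N := rfl
  -- The cell belongs to the first factor, to the second factor, or lies behind the input. In the
  -- first two cases its row and column are recovered by division with remainder.
  rcases lt_or_ge a (1 + N * N) with h1 | h1
  · have hN : 0 < N := Nat.pos_of_ne_zero (by rintro rfl; omega)
    have hu : (a - 1) / N < N := Nat.div_lt_of_lt_mul (by omega)
    have hv : (a - 1) % N < N := Nat.mod_lt _ hN
    have hav : a = 1 + (a - 1) / N * N + (a - 1) % N := by
      have := Nat.div_add_mod' (a - 1) N; omega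
    generalize (a - 1) / N = u at *
    generalize (a - 1) % N = v at *
    have := (d.highInstance N f).input_left (i := u) (k := v) hu hv
    rw [show 1 + u * (d.highInstance N f).n + v = a from hav.symm] at this
    rw [this]
    refine (hent u v hu hv).trans (if_congr (exists_congr fun i => and_congr_right fun _ =>
      and_congr_right fun h0 => ?_) rfl rfl)
    have := hlt i h0
    constructor
    · rintro ⟨rfl, rfl⟩; exact Or.inl hav
    · rintro (e | e)
      · exact hdec _ _ _ _ hu hv this.1 this.2.1 (by omega)
      · omega
  rcases lt_or_ge a (1 + N * N + N * N) with h2 | h2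
  · have hN : 0 < N := Nat.pos_of_ne_zero (by rintro rfl; omega)
    have hu : (a - 1 - N * N) / N < N := Nat.div_lt_of_lt_mul (by omega)
    have hv : (a - 1 - N * N) % N < N := Nat.mod_lt _ hN
    have hav : a = 1 + N * N + (a - 1 - N * N) / N * N + (a - 1 - N * N) % N := by
      have := Nat.div_add_mod' (a - 1 - N * N) N; omega
    generalize (a - 1 - N * N) / N = u at *
    generalize (a - 1 - N * N) % N = v at *
    have := (d.highInstance N f).input_right (k := u) (j := v) hu hv
    rw [show 1 + (d.highInstance N f).n * (d.highInstance N f).n + u * (d.highInstance N f).n + v =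
      a from hav.symm] at this
    rw [this]
    refine (hent u v hu hv).trans (if_congr (exists_congr fun i => and_congr_right fun _ =>
      and_congr_right fun h0 => ?_) rfl rfl)
    have := hlt i h0
    constructor
    · rintro ⟨rfl, rfl⟩; exact Or.inr hav
    · rintro (e | e)
      · have := mul_add_lt_mul_self this.1 this.2.1
        omega
      · exact hdec _ _ _ _ hu hv this.1 this.2.1 (by omega)
  · rw [List.getD_eq_default _ _ (by rw [MatMulInstance.length_input, hn]; omega), if_neg]
    rintro ⟨i, hi, h0, e⟩
    have := hlt i h0
    have := mul_add_lt_mul_self this.1 this.2.1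
    omega

end Darts
namespace RAM

open Exp Stmt Classical

/-! ### The algorithm for closed neighbourhood containment

Variables: `0` dart, `1` source, `2` target, `3` position in a list of neighbours, `4` count,
`5` and `6` current and previous degree threshold, `7` number of vertices of high degree,
`8` simulated program counter, `9` result, `10` flag for the end, `11` stage, `12` number of darts,
`13` neighbour.
Tables: `0` degrees, `1` adjacency matrix, `2` lists of neighbours, `3` numbers of common
neighbours of low degree, `4` numbering of the vertices of high degree, `5` and `6` memory and
registers of the simulated machine (`4`, `5` and `6` are indexed by the stage). -/

/-- Dart `i` starts at the vertex in cell `i + 2` and ends at the one in the other cell of the same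
edge, which is the next or the previous cell according to the parity `i - 2 * (i / 2)`. -/
def loadDart : Stmt :=
  assign 1 (.low (.var 0 + 2)) ;;
  assign 2 (.low (.var 0 + 3 - 2 * (.var 0 - 2 * (.var 0 / 2))))

/-- The raw memory holds the darts. -/
structure Encodes (d : Darts) (off M : ℕ) (low : ℕ → ℕ) : Prop where
  count : low 1 * 2 = d.L
  src : ∀ i < d.L, low (i + 2) = d.s i
  dst : ∀ i < d.L, low (i + 3 - 2 * (i - 2 * (i / 2))) = d.t i
  off_le : d.L + 2 ≤ off
  src_le : ∀ i < d.L, d.s i ≤ M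
  dst_le : ∀ i < d.L, d.t i ≤ M
  L_le : 3 * d.L + 10 ≤ M

theorem loadDart_wp {d : Darts} {off M i : ℕ} {σ : State} {Q : State → Prop}
    (he : Encodes d off M σ.low) (hi : i < d.L) (h0 : σ.var 0 = i)
    (hQ : Q ((σ.setVar 1 (d.s i) 7).setVar 2 (d.t i) 19)) :
    loadDart.wp off M Q σ := by
  have h1 := he.src i hi
  have h2 := he.dst i hi
  have h3 := he.src_le i hi
  have h4 := he.dst_le i hi
  have h5 := he.off_le
  have h6 := he.count
  simp only [loadDart, wp_seq_iff, wp_assign, safe_low, safe_add, safe_sub, safe_mul, safe_div,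
    safe_var, safe_ofNat, eval_low, eval_add, eval_sub, eval_mul, eval_div, eval_var, eval_ofNat,
    State.setVar_var, State.setVar_low, h0, if_neg (show (0 : ℕ) ≠ 1 by decide), h1, h2, true_and]
  exact ⟨by omega, h3, by omega, h4, hQ⟩

/-- The tables that are filled at the beginning. -/
structure Tables (d : Darts) (σ : State) : Prop where
  deg : ∀ x, σ.tab 0 0 x = d.deg x
  adj : ∀ x y, σ.tab 1 x y = if d.Adj x y then 1 else 0
  nbr : ∀ i < d.L, σ.tab 2 (d.s i) (Nat.count (fun i' => d.s i' = d.s i) i) = d.t i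

theorem Tables.congr {d : Darts} {σ τ : State} (h : Tables d σ) (h0 : τ.tab 0 = σ.tab 0)
    (h1 : τ.tab 1 = σ.tab 1) (h2 : τ.tab 2 = σ.tab 2) : Tables d τ :=
  ⟨by rw [h0]; exact h.deg, by rw [h1]; exact h.adj, by rw [h2]; exact h.nbr⟩

/-! ### Degrees, adjacency and lists of neighbours -/

/-- The degree counted so far is also the first free position in the list of neighbours of the
source. -/
def buildBody : Stmt :=
  loadDart ;; put 1 (.var 1) (.var 2) 1 ;; put 2 (.var 1) (.get 0 0 (.var 1)) (.var 2) ;;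
  put 0 0 (.var 1) (.get 0 0 (.var 1) + 1) ;; assign 0 (.var 0 + 1)

def build : Stmt := assign 0 0 ;; rep (.var 12) buildBody

theorem build_wp {d : Darts} {off M : ℕ} {σ : State} (he : Encodes d off M σ.low)
    (hL : σ.var 12 = d.L) (ht : σ.tab = fun _ _ _ => 0) :
    build.wp off M (fun τ => Tables d τ ∧
      τ.time ≤ σ.time + 1000 * (d.L + 1)) σ := by
  have hM := he.L_le
  simp only [build, wp_seq_iff, wp_assign, safe_ofNat, eval_ofNat, Nat.zero_le, true_and]
  refine wp_rep_flat (fun k τ => τ.var 0 = k ∧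
    (∀ x, τ.tab 0 0 x = Nat.count (fun i => d.s i = x) k) ∧
    (∀ x y, τ.tab 1 x y = if ∃ i < k, d.s i = x ∧ d.t i = y then 1 else 0) ∧
    (∀ i < k, τ.tab 2 (d.s i) (Nat.count (fun i' => d.s i' = d.s i) i) = d.t i)) rfl (by simp)
    (fun _ _ _ h => h) (by simp [ht]) ?_ ?_
  · rintro k τ hk ⟨h0, hd, ha, hn⟩ hf
    replace hk : k < d.L := by simpa [hL] using hk
    have hcount : Nat.count (fun i => d.s i = d.s k) k ≤ k := Nat.count_le _
    rw [buildBody, wp_seq_iff]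
    refine loadDart_wp (by rw [hf.low rfl]; exact he) hk h0 ?_
    have := he.dst_le k hk
    simp [h0, hd]
    refine ⟨by omega, by omega, by omega, by omega, fun x => ?_, fun x y => ?_, fun i hi => ?_⟩
    · rw [Nat.count_succ]
      simp only [eq_comm (a := x)]
      split_ifs with h
      · rw [h]
      · rfl
    · rw [ha]
      simp only [Nat.le_iff_lt_or_eq, or_and_right, exists_or, exists_eq_left]
      by_cases h : x = d.s k ∧ y = d.t k
      · simp [h]
      · rw [if_neg h]
        refine if_congr ⟨Or.inl, fun h' => h'.resolve_right fun h'' => h ⟨h''.1.symm, h''.2.symm⟩⟩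
          rfl rfl
    · rcases Nat.le_iff_lt_or_eq.1 hi with hi | rfl
      · rw [if_neg]
        · exact hn i hi
        · rintro ⟨h1, h2⟩
          -- Earlier darts with the same source have strictly smaller positions, so the new entry
          -- overwrites none of theirs.
          have := Nat.count_strict_mono (p := fun i' => d.s i' = d.s i) rfl hi
          rw [h1] at h2 this
          omega
      · simp
  · rintro τ ⟨-, hd, ha, hn⟩ - hti
    simp only [eval_var, State.setVar_var, hL, State.setVar_time, cost_var, cost_ofNat,
      if_neg (show (12 : ℕ) ≠ 0 by decide)] at hd ha hn hti
    refine ⟨⟨hd, fun x y => (ha x y).trans (if_congr Iff.rfl rfl rfl), hn⟩, ?_⟩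
    have h1 : buildBody.cost ≤ 900 := by decide
    have h2 := Nat.mul_le_mul_left d.L (Nat.add_le_add_right h1 5)
    omega

/-! ### Vertices of low degree -/

/-- The vertices whose degree is above the old and not above the new threshold. -/
def _root_.Darts.Mid (d : Darts) (Dp D x : ℕ) : Prop := Dp < d.deg x ∧ d.deg x ≤ D

/-- For a dart from x to y, one pass over the neighbours z of x serves two purposes: table `3`
records x as a common neighbour of y and z, and variable `4` counts the z adjacent to y. -/
def lowInner : Stmt :=
  assign 13 (.get 2 (.var 1) (.var 3)) ;;
  put 3 (.var 2) (.var 13) (.get 3 (.var 2) (.var 13) + 1) ;;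
  assign 4 (.var 4 + .get 1 (.var 2) (.var 13)) ;; assign 3 (.var 3 + 1)

/-- The product of truncated differences is nonzero exactly for the degrees that have become low in
this stage. Each vertex of low degree is thus processed once over all stages, and the counts in
table `3` carry over. -/
def lowBody : Stmt :=
  loadDart ;;
  branch ((.get 0 0 (.var 1) - .var 6) * (.var 5 + 1 - .get 0 0 (.var 1)))
    (assign 4 0 ;; assign 3 0 ;; rep (.get 0 0 (.var 1)) lowInner ;;
      branch ((.var 4 + 1 - .get 0 0 (.var 1)) + (.get 0 0 (.var 1) - (.var 4 + 1))) skip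
        (assign 9 1))
    skip ;;
  assign 0 (.var 0 + 1)

/-- The flag is described relative to an arbitrary proposition `F`, which the loop instantiates with
the containments found so far. -/
theorem lowBody_wp {d : Darts} {off M i Dp D : ℕ} {σ : State} (he : Encodes d off M σ.low)
    (hi : i < d.L) (h0 : σ.var 0 = i) (h5 : σ.var 5 = D) (h6 : σ.var 6 = Dp) (ht : Tables d σ)
    (h3 : ∀ y z, σ.tab 3 y z ≤ d.L) :
    lowBody.wp off M (fun τ => τ.var 0 = i + 1 ∧
      (∀ y z, τ.tab 3 y z = σ.tab 3 y z +
        if d.Mid Dp D (d.s i) ∧ d.t i = y ∧ d.Adj (d.s i) z then 1 else 0) ∧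
      (∀ (F : Prop) [Decidable F], σ.var 9 = (if F then 1 else 0) → τ.var 9 =
        if F ∨ (d.Mid Dp D (d.s i) ∧ d.Good (d.s i) (d.t i)) then 1 else 0) ∧
      τ.time ≤ σ.time + 1000 * (D + 1)) σ := by
  have hM := he.L_le
  rw [lowBody, wp_seq_iff]
  refine loadDart_wp he hi h0 ?_
  simp only [wp_seq_iff, wp_branch]
  simp only [safe_mul, safe_sub, safe_get, safe_ofNat, safe_var, safe_add, eval_mul, eval_sub,
    eval_add, eval_get, eval_ofNat, eval_var, State.setVar_var, State.setVar_tab, ht.deg, h5, h6]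
  refine ⟨by simp, fun hc => ?_, fun hc => ?_⟩
  · have hmid : d.Mid Dp D (d.s i) := by
      have h1 := left_ne_zero_of_mul hc
      have h2 := right_ne_zero_of_mul hc
      simp at h1 h2
      constructor <;> omega
    generalize hσ1 : State.tick _ _ = σ1
    simp only [wp_seq_iff, wp_assign, safe_ofNat, eval_ofNat, Nat.zero_le, true_and]
    have e0 : σ1.var 0 = i := by rw [← hσ1]; simpa using h0
    have e1 : σ1.var 1 = d.s i := by rw [← hσ1]; simp
    have e2 : σ1.var 2 = d.t i := by rw [← hσ1]; simp
    have e9 : σ1.var 9 = σ.var 9 := by rw [← hσ1]; simp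
    have et : σ1.tab = σ.tab := by rw [← hσ1]; simp
    have eti : σ1.time ≤ σ.time + 300 := by rw [← hσ1]; simp
    refine wp_rep_flat (fun k τ => τ.var 3 = k ∧
      (∀ y z, τ.tab 3 y z = σ.tab 3 y z +
        if y = d.t i then Nat.count (fun k' => σ.tab 2 (d.s i) k' = z) k else 0) ∧
      τ.var 4 = Nat.count (fun k' => d.Adj (d.t i) (σ.tab 2 (d.s i) k')) k) rfl (by simp)
      (fun _ _ _ h => h) (by simp [et]) ?_ ?_
    · rintro k τ hk ⟨g3, gt, g4⟩ hf
      have f1 : τ.var 1 = d.s i := by rw [hf.var 1 rfl]; simpa using e1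
      have f2 : τ.var 2 = d.t i := by rw [hf.var 2 rfl]; simpa using e2
      have ft1 : τ.tab 1 = σ.tab 1 := by rw [hf.tab 1 rfl]; simp [et]
      have ft2 : τ.tab 2 = σ.tab 2 := by rw [hf.tab 2 rfl]; simp [et]
      replace hk : k < d.deg (d.s i) := by simpa [et, e1, ht.deg] using hk
      have hkL := hk.trans_le (d.deg_le _)
      have hz : σ.tab 2 (d.s i) k ≤ M := by
        obtain ⟨i', hi', -, h⟩ := d.adj_list ht.nbr hk
        rw [← h]; exact he.dst_le i' hi'
      have c1 : Nat.count (fun k' => σ.tab 2 (d.s i) k' = σ.tab 2 (d.s i) k) k ≤ k :=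
        Nat.count_le _
      have c2 : Nat.count (fun k' => d.Adj (d.t i) (σ.tab 2 (d.s i) k')) k ≤ k := Nat.count_le _
      have c3 := h3 (d.t i) (σ.tab 2 (d.s i) k)
      simp [lowInner, f1, f2, ft1, ft2, g3, g4, gt, ht.adj, hz]
      refine ⟨by omega, by split_ifs <;> omega, by omega, fun y z => ?_, ?_⟩
      · rw [Nat.count_succ]
        by_cases hy : y = d.t i
        · simp only [hy, true_and, if_true, eq_comm (a := z)]
          split_ifs with h
          · rw [h]; ring
          · ring
        · simp [hy]
      · rw [Nat.count_succ]
    · rintro τ ⟨-, gt, g4⟩ hf hti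
      have hdeg : (Exp.get 0 0 (.var 1)).eval
          ((σ1.setVar 4 0 (Exp.cost 0 + 2)).setVar 3 0 (Exp.cost 0 + 2)) = d.deg (d.s i) := by
        simp [et, e1, ht.deg]
      have f0 : τ.var 0 = i := by rw [hf.var 0 rfl]; simpa using e0
      have f1 : τ.var 1 = d.s i := by rw [hf.var 1 rfl]; simpa using e1
      have f9 : τ.var 9 = σ.var 9 := by rw [hf.var 9 rfl]; simpa using e9
      have ft0 : τ.tab 0 = σ.tab 0 := by rw [hf.tab 0 rfl]; simp [et]
      rw [hdeg] at gt g4 hti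
      replace gt : ∀ y z, τ.tab 3 y z = σ.tab 3 y z +
          if d.Mid Dp D (d.s i) ∧ d.t i = y ∧ d.Adj (d.s i) z then 1 else 0 := by
        intro y z
        rw [gt, d.count_list (f := σ.tab 2) (d.s i) (· = z) ht.nbr, d.filter_eq]
        by_cases hy : y = d.t i
        · simp [hy, hmid]
        · simp [hy, eq_comm (a := d.t i)]
      rw [d.count_list (f := σ.tab 2) (d.s i) (d.Adj (d.t i)) ht.nbr, d.filter_adj] at g4
      -- The inner loop runs `d.deg (d.s i)` times, and this is at most `D` for the vertices that
      -- pass the test.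
      have htime : τ.time + 200 ≤ σ.time + 1000 * (D + 1) := by
        have h1 : lowInner.cost ≤ 900 := by decide
        have h2 := Nat.mul_le_mul hmid.2 (Nat.add_le_add_right h1 5)
        simp only [State.setVar_time, cost_get, cost_ofNat, cost_var] at hti
        omega
      simp only [wp_branch, wp_skip, wp_assign]
      simp only [safe_sub, safe_get, safe_ofNat, safe_var, safe_add, eval_sub, eval_add,
        eval_get, eval_ofNat, eval_var, State.tick_var, State.tick_tab, State.setVar_var,
        State.setVar_tab, State.tick_time, State.setVar_time, cost_add, cost_sub, cost_get,
        cost_var, cost_ofNat, f0, f1, f9, ft0, g4, ht.deg, true_and, Nat.reduceEqDiff, if_true,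
        if_false]
      refine ⟨fun hne => ⟨by omega, gt, fun F _ hF => ?_, by omega⟩,
        fun heq => ⟨by omega, by omega, gt, fun F _ hF => ?_, by omega⟩⟩
      · have hg : ¬ d.Good (d.s i) (d.t i) := by unfold Darts.Good; omega
        simpa [hg] using hF
      · have hg : d.Good (d.s i) (d.t i) := by unfold Darts.Good; omega
        simp [hg, hmid]
  · have hmid : ¬ d.Mid Dp D (d.s i) := by
      simp at hc
      unfold Darts.Mid
      omega
    simp [h0, hmid]
    omega

def low : Stmt := assign 0 0 ;; rep (.var 12) lowBody

/-- The number of common neighbours of degree at most `D`. -/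
noncomputable def _root_.Darts.lowCount (d : Darts) (D y z : ℕ) : ℕ :=
  ((d.nb y ∩ d.nb z).filter fun x => d.deg x ≤ D).card

theorem _root_.Darts.lowCount_le (d : Darts) (D y z : ℕ) : d.lowCount D y z ≤ d.L :=
  (Finset.card_filter_le _ _).trans (d.card_inter_le y z)

/-- A counted dart into `y` is a common neighbour of `y` and `z` whose degree is above the old
threshold but not above the new one; together with the older ones these partition the common
neighbours of degree at most `D`. -/
theorem _root_.Darts.lowCount_add_count (d : Darts) {Dp D : ℕ} (hD : Dp ≤ D) (y z : ℕ) :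
    d.lowCount Dp y z + Nat.count (fun i => d.Mid Dp D (d.s i) ∧ d.t i = y ∧ d.Adj (d.s i) z) d.L =
      d.lowCount D y z := by
  have h : Nat.count (fun i => d.Mid Dp D (d.s i) ∧ d.t i = y ∧ d.Adj (d.s i) z) d.L =
      ((d.nb y).filter fun x => d.Mid Dp D x ∧ d.Adj x z).card := by
    rw [← d.count_in y fun x => d.Mid Dp D x ∧ d.Adj x z]
    simp only [and_left_comm]
  rw [h, Darts.lowCount, Darts.lowCount, ← Finset.card_union_of_disjoint]
  · congr 1
    ext x
    simp only [Finset.mem_union, Finset.mem_filter, Finset.mem_inter, Darts.mem_nb]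
    simp only [Darts.Mid]
    constructor
    · rintro (h | h)
      · exact ⟨h.1, by omega⟩
      · exact ⟨⟨h.1, h.2.2.symm⟩, h.2.1.2⟩
    · rintro ⟨h1, h2⟩
      by_cases h3 : d.deg x ≤ Dp
      · exact Or.inl ⟨h1, h3⟩
      · exact Or.inr ⟨h1.1, ⟨by omega, h2⟩, h1.2.symm⟩
  · rw [Finset.disjoint_left]
    intro x hx hx'
    have h1 := (Finset.mem_filter.1 hx).2
    have h2 := (Finset.mem_filter.1 hx').2.1.1
    omega

theorem low_wp {d : Darts} {off M Dp D : ℕ} {σ : State} (he : Encodes d off M σ.low)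
    (hL : σ.var 12 = d.L) (h5 : σ.var 5 = D) (h6 : σ.var 6 = Dp) (hD : Dp ≤ D) (ht : Tables d σ)
    (h3 : ∀ y z, σ.tab 3 y z = d.lowCount Dp y z)
    (h9 : σ.var 9 = if ∃ i < d.L, d.deg (d.s i) ≤ Dp ∧ d.Good (d.s i) (d.t i) then 1 else 0) :
    low.wp off M (fun τ => (∀ y z, τ.tab 3 y z = d.lowCount D y z) ∧
      τ.var 9 = (if ∃ i < d.L, d.deg (d.s i) ≤ D ∧ d.Good (d.s i) (d.t i) then 1 else 0) ∧
      τ.time ≤ σ.time + 2000 * ((d.L + 1) * (D + 1))) σ := by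
  simp only [low, wp_seq_iff, wp_assign, safe_ofNat, eval_ofNat, Nat.zero_le, true_and]
  refine wp_rep (fun k τ => τ.var 0 = k ∧
    (∀ y z, τ.tab 3 y z = σ.tab 3 y z +
      Nat.count (fun i => d.Mid Dp D (d.s i) ∧ d.t i = y ∧ d.Adj (d.s i) z) k) ∧
    τ.var 9 = if (∃ i < d.L, d.deg (d.s i) ≤ Dp ∧ d.Good (d.s i) (d.t i)) ∨
      ∃ i < k, d.Mid Dp D (d.s i) ∧ d.Good (d.s i) (d.t i) then 1 else 0) (1000 * (D + 1))
    (by simp) (fun _ _ _ h => h) (by simp [h9]) ?_ ?_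
  · rintro k τ hk ⟨g0, g3, g9⟩ hf
    replace hk : k < d.L := by simpa [hL] using hk
    refine wp_mono ?_ (lowBody_wp (D := D) (Dp := Dp) (by rw [hf.low rfl]; exact he) hk g0
      (by rw [hf.var 5 rfl]; simpa using h5) (by rw [hf.var 6 rfl]; simpa using h6)
      (ht.congr (hf.tab 0 rfl) (hf.tab 1 rfl) (hf.tab 2 rfl)) fun y z => ?_)
    · rintro τ' ⟨f0, f3, f9, fti⟩
      refine ⟨⟨f0, fun y z => ?_, ?_⟩, fti⟩
      · rw [f3, g3, Nat.count_succ, add_assoc]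
      · rw [f9 _ g9]
        refine if_congr ?_ rfl rfl
        simp only [Nat.lt_succ_iff_lt_or_eq, or_and_right, exists_or, exists_eq_left, or_assoc]
    · rw [g3, h3]
      refine le_trans (Nat.add_le_add_left (Nat.count_monotone _ hk.le) _) ?_
      rw [d.lowCount_add_count hD]
      exact d.lowCount_le _ _ _
  · rintro τ ⟨-, g3, g9⟩ - hti
    have hL' : (Exp.var 12).eval (σ.setVar 0 0 (Exp.cost 0 + 2)) = d.L := by simpa using hL
    rw [hL'] at g3 g9 hti
    refine ⟨fun y z => by rw [g3, h3, d.lowCount_add_count hD], ?_, ?_⟩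
    · rw [g9]
      refine if_congr ?_ rfl rfl
      simp only [Darts.Mid]
      constructor
      · rintro (⟨i, hi, h1, h2⟩ | ⟨i, hi, h1, h2⟩)
        · exact ⟨i, hi, by omega, h2⟩
        · exact ⟨i, hi, h1.2, h2⟩
      · rintro ⟨i, hi, h1, h2⟩
        by_cases h3 : d.deg (d.s i) ≤ Dp
        · exact Or.inl ⟨i, hi, h3, h2⟩
        · exact Or.inr ⟨i, hi, ⟨by omega, h1⟩, h2⟩
    · simp only [State.setVar_time, cost_ofNat, cost_var] at hti
      nlinarith

end RAM
namespace RAM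

open Exp Stmt Classical

/-! ### Numbering the vertices of high degree and preparing the multiplication -/

/-- A number is assigned when the degree exceeds the threshold and the entry is still `0`; hence
numbers start at `1`. -/
def numberBody : Stmt :=
  assign 1 (.low (.var 0 + 2)) ;;
  branch ((.get 0 0 (.var 1) - .var 5) * (1 - .get 4 (.var 11) (.var 1)))
    (assign 7 (.var 7 + 1) ;; put 4 (.var 11) (.var 1) (.var 7)) skip ;;
  assign 0 (.var 0 + 1)

def number : Stmt := assign 7 0 ;; assign 0 0 ;; rep (.var 12) numberBody

theorem number_wp {d : Darts} {off M D j : ℕ} {σ : State} (he : Encodes d off M σ.low)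
    (hL : σ.var 12 = d.L) (h5 : σ.var 5 = D) (hj : σ.var 11 = j) (ht : Tables d σ)
    (h4 : ∀ x, σ.tab 4 j x = 0) :
    number.wp off M (fun τ => d.Numbering D (τ.var 7) (τ.tab 4 j) ∧
      (∀ b, b ≠ j → τ.tab 4 b = σ.tab 4 b) ∧ τ.time ≤ σ.time + 1000 * (d.L + 1)) σ := by
  have hM := he.L_le
  simp only [number, wp_seq_iff, wp_assign, safe_ofNat, eval_ofNat, Nat.zero_le, true_and]
  refine wp_rep_flat (fun k τ => τ.var 0 = k ∧ τ.var 7 ≤ k ∧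
    (∀ b, b ≠ j → τ.tab 4 b = σ.tab 4 b) ∧
    (∀ x, τ.tab 4 j x ≠ 0 ↔ D < d.deg x ∧ ∃ i < k, d.s i = x) ∧ (∀ x, τ.tab 4 j x ≤ τ.var 7) ∧
    (∀ p, 1 ≤ p → p ≤ τ.var 7 → ∃ x, τ.tab 4 j x = p) ∧
    (∀ x y, τ.tab 4 j x = τ.tab 4 j y → τ.tab 4 j x ≠ 0 → x = y)) rfl (by simp)
    (fun _ _ _ h => h) ?_ ?_ ?_
  · simp [h4]
    intro p h1 h2
    omega
  · rintro k τ hk ⟨g0, g7, gb, g1, g2, g3, g4⟩ hf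
    replace hk : k < d.L := by simpa [hL] using hk
    have f5 : τ.var 5 = D := by rw [hf.var 5 rfl]; simpa using h5
    have f11 : τ.var 11 = j := by rw [hf.var 11 rfl]; simpa using hj
    have flow : τ.low (k + 2) = d.s k := by rw [hf.low rfl]; exact he.src k hk
    have f0 : ∀ x, τ.tab 0 0 x = d.deg x := by rw [hf.tab 0 rfl]; exact ht.deg
    have hoff := he.off_le
    have hs := he.src_le k hk
    simp only [numberBody, wp_seq_iff, wp_assign, wp_branch, wp_put, wp_skip]
    simp only [safe_mul, safe_sub, safe_get, safe_ofNat, safe_var, safe_add, safe_low, eval_mul,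
      eval_sub, eval_add, eval_get, eval_ofNat, eval_var, eval_low, State.tick_var, State.tick_tab,
      State.setVar_var, State.setVar_tab, State.setTab_var, g0, f5, f11, flow, f0, true_and,
      Nat.reduceEqDiff, OfNat.ofNat_ne_zero, OfNat.ofNat_ne_one, if_true,
      if_false, OfNat.zero_ne_ofNat, OfNat.one_ne_ofNat, zero_ne_one]
    have hex : ∀ x, (∃ i < k + 1, d.s i = x) ↔ (∃ i < k, d.s i = x) ∨ d.s k = x := by
      intro x
      simp only [Nat.lt_succ_iff_lt_or_eq, or_and_right, exists_or, exists_eq_left]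
    refine ⟨by omega, hs, fun hc => ?_, fun hc => ?_⟩
    · have hD : D < d.deg (d.s k) := by have := left_ne_zero_of_mul hc; omega
      have h0 : τ.tab 4 j (d.s k) = 0 := by have := right_ne_zero_of_mul hc; omega
      have htab : ∀ x, (((((τ.setVar 1 (d.s k) ((Exp.var 0 + 2).low.cost + 2)).tick
          (((Exp.get 0 0 (.var 1) - .var 5) * (1 - .get 4 (.var 11) (.var 1))).cost + 1)).setVar 7
          (τ.var 7 + 1) ((Exp.var 7 + 1).cost + 2)).setTab 4 j (d.s k) (τ.var 7 + 1)
          (2 * (Exp.var 11).cost + 3 * (Exp.var 1).cost + (Exp.var 7).cost + 16)).tab 4 j x) =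
          if x = d.s k then τ.var 7 + 1 else τ.tab 4 j x := by
        intro x; simp
      refine ⟨by omega, by omega, by omega, by omega, fun b hb => ?_, fun x => ?_, fun x => ?_,
        fun p hp1 hp2 => ?_, fun x y => ?_⟩
      · rw [← gb b hb]; funext x; simp [hb]
      · rw [htab, hex]
        split_ifs with h
        · subst h; simp [hD]
        · rw [g1]; simp [eq_comm (a := d.s k), h]
      · rw [htab]
        have := g2 x
        split_ifs <;> omega
      · by_cases h : p = τ.var 7 + 1
        · exact ⟨d.s k, by rw [htab, if_pos rfl, h]⟩
        · obtain ⟨x, hx⟩ := g3 p hp1 (by omega)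
          refine ⟨x, ?_⟩
          rw [htab, if_neg, hx]
          rintro rfl
          omega
      · rw [htab, htab]
        have h1 := g2 x
        have h2 := g2 y
        split_ifs with h h' h'
        · intros; rw [h, h']
        · intros; omega
        · intros; omega
        · exact g4 x y
    · refine ⟨by omega, by omega, gb, fun x => ?_, g2, g3, g4⟩
      rw [g1, hex]
      constructor
      · rintro ⟨h1, h2⟩; exact ⟨h1, Or.inl h2⟩
      · rintro ⟨h1, h2 | rfl⟩
        · exact ⟨h1, h2⟩
        · refine (g1 _).1 fun h0 => ?_
          rw [h0, Nat.mul_eq_zero] at hc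
          omega
  · rintro τ ⟨-, -, gb, g1, g2, g3, g4⟩ - hti
    have hL' : (Exp.var 12).eval ((σ.setVar 7 0 (Exp.cost 0 + 2)).setVar 0 0 (Exp.cost 0 + 2)) =
      d.L := by simpa using hL
    rw [hL'] at g1 hti
    refine ⟨⟨fun x => ?_, g2, g3, g4⟩, gb, ?_⟩
    · rw [g1]
      -- A vertex of degree above `D` has positive degree, so the pass over the sources of darts
      -- meets it.
      exact ⟨And.left, fun h => ⟨h, d.exists_of_deg_pos (by omega)⟩⟩
    · have h1 : numberBody.cost ≤ 900 := by decide
      have h2 := Nat.mul_le_mul_left d.L (Nat.add_le_add_right h1 5)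
      simp only [State.setVar_time, cost_ofNat, cost_var] at hti
      omega

/-- Both factors are the same matrix, so a dart sets two cells. The zeros are already there because
the tables of this stage are unused, and preparing the input takes time linear in the number of
darts rather than in the number of matrix entries. -/
def fillBody : Stmt :=
  loadDart ;;
  branch (.get 4 (.var 11) (.var 1) * .get 4 (.var 11) (.var 2))
    (put 5 (.var 11) (1 + (.get 4 (.var 11) (.var 1) - 1) * .var 7 +
        (.get 4 (.var 11) (.var 2) - 1)) 1 ;;
      put 5 (.var 11) (1 + .var 7 * .var 7 + (.get 4 (.var 11) (.var 1) - 1) * .var 7 +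
        (.get 4 (.var 11) (.var 2) - 1)) 1)
    skip ;;
  assign 0 (.var 0 + 1)

def fill : Stmt :=
  assign 0 0 ;; rep (.var 12) fillBody ;; put 5 (.var 11) 0 (.var 7) ;; assign 8 0

theorem fill_wp {d : Darts} {off M D N j : ℕ} {σ : State} (he : Encodes d off M σ.low)
    (hL : σ.var 12 = d.L) (hj : σ.var 11 = j) (h7 : σ.var 7 = N) (hN : N ≤ M)
    (hnum : d.Numbering D N (σ.tab 4 j))
    (hfresh : ∀ b, j ≤ b → ∀ a, σ.tab 5 b a = 0 ∧ σ.tab 6 b a = 0) :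
    fill.wp off M (fun τ => Simulates j τ (init (d.highInstance N (σ.tab 4 j)).input) ∧
      τ.time ≤ σ.time + 2000 * (d.L + 1)) σ := by
  have hM := he.L_le
  simp only [fill, wp_seq_iff, wp_assign, safe_ofNat, eval_ofNat, Nat.zero_le, true_and]
  refine wp_rep_flat (fun k τ => τ.var 0 = k ∧ (∀ b, b ≠ j → τ.tab 5 b = σ.tab 5 b) ∧
    (∀ a, τ.tab 5 j a = if ∃ i < k, σ.tab 4 j (d.s i) * σ.tab 4 j (d.t i) ≠ 0 ∧
      (a = 1 + (σ.tab 4 j (d.s i) - 1) * N + (σ.tab 4 j (d.t i) - 1) ∨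
      a = 1 + N * N + (σ.tab 4 j (d.s i) - 1) * N + (σ.tab 4 j (d.t i) - 1)) then 1 else 0)) rfl
    (by simp) (fun _ _ _ h => h) (by simp [fun a => (hfresh j le_rfl a).1]) ?_ ?_
  · rintro k τ hk ⟨g0, gb, g5⟩ hf
    replace hk : k < d.L := by simpa [hL] using hk
    have f7 : τ.var 7 = N := by rw [hf.var 7 rfl]; simpa using h7
    have f11 : τ.var 11 = j := by rw [hf.var 11 rfl]; simpa using hj
    have f4 : τ.tab 4 = σ.tab 4 := hf.tab 4 rfl
    simp only [fillBody, wp_seq_iff (s := loadDart)]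
    refine loadDart_wp (by rw [hf.low rfl]; exact he) hk g0 ?_
    simp only [wp_seq_iff, wp_assign, wp_branch, wp_put, wp_skip]
    simp [g0, f7, f11, f4, -mul_eq_zero]
    refine ⟨fun hc => ⟨by omega, by omega, fun b hb => ?_, fun a => ?_⟩,
      fun hc => ⟨by omega, gb, fun a => ?_⟩⟩
    · rw [← gb b hb]; funext x; simp [hb]
    · rw [g5]
      simp only [ne_eq, Nat.le_iff_lt_or_eq, or_and_right, exists_or, exists_eq_left]
      by_cases h1 : a = 1 + (σ.tab 4 j (d.s k) - 1) * N + (σ.tab 4 j (d.t k) - 1) <;>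
        by_cases h2 : a = 1 + N * N + (σ.tab 4 j (d.s k) - 1) * N + (σ.tab 4 j (d.t k) - 1) <;>
        simp only [h1, h2, hc, if_true, if_false, not_false_eq_true, true_and, or_true, true_or,
          or_false, ite_self]
    · rw [g5]
      simp only [ne_eq, Nat.le_iff_lt_or_eq, or_and_right, exists_or, exists_eq_left]
      refine if_congr ?_ rfl rfl
      rw [hc]
      simp only [not_true_eq_false, false_and, or_false]
  · rintro τ ⟨-, gb, g5⟩ hf hti
    have hL' : (Exp.var 12).eval (σ.setVar 0 0 (Exp.cost 0 + 2)) = d.L := by simpa using hL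
    rw [hL'] at g5 hti
    have f7 : τ.var 7 = N := by rw [hf.var 7 rfl]; simpa using h7
    have f11 : τ.var 11 = j := by rw [hf.var 11 rfl]; simpa using hj
    have f6 : τ.tab 6 = σ.tab 6 := hf.tab 6 rfl
    simp only [wp_seq_iff, wp_put, wp_assign, safe_ofNat, safe_var, eval_ofNat, eval_var, f7, f11,
      true_and]
    refine ⟨hN, Nat.zero_le _, ⟨rfl, fun r => ?_, fun a => ?_, fun b hb a => ?_⟩, ?_⟩
    · simp [f6, (hfresh j le_rfl r).2, init]
    · by_cases ha : a = 0
      · subst ha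
        simp only [State.setVar_tab, State.setTab_tab, and_self, if_true]
        rfl
      · have := hnum.input_getD ha
        simp only [init]
        rw [this]
        simp [ha, g5]
    · simp [hb.ne', gb b hb.ne', f6, hfresh b hb.le a]
    · have h1 : fillBody.cost ≤ 1900 := by decide
      have h2 := Nat.mul_le_mul_left d.L (Nat.add_le_add_right h1 5)
      simp only [State.setVar_time, State.setTab_time, cost_ofNat, cost_var] at hti ⊢
      omega

/-! ### Edges between vertices of high degree -/

/-- Common neighbours of low degree are read from table `3`, those of high degree from the product.
Only entries belonging to darts are inspected. -/
def checkBody : Stmt :=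
  loadDart ;;
  branch (.get 4 (.var 11) (.var 1) * .get 4 (.var 11) (.var 2))
    (assign 4 (.get 3 (.var 1) (.var 2) +
        .get 5 (.var 11) ((.get 4 (.var 11) (.var 1) - 1) * .var 7 +
          (.get 4 (.var 11) (.var 2) - 1)) + 1) ;;
      branch ((.var 4 - .get 0 0 (.var 1)) + (.get 0 0 (.var 1) - .var 4)) skip (assign 9 1))
    skip ;;
  assign 0 (.var 0 + 1)

def check : Stmt := assign 0 0 ;; rep (.var 12) checkBody ;; assign 10 1

theorem check_wp {d : Darts} {off M D N j : ℕ} {σ : State} (he : Encodes d off M σ.low)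
    (hL : σ.var 12 = d.L) (hj : σ.var 11 = j) (h7 : σ.var 7 = N) (ht : Tables d σ)
    (hnum : d.Numbering D N (σ.tab 4 j))
    (hcommon : ∀ x y, D < d.deg x → D < d.deg y → σ.tab 3 x y +
      σ.tab 5 j ((σ.tab 4 j x - 1) * N + (σ.tab 4 j y - 1)) = (d.nb x ∩ d.nb y).card)
    (F : Prop) [Decidable F] (h9 : σ.var 9 = if F then 1 else 0) :
    check.wp off M (fun τ => τ.var 10 = 1 ∧ τ.var 9 = (if F ∨ ∃ i < d.L, D < d.deg (d.s i) ∧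
        D < d.deg (d.t i) ∧ d.Good (d.s i) (d.t i) then 1 else 0) ∧
      τ.time ≤ σ.time + 2000 * (d.L + 1)) σ := by
  have hM := he.L_le
  simp only [check, wp_seq_iff, wp_assign, safe_ofNat, eval_ofNat, Nat.zero_le, true_and]
  refine wp_rep_flat (fun k τ => τ.var 0 = k ∧ τ.var 9 = (if F ∨ ∃ i < k, D < d.deg (d.s i) ∧
    D < d.deg (d.t i) ∧ d.Good (d.s i) (d.t i) then 1 else 0)) rfl
    (by simp) (fun _ _ _ h => h) (by simp [h9]) ?_ ?_
  · rintro k τ hk ⟨g0, g9⟩ hf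
    replace hk : k < d.L := by simpa [hL] using hk
    have f7 : τ.var 7 = N := by rw [hf.var 7 rfl]; simpa using h7
    have f11 : τ.var 11 = j := by rw [hf.var 11 rfl]; simpa using hj
    have f0 : ∀ x, τ.tab 0 0 x = d.deg x := by rw [hf.tab 0 rfl]; exact ht.deg
    have f3 : τ.tab 3 = σ.tab 3 := hf.tab 3 rfl
    have f4 : τ.tab 4 = σ.tab 4 := hf.tab 4 rfl
    have f5 : τ.tab 5 = σ.tab 5 := hf.tab 5 rfl
    simp only [checkBody, wp_seq_iff (s := loadDart)]
    refine loadDart_wp (by rw [hf.low rfl]; exact he) hk g0 ?_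
    simp only [wp_seq_iff, wp_assign, wp_branch, wp_skip]
    have hex : (F ∨ ∃ i < k + 1, D < d.deg (d.s i) ∧ D < d.deg (d.t i) ∧ d.Good (d.s i) (d.t i)) ↔
        (F ∨ ∃ i < k, D < d.deg (d.s i) ∧ D < d.deg (d.t i) ∧ d.Good (d.s i) (d.t i)) ∨
        (D < d.deg (d.s k) ∧ D < d.deg (d.t k) ∧ d.Good (d.s k) (d.t k)) := by
      simp only [Nat.lt_succ_iff_lt_or_eq, or_and_right, exists_or, exists_eq_left, or_assoc]
    have hnx := hnum.ne_zero (d.s k)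
    have hny := hnum.ne_zero (d.t k)
    by_cases hc : σ.tab 4 j (d.s k) * σ.tab 4 j (d.t k) = 0
    · have hnot : ¬ (D < d.deg (d.s k) ∧ D < d.deg (d.t k) ∧ d.Good (d.s k) (d.t k)) := by
        rintro ⟨h1, h2, -⟩
        rw [Nat.mul_eq_zero] at hc
        omega
      have hval := g9
      rw [← if_congr (hex.trans (or_iff_left hnot)) rfl rfl] at hval
      simp [g0, f11, f4, hc, -mul_eq_zero]
      exact ⟨by omega, by simpa only [Nat.lt_succ_iff] using hval⟩
    · have hDx : D < d.deg (d.s k) := by have := left_ne_zero_of_mul hc; omega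
      have hDy : D < d.deg (d.t k) := by have := right_ne_zero_of_mul hc; omega
      have hcom := hcommon _ _ hDx hDy
      have hle := d.card_inter_le (d.s k) (d.t k)
      have hgood : d.Good (d.s k) (d.t k) ↔
        (d.nb (d.s k) ∩ d.nb (d.t k)).card + 1 = d.deg (d.s k) := Iff.rfl
      simp only [hDx, hDy, true_and] at hex
      rw [if_congr hex rfl rfl]
      simp [g0, f7, f11, f4, f3, f5, f0, hc, hcom, -mul_eq_zero]
      refine ⟨by omega, fun h => ⟨by omega, ?_⟩,
        fun h1 h2 => ⟨by omega, by omega, fun _ _ => hgood.2 (by omega)⟩⟩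
      rw [g9]
      refine (if_congr (or_iff_left fun hg => ?_) rfl rfl).symm
      have := hgood.1 hg
      omega
  · rintro τ ⟨-, g9⟩ - hti
    simp only [wp_assign, safe_ofNat, eval_ofNat, true_and]
    have hL' : (Exp.var 12).eval (σ.setVar 0 0 (Exp.cost 0 + 2)) = d.L := by simpa using hL
    rw [hL'] at g9 hti
    have h1 : checkBody.cost ≤ 1900 := by decide
    have h2 := Nat.mul_le_mul_left d.L (Nat.add_le_add_right h1 5)
    simp only [State.setVar_time, cost_ofNat, cost_var] at hti ⊢
    refine ⟨by omega, by simp, by simpa using g9, by omega⟩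

end RAM
namespace RAM

open Exp Stmt Classical

/-! ### One stage of the algorithm -/

/-- Double the degree threshold. -/
def advance : Stmt := assign 6 (.var 5) ;; assign 5 (2 * .var 5) ;; assign 11 (.var 11 + 1)

theorem advance_wp {off M D j : ℕ} {σ : State} {Q : State → Prop} (h5 : σ.var 5 = D)
    (h11 : σ.var 11 = j) (hDM : 2 * D ≤ M) (hj : j + 1 ≤ M)
    (hQ : Q (((σ.setVar 6 D 4).setVar 5 (2 * D) 6).setVar 11 (j + 1) 6)) :
    advance.wp off M Q σ := by
  simp only [advance, wp_seq_iff, wp_assign, safe_var, safe_mul, safe_add, safe_ofNat, eval_var,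
    eval_mul, eval_add, eval_ofNat, State.setVar_var, Nat.reduceEqDiff, if_false, h5, h11, true_and]
  exact ⟨by omega, hDM, hj, hQ⟩

/-- Process the vertices of degree at most `var 5` directly, and the others with the program `P` for
matrix multiplication, which is stopped after `var 12 * var 5` steps. -/
def stage (P : Program) : Stmt :=
  low ;; number ;; fill ;; rep (.var 12 * .var 5) (simStep P 0) ;;
  branch (.const P.length - .var 8) skip check ;;
  advance

/-- The situation before stage `j`, if no multiplication has been successful. -/
structure StageInv (d : Darts) (j Dp D : ℕ) (σ : State) : Prop where
  var_L : σ.var 12 = d.L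
  var_stage : σ.var 11 = j
  var_new : σ.var 5 = D
  var_old : σ.var 6 = Dp
  tables : Tables d σ
  count : ∀ y z, σ.tab 3 y z = d.lowCount Dp y z
  found : σ.var 9 = if ∃ i < d.L, d.deg (d.s i) ≤ Dp ∧ d.Good (d.s i) (d.t i) then 1 else 0
  fresh : ∀ b, j ≤ b → ∀ a, σ.tab 4 b a = 0 ∧ σ.tab 5 b a = 0 ∧ σ.tab 6 b a = 0

/-- `P` multiplies zero-one matrices in time `C * n ^ ω`. -/
def MultipliesWithin (P : Program) (k : ℕ) (C ω : ℝ) : Prop :=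
  ∀ x : MatMulInstance 0, ComputesWithin P x.input (matrixEntries (x.A * x.B))
    (C * (max (x.n : ℝ) 1) ^ ω) ((x.n + 2) ^ k)

/-- An unsuccessful stage delivers a certificate: a dimension `N` with `N * D ≤ d.L` whose
guaranteed multiplication time exceeds the budget `d.L * D`. For large thresholds the caller refutes
it, so nothing about `C` or `ω` enters the program itself. -/
theorem stage_wp {d : Darts} {off M Dp D j k : ℕ} {C ω : ℝ} {P : Program} {σ : State}
    (he : Encodes d off M σ.low) (hP : MultipliesWithin P k C ω) (hpc : P.PcBound M)
    (hk : (d.L + 2) ^ k ≤ M) (hD : Dp ≤ D) (hD1 : 1 ≤ D) (hDM : 2 * D ≤ M) (hj : j + 1 ≤ M)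
    (hσ : StageInv d j Dp D σ) :
    (stage P).wp off M (fun τ =>
      (τ.var 10 = 1 ∧ τ.var 9 = (if ∃ i < d.L, d.Good (d.s i) (d.t i) then 1 else 0) ∨
        τ.var 10 = σ.var 10 ∧ StageInv d (j + 1) D (2 * D) τ ∧
          ∃ N : ℕ, N * D ≤ d.L ∧ (d.L * D : ℝ) < C * (max (N : ℝ) 1) ^ ω) ∧
      τ.time ≤ σ.time + ((simStep P 0).cost + 10000) * ((d.L + 1) * (D + 1))) σ := by
  have hM := he.L_le
  unfold stage
  refine wp_seq (low_wp he hσ.var_L hσ.var_new hσ.var_old hD hσ.tables hσ.count hσ.found)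
    fun τ1 ⟨c1, g1, ti1⟩ f1 => ?_
  have t1 : Tables d τ1 := hσ.tables.congr (f1.tab 0 rfl) (f1.tab 1 rfl) (f1.tab 2 rfl)
  refine wp_seq (number_wp (D := D) (j := j) (by rw [f1.low rfl]; exact he)
    (by rw [f1.var 12 rfl]; exact hσ.var_L) (by rw [f1.var 5 rfl]; exact hσ.var_new)
    (by rw [f1.var 11 rfl]; exact hσ.var_stage) t1
    (by rw [f1.tab 4 rfl]; exact fun x => (hσ.fresh j le_rfl x).1))
    fun τ2 ⟨hnum, g2, ti2⟩ f2 => ?_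
  have hNL : τ2.var 7 ≤ d.L := (Nat.le_mul_of_pos_right _ hD1).trans hnum.mul_le
  have l2 : τ2.low = σ.low := by rw [f2.low rfl, f1.low rfl]
  refine wp_seq (fill_wp (D := D) (N := τ2.var 7) (j := j) (by rw [l2]; exact he)
    (by rw [f2.var 12 rfl, f1.var 12 rfl]; exact hσ.var_L)
    (by rw [f2.var 11 rfl, f1.var 11 rfl]; exact hσ.var_stage) rfl (by omega) hnum
    (by rw [f2.tab 5 rfl, f1.tab 5 rfl, f2.tab 6 rfl, f1.tab 6 rfl]
        exact fun b hb a => (hσ.fresh b hb a).2))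
    fun τ3 ⟨hsim, ti3⟩ f3 => ?_
  set N := τ2.var 7 with hN
  set x := d.highInstance N (τ2.tab 4 j) with hx
  have hxn : x.n = N := rfl
  have v12 : τ3.var 12 = d.L := by
    rw [f3.var 12 rfl, f2.var 12 rfl, f1.var 12 rfl]; exact hσ.var_L
  have v5 : τ3.var 5 = D := by
    rw [f3.var 5 rfl, f2.var 5 rfl, f1.var 5 rfl]; exact hσ.var_new
  have v11 : τ3.var 11 = j := by
    rw [f3.var 11 rfl, f2.var 11 rfl, f1.var 11 rfl]; exact hσ.var_stage
  have hB : (x.n + 2) ^ k ≤ M := (Nat.pow_le_pow_left (by omega) k).trans hk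
  refine rep_simStep_wp (by simp) hpc v11 hsim
    (fun t i => ⟨((hP x).bounded t i).1.trans hB, ((hP x).bounded t i).2.trans hB⟩)
    fun τ4 hsim4 f4 ti4 => ?_
  have hF : (Exp.var 12 * Exp.var 5).eval τ3 = d.L * D := by simp [v12, v5]
  rw [hF] at hsim4 ti4
  have mv : ∀ v, v ≠ 8 → τ4.var v = τ3.var v := fun v hv => f4.var v (simStep_modsVar P 0 hv)
  have mt : ∀ t, t ≠ 5 → t ≠ 6 → τ4.tab t = τ3.tab t :=
    fun t h5 h6 => f4.tab t (simStep_modsTab P 0 h5 h6)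
  have ml : τ4.low = σ.low := by
    rw [f4.low (simStep_modsLow P 0), f3.low rfl, l2]
  have t4 : Tables d τ4 := t1.congr
    (by rw [mt 0 (by decide) (by decide), f3.tab 0 rfl, f2.tab 0 rfl])
    (by rw [mt 1 (by decide) (by decide), f3.tab 1 rfl, f2.tab 1 rfl])
    (by rw [mt 2 (by decide) (by decide), f3.tab 2 rfl, f2.tab 2 rfl])
  have w12 : τ4.var 12 = d.L := by rw [mv 12 (by decide), v12]
  have w11 : τ4.var 11 = j := by rw [mv 11 (by decide), v11]
  have w5 : τ4.var 5 = D := by rw [mv 5 (by decide), v5]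
  have w7 : τ4.var 7 = N := by rw [mv 7 (by decide), f3.var 7 rfl]
  have w9 : τ4.var 9 =
      if ∃ i < d.L, d.deg (d.s i) ≤ D ∧ d.Good (d.s i) (d.t i) then 1 else 0 := by
    rw [mv 9 (by decide), f3.var 9 rfl, f2.var 9 rfl, g1]
  have w10 : τ4.var 10 = σ.var 10 := by
    rw [mv 10 (by decide), f3.var 10 rfl, f2.var 10 rfl, f1.var 10 rfl]
  have x3 : ∀ y z, τ4.tab 3 y z = d.lowCount D y z := by
    rw [mt 3 (by decide) (by decide), f3.tab 3 rfl, f2.tab 3 rfl]; exact c1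
  have x4 : τ4.tab 4 = τ2.tab 4 := by rw [mt 4 (by decide) (by decide), f3.tab 4 rfl]
  have hti : τ4.time + 2000 * (d.L + 1) + 100 ≤
      σ.time + ((simStep P 0).cost + 10000) * ((d.L + 1) * (D + 1)) := by
    simp only [cost_mul, cost_var] at ti4
    generalize (simStep P 0).cost = K at ti4 ⊢
    have e1 : d.L + 1 ≤ (d.L + 1) * (D + 1) := Nat.le_mul_of_pos_right _ (by omega)
    have e2 : d.L * D * (K + 5) ≤ (d.L + 1) * (D + 1) * (K + 5) := by gcongr <;> omega
    generalize (d.L + 1) * (D + 1) = Z at *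
    have e3 : (K + 10000) * Z = Z * (K + 5) + 9995 * Z := by ring
    omega
  rw [wp_seq_iff, wp_branch]
  refine ⟨by simp, fun hne => ?_, fun heq => ?_⟩
  · have hnot : ¬ Halted P (run P x.input (d.L * D)) := by
      simp only [eval_sub, eval_const, eval_var, hsim4.pc] at hne
      unfold Halted
      omega
    rw [wp_skip]
    refine advance_wp w5 w11 hDM hj ⟨Or.inr ⟨by simpa using w10, ⟨by simpa using w12, by simp,
      by simp, by simp, t4.congr rfl rfl rfl, x3, by simpa using w9, fun b hb a => ⟨?_, ?_⟩⟩,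
      N, hnum.mul_le, ?_⟩, ?_⟩
    · simp only [State.setVar_tab, State.tick_tab, x4]
      rw [g2 b (by omega), f1.tab 4 rfl]
      exact (hσ.fresh b (by omega) a).1
    · exact hsim4.fresh b (by omega) a
    -- Had the guaranteed time fitted into the budget, the simulated program would have halted.
    · by_contra! hle
      exact hnot ((hP x).halted (by exact_mod_cast hle))
    · simp only [State.setVar_time, State.tick_time, cost_sub, cost_const, cost_var]
      omega
  · have hhalt : Halted P (run P x.input (d.L * D)) := by
      simp only [eval_sub, eval_const, eval_var, hsim4.pc] at heq
      unfold Halted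
      omega
    generalize hτ : τ4.tick _ = τ
    have hv : τ.var = τ4.var := by rw [← hτ]; rfl
    have ht : τ.tab = τ4.tab := by rw [← hτ]; rfl
    have hl : τ.low = σ.low := by rw [← hτ]; exact ml
    have htime : τ.time ≤ τ4.time + 10 := by
      rw [← hτ]; simp only [State.tick_time, cost_sub, cost_const, cost_var]; omega
    refine wp_mono ?_ (wp_and_frame (check_wp (D := D) (N := N) (j := j) (by rw [hl]; exact he)
      (by rw [hv, w12]) (by rw [hv, w11]) (by rw [hv, w7])
      (t4.congr (by rw [ht]) (by rw [ht]) (by rw [ht])) (by rw [ht, x4]; exact hnum) ?_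
      (∃ i < d.L, d.deg (d.s i) ≤ D ∧ d.Good (d.s i) (d.t i))
      (by rw [hv, w9])))
    · rintro τ5 ⟨⟨y10, y9, ti5⟩, f5⟩
      refine advance_wp (by rw [f5.var 5 rfl, hv, w5]) (by rw [f5.var 11 rfl, hv, w11]) hDM hj
        ⟨Or.inl ⟨by simpa using y10, ?_⟩, ?_⟩
      · simp only [State.setVar_var, Nat.reduceEqDiff, if_false, y9]
        refine if_congr ?_ rfl rfl
        constructor
        · rintro (⟨i, hi, -, h⟩ | ⟨i, hi, -, -, h⟩) <;> exact ⟨i, hi, h⟩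
        · rintro ⟨i, hi, h⟩
          -- If the source has degree above `D`, then so has the target; the two searches together
          -- miss nothing.
          have := h.deg_le_deg (Darts.adj_of_lt hi)
          by_cases hs : d.deg (d.s i) ≤ D
          · exact Or.inl ⟨i, hi, hs, h⟩
          · exact Or.inr ⟨i, hi, by omega, by omega, h⟩
      · simp only [State.setVar_time]
        omega
    · intro u v hu hv'
      have hu0 := (hnum.ne_zero u).2 hu
      have hv0 := (hnum.ne_zero v).2 hv'
      have hu1 := hnum.le u
      have hv1 := hnum.le v
      have hN0 : 0 < N := by omega
      have hlt := mul_add_lt_mul_self (n := N) (i := τ2.tab 4 j u - 1) (j := τ2.tab 4 j v - 1)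
        (by omega) (by omega)
      have hlen : (τ2.tab 4 j u - 1) * N + (τ2.tab 4 j v - 1) <
        (matrixEntries (x.A * x.B)).length := by rw [length_matrixEntries]; exact hlt
      rw [ht, x3, hsim4.mem, x4, (hP x).mem_eq hhalt hlen, ← List.getD_eq_getElem _ 0 hlen]
      rw [show (matrixEntries (x.A * x.B)).getD _ 0 = _ from matrixEntries_getD _ hlt]
      have e1 : ((τ2.tab 4 j u - 1) * N + (τ2.tab 4 j v - 1)) / x.n = τ2.tab 4 j u - 1 := by
        rw [hxn, Nat.add_comm, Nat.add_mul_div_right _ _ hN0, Nat.div_eq_of_lt (by omega),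
          Nat.zero_add]
      have e2 : ((τ2.tab 4 j u - 1) * N + (τ2.tab 4 j v - 1)) % x.n = τ2.tab 4 j v - 1 := by
        rw [hxn, Nat.add_comm, Nat.add_mul_mod_self_right, Nat.mod_eq_of_lt (by omega)]
      rw [e1, e2]
      have := hnum.entry_mul hu0 hv0
      rw [← d.card_filter_split u v D, ← this]
      rfl

end RAM
namespace RAM

open Exp Stmt Classical

/-! ### Doubling the threshold until the multiplication succeeds -/

/-- Closed neighbourhood containment, with at most `R * low 1` stages. -/
def containment (P : Program) (R : ℕ) : Stmt :=
  assign 12 (.low 1 * 2) ;; assign 5 1 ;; build ;;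
  rep (.low 1 * .const R) (branch (.var 10) skip (stage P)) ;; write 0 (.var 9)

theorem stage_modsLow (P : Program) : (stage P).modsLow = false := by
  simp [stage, modsLow, simStep_modsLow, low, lowBody, lowInner, number, numberBody, fill, fillBody,
    check, checkBody, loadDart, advance]

/-- `X` is a threshold from which on every stage succeeds; it occurs only in the analysis. The
number of rounds is a multiple of the number of edges instead of a logarithm, which is simpler to
compute: after success a round costs a constant, and so all idle rounds together are linear. -/
theorem containment_wp {d : Darts} {off M k R X : ℕ} {C ω : ℝ} {P : Program} {σ : State}
    (he : Encodes d off M σ.low) (hv : σ.var = fun _ => 0) (ht : σ.tab = fun _ _ _ => 0)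
    (hP : MultipliesWithin P k C ω) (hpc : P.PcBound M) (hk : (d.L + 2) ^ k ≤ M)
    (hX : 0 < d.L → ∀ D N : ℕ, X ≤ D → N * D ≤ d.L → C * (max (N : ℝ) 1) ^ ω ≤ d.L * D)
    (hX1 : 1 ≤ X)
    (hR : 0 < d.L → 2 * X < 2 ^ (σ.low 1 * R)) (hXM : 4 * X ≤ M) (hRM : σ.low 1 * R ≤ M) :
    (containment P R).wp off M (fun τ =>
      τ.low 0 = (if ∃ i < d.L, d.Good (d.s i) (d.t i) then 1 else 0) ∧
      τ.time ≤ σ.time + (8 * (simStep P 0).cost + 10 * R + 90000) * ((d.L + 1) * X)) σ := by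
  have hM := he.L_le
  have hoff := he.off_le
  have hcount := he.count
  simp only [containment, wp_seq_iff, wp_assign, safe_mul, safe_low, safe_ofNat, eval_ofNat,
    eval_mul, eval_low, hcount, true_and, and_true]
  refine ⟨by omega, by omega, by omega, ?_⟩
  refine wp_mono ?_ (wp_and_frame (build_wp he (by simp) ht))
  rintro τ0 ⟨⟨t0, ti0⟩, f0⟩
  have l0 : τ0.low = σ.low := f0.low rfl
  simp only [State.setVar_time, cost_mul, cost_low, cost_ofNat] at ti0
  set K := (simStep P 0).cost with hK
  have inv0 : StageInv d 0 0 1 τ0 := by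
    refine ⟨?_, ?_, ?_, ?_, t0, fun y z => ?_, ?_, fun b _ a => ⟨?_, ?_, ?_⟩⟩
    · simp [f0.var 12 rfl]
    · simp [f0.var 11 rfl, hv]
    · simp [f0.var 5 rfl]
    · simp [f0.var 6 rfl, hv]
    · have : d.lowCount 0 y z = 0 := by
        rw [Darts.lowCount, Finset.card_eq_zero, Finset.filter_eq_empty_iff]
        intro x hx
        rw [Finset.mem_inter, Darts.mem_nb] at hx
        obtain ⟨i, hi, h, -⟩ := hx.1.symm
        have := d.deg_pos hi
        rw [h] at this
        omega
      simp [f0.tab 3 rfl, ht, this]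
    · rw [f0.var 9 rfl, if_neg]
      · simp [hv]
      · rintro ⟨i, hi, h, -⟩
        have := d.deg_pos hi
        omega
    · simp [f0.tab 4 rfl, ht]
    · simp [f0.tab 5 rfl, ht]
    · simp [f0.tab 6 rfl, ht]
  have n10 : τ0.var 10 = 0 := by simp [f0.var 10 rfl, hv]
  have hev : ∀ τ : State, τ.low = σ.low → (Exp.low 1 * .const R).eval τ = σ.low 1 * R := by
    intro τ h; simp [h]
  -- While unfinished, stage `n` has threshold `2 ^ n`, and the cost of all earlier stages is
  -- bounded by a multiple of `2 ^ n`, as a geometric sum. The last stage may double once more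
  -- beyond `2 * X`, hence `4 * X`; the term `10 * n` pays for the loop itself.
  refine wp_rep_of_invariant (fun n τ => τ.low = σ.low ∧
    ((τ.var 10 = 1 ∧ τ.var 9 = (if ∃ i < d.L, d.Good (d.s i) (d.t i) then 1 else 0) ∧
        τ.time ≤ τ0.time + 4 + 2 * (K + 10000) * ((d.L + 1) * (4 * X)) + 10 * n) ∨
      τ.var 10 = 0 ∧ 2 ^ n ≤ 2 * X ∧ (∃ Dp, Dp ≤ 2 ^ n ∧ StageInv d n Dp (2 ^ n) τ) ∧
        τ.time ≤ τ0.time + 4 + 2 * (K + 10000) * ((d.L + 1) * 2 ^ n) + 10 * n))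
    ?_ ?_ ?_ ?_
  · simp only [safe_mul, safe_low, safe_ofNat, safe_const, eval_ofNat, true_and, and_true]
    omega
  · refine ⟨l0, Or.inr ⟨n10, by omega, ⟨0, by omega, ?_⟩, ?_⟩⟩
    · exact ⟨inv0.var_L, inv0.var_stage, inv0.var_new, inv0.var_old, inv0.tables.congr rfl rfl rfl,
        inv0.count, inv0.found, inv0.fresh⟩
    · simp only [State.tick_time, cost_mul, cost_low, cost_const, cost_ofNat]
      omega
  · rintro n τ hn ⟨hl, hdone | ⟨h10, hDX, ⟨Dp, hDp, inv⟩, hti⟩⟩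
    · simp only [wp_branch, wp_skip, safe_var, eval_var, State.tick_var, hdone.1, State.tick_low,
        State.tick_time, hl, hdone.2.1, cost_var, true_and, one_ne_zero, ne_eq,
        not_false_eq_true, false_imp_iff, and_true, forall_const]
      have := hdone.2.2
      exact Or.inl (by omega)
    · rw [hev τ0 l0] at hn
      have hL : 0 < d.L := by
        have := left_ne_zero_of_mul (Nat.ne_zero_of_lt hn)
        omega
      rw [wp_branch]
      refine ⟨trivial, fun h => absurd h10 h, fun _ => ?_⟩
      generalize hσ1 : ((τ.tick 1).tick _) = σ1
      have s1 : σ1.var = τ.var ∧ σ1.tab = τ.tab ∧ σ1.low = σ.low ∧ σ1.time = τ.time + 4 := by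
        rw [← hσ1]; exact ⟨rfl, rfl, hl, rfl⟩
      obtain ⟨sv, st, sl, sti⟩ := s1
      have inv1 : StageInv d n Dp (2 ^ n) σ1 :=
        ⟨by rw [sv, inv.var_L], by rw [sv, inv.var_stage], by rw [sv, inv.var_new],
          by rw [sv, inv.var_old], inv.tables.congr (by rw [st]) (by rw [st]) (by rw [st]),
          by rw [st]; exact inv.count, by rw [sv, inv.found], by rw [st]; exact inv.fresh⟩
      refine wp_mono ?_ (wp_and_frame (stage_wp (by rw [sl]; exact he) hP hpc hk hDp
        Nat.one_le_two_pow (by omega) (by omega) inv1))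
      rintro τ' ⟨⟨hor, hti'⟩, ff⟩
      rw [← hK] at hti'
      have e1 : (K + 10000) * ((d.L + 1) * (2 ^ n + 1)) ≤
          2 * (K + 10000) * ((d.L + 1) * 2 ^ n) := by
        have : 2 ^ n + 1 ≤ 2 * 2 ^ n := by have := Nat.one_le_two_pow (n := n); omega
        calc (K + 10000) * ((d.L + 1) * (2 ^ n + 1))
            ≤ (K + 10000) * ((d.L + 1) * (2 * 2 ^ n)) := by gcongr
          _ = _ := by ring
      have e2 : 2 * (K + 10000) * ((d.L + 1) * 2 ^ (n + 1)) =
          2 * (K + 10000) * ((d.L + 1) * 2 ^ n) + 2 * (K + 10000) * ((d.L + 1) * 2 ^ n) := by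
        ring
      refine ⟨by rw [State.tick_low, ff.low (stage_modsLow P), sl], ?_⟩
      rcases hor with ⟨h10', h9'⟩ | ⟨h10', inv', N, hN, hlt⟩
      · have e3 : 2 * (K + 10000) * ((d.L + 1) * 2 ^ (n + 1)) ≤
            2 * (K + 10000) * ((d.L + 1) * (4 * X)) := by
          have : 2 ^ (n + 1) ≤ 4 * X := by rw [pow_succ]; omega
          gcongr
        exact Or.inl ⟨h10', h9', by rw [State.tick_time]; omega⟩
      -- A stage with threshold at least `X` cannot fail, so its certificate is contradictory.
      · have hDX' : 2 ^ n < X := by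
          by_contra! hle
          exact absurd hlt (not_lt.2 (by exact_mod_cast hX hL (2 ^ n) N hle hN))
        refine Or.inr ⟨by rw [State.tick_var, h10', sv, h10], by rw [pow_succ]; omega,
          ⟨2 ^ n, by rw [pow_succ]; omega, ?_⟩, by rw [State.tick_time]; omega⟩
        rw [pow_succ, Nat.mul_comm]
        exact ⟨inv'.var_L, inv'.var_stage, inv'.var_new, inv'.var_old,
          inv'.tables.congr rfl rfl rfl, inv'.count, inv'.found, inv'.fresh⟩
  · rintro τ ⟨hl, hor⟩
    rw [hev τ0 l0] at hor
    have hr : σ.low 1 * R ≤ R * ((d.L + 1) * X) := by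
      rw [Nat.mul_comm]
      exact Nat.mul_le_mul_left R (le_trans (by omega) (Nat.le_mul_of_pos_right _ hX1))
    have hLX : d.L + 1 ≤ (d.L + 1) * X := Nat.le_mul_of_pos_right _ hX1
    have htot : 2 * (K + 10000) * ((d.L + 1) * (4 * X)) =
      (8 * K) * ((d.L + 1) * X) + 80000 * ((d.L + 1) * X) := by ring
    have hgoal : (8 * K + 10 * R + 90000) * ((d.L + 1) * X) = (8 * K) * ((d.L + 1) * X) +
      10 * (R * ((d.L + 1) * X)) + 90000 * ((d.L + 1) * X) := by ring
    simp only [wp_write, safe_ofNat, safe_var, eval_ofNat, eval_var, State.tick_var,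
      State.setLow_low, if_true, State.setLow_time, State.tick_time, cost_ofNat, cost_var, true_and]
    rcases hor with ⟨-, h9, hti⟩ | ⟨-, hDX, ⟨Dp, -, inv⟩, hti⟩
    · rw [h9]
      refine ⟨by omega, by split_ifs <;> omega, rfl, by omega⟩
    -- Using up all rounds without success would make the threshold exceed `2 * X`, unless there are
    -- no edges and hence no rounds; then the answer `0` is correct.
    · have hL0 : d.L = 0 := by
        by_contra h
        have := hR (Nat.pos_of_ne_zero h)
        omega
      have hl0 : σ.low 1 = 0 := by omega
      rw [hl0, Nat.zero_mul, pow_zero] at hti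
      have h9 : τ.var 9 = if ∃ i < d.L, d.Good (d.s i) (d.t i) then 1 else 0 := by
        rw [inv.found]
        simp [hL0]
      have e3 : 2 * (K + 10000) * ((d.L + 1) * 1) ≤ 2 * (K + 10000) * ((d.L + 1) * (4 * X)) := by
        have : 1 ≤ 4 * X := by omega
        gcongr
      rw [h9]
      refine ⟨by omega, by split_ifs <;> omega, rfl, by omega⟩

end RAM

/-! ### From edge lists to oriented edges -/

theorem List.getD_flatMap_pair {α : Type*} (f g : α → ℕ) {l : List α} {q : ℕ} (hq : q < l.length) :
    (l.flatMap fun e => [f e, g e]).getD (2 * q) 0 = f l[q] ∧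
      (l.flatMap fun e => [f e, g e]).getD (2 * q + 1) 0 = g l[q] := by
  induction l generalizing q with
  | nil => simp at hq
  | cons a l ih =>
    cases q with
    | zero => simp
    | succ q =>
      have h := ih (q := q) (by simpa using hq)
      rw [List.flatMap_cons, Nat.mul_succ]
      simpa using h

namespace EdgeListGraph

open Classical

variable (x : EdgeListGraph)

/-- Each edge gives two consecutive darts of opposite orientation. -/
def revIndex (i : ℕ) : ℕ := i + 1 - 2 * (i - 2 * (i / 2))

def endpoint (i : ℕ) : ℕ := x.encode.getD (i + 2) 0

variable {x}

theorem endpoint_cases {i : ℕ} (hi : i < 2 * x.edges.length) :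
    ∃ (q : ℕ) (hq : q < x.edges.length),
      (i = 2 * q ∧ revIndex i = 2 * q + 1 ∧ x.endpoint i = x.edges[q].1 ∧
        x.endpoint (revIndex i) = x.edges[q].2) ∨
      (i = 2 * q + 1 ∧ revIndex i = 2 * q ∧ x.endpoint i = x.edges[q].2 ∧
        x.endpoint (revIndex i) = x.edges[q].1) := by
  have hq : i / 2 < x.edges.length := by omega
  have h := List.getD_flatMap_pair (fun e : Fin x.n × Fin x.n => (e.1 : ℕ))
    (fun e => (e.2 : ℕ)) hq
  refine ⟨i / 2, hq, ?_⟩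
  rcases Nat.mod_two_eq_zero_or_one i with h2 | h2
  · have e1 : i = 2 * (i / 2) := by omega
    have e2 : revIndex i = 2 * (i / 2) + 1 := by unfold revIndex; omega
    refine Or.inl ⟨e1, e2, ?_, ?_⟩
    · rw [← h.1, ← e1]; rfl
    · rw [← h.2, e2]; rfl
  · have e1 : i = 2 * (i / 2) + 1 := by omega
    have e2 : revIndex i = 2 * (i / 2) := by unfold revIndex; omega
    refine Or.inr ⟨e1, e2, ?_, ?_⟩
    · rw [← h.2, ← e1]; rfl
    · rw [← h.1, e2]; rfl

theorem endpoint_lt {i : ℕ} (hi : i < 2 * x.edges.length) :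
    x.endpoint i < x.n ∧ x.endpoint (revIndex i) < x.n := by
  obtain ⟨q, hq, ⟨-, -, hs, ht⟩ | ⟨-, -, hs, ht⟩⟩ := endpoint_cases hi <;>
    exact ⟨hs ▸ Fin.is_lt _, ht ▸ Fin.is_lt _⟩

theorem adj_getElem {q : ℕ} (hq : q < x.edges.length) : x.G.Adj x.edges[q].1 x.edges[q].2 := by
  rw [← SimpleGraph.mem_edgeSet, ← x.mem_iff]
  exact List.mem_map_of_mem (List.getElem_mem hq)

theorem getElem_inj {q q' : ℕ} (hq : q < x.edges.length) (hq' : q' < x.edges.length)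
    (h : s(x.edges[q].1, x.edges[q].2) = s(x.edges[q'].1, x.edges[q'].2)) : q = q' := by
  have := x.nodup.getElem_inj_iff (i := q) (j := q') (hi := by simpa using hq)
    (hj := by simpa using hq')
  rw [← this]
  simpa using h

variable (x)

/-- The darts, in the order in which the input lists them. -/
def darts : Darts where
  L := 2 * x.edges.length
  s := x.endpoint
  t i := x.endpoint (revIndex i)
  rev := revIndex
  rev_lt i hi := by unfold revIndex; omega
  s_rev i hi := rfl
  t_rev i hi := by
    congr 1
    unfold revIndex; omega
  inj i hi i' hi' h1 h2 := by
    obtain ⟨q, hq, h⟩ := endpoint_cases hi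
    obtain ⟨q', hq', h'⟩ := endpoint_cases hi'
    -- Darts with equal ends come from the same edge, since no edge is listed twice; if they had
    -- opposite orientations, that edge would be a loop.
    have hne := (adj_getElem hq).ne
    rcases h with ⟨e, -, hs, ht⟩ | ⟨e, -, hs, ht⟩ <;>
      rcases h' with ⟨e', -, hs', ht'⟩ | ⟨e', -, hs', ht'⟩ <;>
      rw [hs, hs', Fin.val_inj] at h1 <;> rw [ht, ht', Fin.val_inj] at h2 <;>
      obtain rfl := getElem_inj hq hq' (by rw [Sym2.eq_iff]; tauto)
    · omega
    · exact absurd h1 hne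
    · exact absurd h1.symm hne
    · omega
  ne i hi h := by
    obtain ⟨q, hq, h'⟩ := endpoint_cases hi
    have hne := (adj_getElem hq).ne
    rcases h' with ⟨-, -, hs, ht⟩ | ⟨-, -, hs, ht⟩ <;> rw [hs, ht, Fin.val_inj] at h
    · exact hne h
    · exact hne h.symm

variable {x}

theorem darts_adj {u v : ℕ} :
    x.darts.Adj u v ↔ ∃ (hu : u < x.n) (hv : v < x.n), x.G.Adj ⟨u, hu⟩ ⟨v, hv⟩ := by
  constructor
  · rintro ⟨i, hi, rfl, rfl⟩
    obtain ⟨q, hq, h⟩ := endpoint_cases hi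
    have hadj := adj_getElem hq
    rcases h with ⟨-, -, hs, ht⟩ | ⟨-, -, hs, ht⟩
    · exact ⟨(endpoint_lt hi).1, (endpoint_lt hi).2, by simpa only [darts, hs, ht] using hadj⟩
    · exact ⟨(endpoint_lt hi).1, (endpoint_lt hi).2, by simpa only [darts, hs, ht] using hadj.symm⟩
  · rintro ⟨hu, hv, h⟩
    rw [← SimpleGraph.mem_edgeSet, ← x.mem_iff, List.mem_map] at h
    obtain ⟨e, he, heq⟩ := h
    obtain ⟨q, hq, rfl⟩ := List.getElem_of_mem he
    obtain ⟨hs, ht⟩ := List.getD_flatMap_pair (fun e : Fin x.n × Fin x.n => (e.1 : ℕ))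
      (fun e => (e.2 : ℕ)) hq
    have hlt : 2 * q < x.darts.L := by simp only [darts]; omega
    have : x.darts.Adj x.edges[q].1 x.edges[q].2 := by
      refine ⟨2 * q, hlt, hs, ?_⟩
      have : revIndex (2 * q) = 2 * q + 1 := by unfold revIndex; omega
      simp only [darts, this]
      exact ht
    rcases Sym2.eq_iff.1 heq with ⟨h1, h2⟩ | ⟨h1, h2⟩
    · simpa only [h1, h2] using this
    · simpa only [h1, h2] using this.symm

theorem length_edges : x.edges.length = x.m := by
  rw [m, ← List.length_map (f := fun e : Fin x.n × Fin x.n => s(e.1, e.2)),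
    ← List.toFinset_card_of_nodup x.nodup, ← Set.ncard_coe_finset]
  congr 1
  ext e
  simp [← x.mem_iff]

/-- Since u belongs to its own closed neighbourhood, containment in that of another vertex v makes u
and v adjacent, so it is enough to look at darts. -/
theorem hasClosedNbhdContainment_iff : x.G.HasClosedNbhdContainment ↔
    ∃ i < x.darts.L, x.darts.Good (x.darts.s i) (x.darts.t i) := by
  constructor
  · rintro ⟨u, v, hne, hsub⟩
    have huv : x.G.Adj v u := by
      have := hsub (Set.mem_insert u _)
      exact this.resolve_left hne
    obtain ⟨i, hi, hs, ht⟩ : x.darts.Adj u v := darts_adj.2 ⟨u.2, v.2, huv.symm⟩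
    refine ⟨i, hi, (Darts.good_iff (Darts.adj_of_lt hi)).2 fun z hz => ?_⟩
    rw [hs] at hz
    rw [ht]
    obtain ⟨_, hz', hz⟩ := darts_adj.1 hz
    rcases hsub (Set.mem_insert_of_mem _ hz) with h | h
    · exact Or.inl (congrArg Fin.val h)
    · exact Or.inr (darts_adj.2 ⟨v.2, hz', h⟩)
  · rintro ⟨i, hi, hg⟩
    have hadj := Darts.adj_of_lt hi
    rw [Darts.good_iff hadj] at hg
    obtain ⟨hu, hv, huv⟩ := darts_adj.1 hadj
    refine ⟨_, _, huv.ne, Set.insert_subset (Set.mem_insert_of_mem _ huv.symm) fun z hz => ?_⟩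
    rcases hg z (darts_adj.2 ⟨hu, z.2, hz⟩) with h | h
    · exact Or.inl (Fin.ext h)
    · exact Or.inr (darts_adj.1 h).2.2

theorem encodes {off M : ℕ} (hoff : 2 * x.m + 2 ≤ off) (hn : x.n ≤ M) (hM : 6 * x.m + 10 ≤ M) :
    RAM.Encodes x.darts off M (fun a => x.encode.getD a 0) := by
  rw [← length_edges] at hoff hM
  refine ⟨?_, fun i _ => rfl, fun i _ => ?_, hoff, fun i hi => ?_, fun i hi => ?_, ?_⟩
  · simp [encode, darts, Nat.mul_comm]
  · simp only [darts, endpoint, revIndex]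
    congr 1
    omega
  · exact (endpoint_lt hi).1.le.trans hn
  · exact (endpoint_lt hi).2.le.trans hn
  · simp only [darts]; omega

theorem length_encode : x.encode.length = 2 * x.m + 2 := by
  rw [← length_edges]
  simp [encode, List.length_flatMap]
  omega

theorem le_of_mem_encode {a : ℕ} (ha : a ∈ x.encode) : a ≤ x.n + x.m := by
  rw [← length_edges]
  simp only [encode, List.mem_cons, List.mem_flatMap, List.not_mem_nil, or_false] at ha
  rcases ha with rfl | rfl | ⟨e, -, rfl | rfl⟩
  · omega
  · omega
  · have := e.1.2; omega
  · have := e.2.2; omega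

end EdgeListGraph

/-! ### Choice of the threshold and the exponent of the running time -/

section

open RAM Classical

theorem RAM.ComputesWithin.mono_time {P : Program} {input output : List ℕ} {T T' : ℝ} {B : ℕ}
    (h : ComputesWithin P input output T B) (hT : T ≤ T') :
    ComputesWithin P input output T' B :=
  let ⟨t, ht, h⟩ := h
  ⟨t, ht.trans hT, h⟩

theorem ClosedNbhdContainmentInTime.mono {e e' : ℝ} (h : ClosedNbhdContainmentInTime e)
    (he : e ≤ e') : ClosedNbhdContainmentInTime e' := by
  obtain ⟨P, k, C, hP⟩ := h
  refine ⟨P, k, |C|, fun x => (hP x).mono_time ?_⟩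
  have h1 : (1 : ℝ) ≤ max (x.m : ℝ) 1 := le_max_right _ _
  exact (mul_le_mul_of_nonneg_right (le_abs_self C) (by positivity)).trans
    (mul_le_mul_of_nonneg_left (Real.rpow_le_rpow_of_exponent_le h1 he) (abs_nonneg C))

/-- For `D ≥ C * L ^ ((ω - 1) / (ω + 1))`, matrices with `L / D` rows can be multiplied in time
`L * D`. -/
theorem mul_rpow_le_mul {C ω : ℝ} (hC : 1 ≤ C) (hω : 1 ≤ ω) {L D N : ℕ} (hL : 0 < L)
    (hD : C * (L : ℝ) ^ ((ω - 1) / (ω + 1)) ≤ D) (hN : N * D ≤ L) :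
    C * (max (N : ℝ) 1) ^ ω ≤ L * D := by
  have hL1 : (1 : ℝ) ≤ L := by exact_mod_cast hL
  have hα : 0 ≤ (ω - 1) / (ω + 1) := div_nonneg (by linarith) (by linarith)
  have hLα : 1 ≤ (L : ℝ) ^ ((ω - 1) / (ω + 1)) := Real.one_le_rpow hL1 hα
  have hCD : C ≤ D := le_trans (by nlinarith) hD
  have hD0 : (0 : ℝ) < D := by linarith
  rcases Nat.eq_zero_or_pos N with rfl | hN0
  · simp only [Nat.cast_zero, zero_le_one, max_eq_right, Real.one_rpow]
    nlinarith
  have hN1 : (1 : ℝ) ≤ N := by exact_mod_cast hN0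
  rw [max_eq_left hN1]
  -- The hypothesis on `D` raised to the power ω + 1; the resulting factor C ^ (ω + 1) is at least
  -- `C` because `C ≥ 1`.
  have key : C * (L : ℝ) ^ (ω - 1) ≤ (D : ℝ) ^ (ω + 1) := by
    have h1 : (C * (L : ℝ) ^ ((ω - 1) / (ω + 1))) ^ (ω + 1) ≤ (D : ℝ) ^ (ω + 1) :=
      Real.rpow_le_rpow (by positivity) hD (by linarith)
    rw [Real.mul_rpow (by linarith) (by positivity), ← Real.rpow_mul (by positivity),
      div_mul_cancel₀ _ (by linarith)] at h1
    refine le_trans (mul_le_mul_of_nonneg_right ?_ (by positivity)) h1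
    calc C = C ^ (1 : ℝ) := (Real.rpow_one C).symm
      _ ≤ C ^ (ω + 1) := Real.rpow_le_rpow_of_exponent_le hC (by linarith)
  have hND : ((N : ℝ) * D) ^ ω ≤ (L : ℝ) ^ ω :=
    Real.rpow_le_rpow (by positivity) (by exact_mod_cast hN) (by linarith)
  rw [Real.mul_rpow (by positivity) (by positivity)] at hND
  have hLω : (L : ℝ) ^ ω = (L : ℝ) ^ (ω - 1) * L := by
    rw [Real.rpow_sub_one (by positivity), div_mul_cancel₀ _ (by positivity)]
  have hDω : (D : ℝ) ^ (ω + 1) = (D : ℝ) ^ ω * D := Real.rpow_add_one (by positivity) _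
  have hDp : 0 < (D : ℝ) ^ ω := by positivity
  -- After multiplication by D ^ ω, the bound (N * D) ^ ω ≤ L ^ ω eliminates `N`.
  refine le_of_mul_le_mul_right ?_ hDp
  calc C * (N : ℝ) ^ ω * (D : ℝ) ^ ω = C * ((N : ℝ) ^ ω * (D : ℝ) ^ ω) := by ring
    _ ≤ C * (L : ℝ) ^ ω := by gcongr
    _ = C * (L : ℝ) ^ (ω - 1) * L := by rw [hLω]; ring
    _ ≤ (D : ℝ) ^ (ω + 1) * L := by gcongr
    _ = L * D * (D : ℝ) ^ ω := by rw [hDω]; ring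

/-- A degree threshold with which the multiplication is certainly successful. -/
noncomputable def sufficientDegree (C ω : ℝ) (L : ℕ) : ℕ :=
  ⌈C * (max (L : ℝ) 1) ^ ((ω - 1) / (ω + 1))⌉₊

theorem one_le_mul_rpow {C ω : ℝ} (hC : 1 ≤ C) (hω : 1 ≤ ω) (L : ℕ) :
    1 ≤ C * (max (L : ℝ) 1) ^ ((ω - 1) / (ω + 1)) :=
  one_le_mul_of_one_le_of_one_le hC (Real.one_le_rpow (le_max_right _ _)
    (div_nonneg (by linarith) (by linarith)))

theorem one_le_sufficientDegree {C ω : ℝ} (hC : 1 ≤ C) (hω : 1 ≤ ω) (L : ℕ) :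
    1 ≤ sufficientDegree C ω L :=
  Nat.one_le_ceil_iff.2 (zero_lt_one.trans_le (one_le_mul_rpow hC hω L))

/-- The exponent (ω - 1) / (ω + 1) is at most `1`. This crude linear bound serves for the word size
and the number of rounds, not for the running time. -/
theorem sufficientDegree_le {C ω : ℝ} (hC : 1 ≤ C) (hω : 1 ≤ ω) (L : ℕ) :
    sufficientDegree C ω L ≤ ⌈C⌉₊ * max L 1 := by
  refine Nat.ceil_le.2 ?_
  push_cast
  refine mul_le_mul (Nat.le_ceil C) ?_ (by positivity) (by positivity)
  calc (max (L : ℝ) 1) ^ ((ω - 1) / (ω + 1)) ≤ (max (L : ℝ) 1) ^ (1 : ℝ) :=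
        Real.rpow_le_rpow_of_exponent_le (le_max_right _ _)
          ((div_le_one (by linarith)).2 (by linarith))
    _ = _ := Real.rpow_one _

/-- The exponents add up as 1 + (ω - 1) / (ω + 1) = 2ω / (ω + 1). The constant is 12 = 3 * 2 * 2: a
factor 3 from 2m + 1, a factor 2 from rounding up, and a factor 2 from replacing 2m by m in the
power. -/
theorem mul_sufficientDegree_le {C ω : ℝ} (hC : 1 ≤ C) (hω : 1 ≤ ω) (m : ℕ) :
    ((2 * m + 1 : ℕ) : ℝ) * sufficientDegree C ω (2 * m) ≤
      12 * C * (max (m : ℝ) 1) ^ (2 * ω / (ω + 1)) := by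
  have hα : 0 ≤ (ω - 1) / (ω + 1) := div_nonneg (by linarith) (by linarith)
  have hα1 : (ω - 1) / (ω + 1) ≤ 1 := (div_le_one (by linarith)).2 (by linarith)
  have hexp : 2 * ω / (ω + 1) = 1 + (ω - 1) / (ω + 1) := by
    rw [div_eq_iff (by linarith), add_mul, div_mul_cancel₀ _ (by linarith)]; ring
  have hone := one_le_mul_rpow hC hω (2 * m)
  have hX : (sufficientDegree C ω (2 * m) : ℝ) ≤
      2 * (C * (max ((2 * m : ℕ) : ℝ) 1) ^ ((ω - 1) / (ω + 1))) := by
    have := (Nat.ceil_lt_add_one (zero_le_one.trans hone)).le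
    rw [sufficientDegree]
    linarith
  have hm1 : (1 : ℝ) ≤ max (m : ℝ) 1 := le_max_right _ _
  have hm0 : (m : ℝ) ≤ max (m : ℝ) 1 := le_max_left _ _
  rw [hexp, Real.rpow_add (by positivity), Real.rpow_one]
  generalize max (m : ℝ) 1 = μ at hm1 hm0 ⊢
  have h2 : (max ((2 * m : ℕ) : ℝ) 1) ^ ((ω - 1) / (ω + 1)) ≤ 2 * μ ^ ((ω - 1) / (ω + 1)) := by
    calc (max ((2 * m : ℕ) : ℝ) 1) ^ ((ω - 1) / (ω + 1)) ≤ (2 * μ) ^ ((ω - 1) / (ω + 1)) := by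
          refine Real.rpow_le_rpow (by positivity) (max_le ?_ (by linarith)) hα
          push_cast; linarith
      _ = 2 ^ ((ω - 1) / (ω + 1)) * μ ^ ((ω - 1) / (ω + 1)) :=
          Real.mul_rpow (by norm_num) (by linarith)
      _ ≤ 2 ^ (1 : ℝ) * μ ^ ((ω - 1) / (ω + 1)) := by gcongr; norm_num
      _ = _ := by rw [Real.rpow_one]
  have h3 : ((2 * m + 1 : ℕ) : ℝ) ≤ 3 * μ := by push_cast; linarith
  calc ((2 * m + 1 : ℕ) : ℝ) * sufficientDegree C ω (2 * m)
      ≤ (3 * μ) * (2 * (C * (2 * μ ^ ((ω - 1) / (ω + 1))))) := by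
        refine mul_le_mul h3 (hX.trans ?_) (by positivity) (by positivity)
        gcongr
    _ = _ := by ring

theorem exists_multipliesWithin {ω : ℝ} (h : IsMatMulExponent ω) :
    ∃ (P : Program) (k : ℕ) (C : ℝ), 1 ≤ C ∧ MultipliesWithin P k C ω := by
  obtain ⟨P, k, C, hP⟩ := h 0
  refine ⟨P, k, max C 1, le_max_right _ _, fun x => (hP x).mono_time ?_⟩
  exact mul_le_mul_of_nonneg_right (le_max_left _ _) (by positivity)

theorem EdgeListGraph.rawSize_encode (x : EdgeListGraph) :
    rawSize x.encode = 2 * (x.n * x.n + x.m) + 2 := by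
  simp [rawSize, EdgeListGraph.encode, EdgeListGraph.length_edges]

/-- All quantities in the algorithm are bounded by a power of the size. -/
theorem bounds_le_pow {n m k K B e : ℕ} (he : 2 * k + K + B + 10 ≤ e) :
    2 * (n * n + m) + 2 ≤ (n + m + 2) ^ e ∧ n + m ≤ (n + m + 2) ^ e ∧
      6 * m + 10 ≤ (n + m + 2) ^ e ∧ (2 * m + 2) ^ k ≤ (n + m + 2) ^ e ∧ K ≤ (n + m + 2) ^ e ∧
      4 * (B * (2 * m + 1)) ≤ (n + m + 2) ^ e := by
  have hS : 2 ≤ n + m + 2 := by omega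
  have hn : n ≤ n + m + 2 := by omega
  have hm : 2 * m + 2 ≤ 2 * (n + m + 2) := by omega
  have hm' : m ≤ n + m + 2 := by omega
  have hnm : n + m ≤ n + m + 2 := by omega
  generalize n + m + 2 = S at *
  have mono : ∀ {a f : ℕ}, a ≤ S ^ f → f ≤ e → a ≤ S ^ e :=
    fun h hf => h.trans (Nat.pow_le_pow_right (by omega) hf)
  have const : ∀ c : ℕ, c ≤ S ^ c := fun c =>
    (Nat.lt_two_pow_self).le.trans (Nat.pow_le_pow_left hS c)
  have h2 : 2 * m + 2 ≤ S ^ 2 := hm.trans (by nlinarith)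
  have h8 : 8 ≤ S ^ 3 := Nat.pow_le_pow_left hS 3
  have h16 : 16 ≤ S ^ 4 := Nat.pow_le_pow_left hS 4
  refine ⟨mono (f := 5) ?_ (by omega), mono (f := 1) ?_ (by omega), mono (f := 6) ?_ (by omega),
    mono (f := 2 * k) ?_ (by omega), mono (const K) (by omega),
    mono (f := 3 + (B + 2)) ?_ (by omega)⟩
  · calc 2 * (n * n + m) + 2 ≤ 8 * S ^ 2 := by nlinarith
      _ ≤ S ^ 3 * S ^ 2 := by gcongr
      _ = S ^ 5 := by ring
  · rwa [pow_one]
  · calc 6 * m + 10 ≤ 16 * (2 * m + 2) := by omega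
      _ ≤ S ^ 4 * S ^ 2 := by gcongr
      _ = S ^ 6 := by ring
  · rw [pow_mul]; exact Nat.pow_le_pow_left h2 k
  · calc 4 * (B * (2 * m + 1)) ≤ 8 * (B * (2 * m + 2)) := by nlinarith
      _ ≤ S ^ 3 * (S ^ B * S ^ 2) := by gcongr; exact const B
      _ = S ^ (3 + (B + 2)) := by rw [pow_add, pow_add]

theorem IsMatMulExponent.closedNbhdContainmentInTime {ω : ℝ} (h : IsMatMulExponent ω) :
    ClosedNbhdContainmentInTime (2 * ω / (ω + 1)) := by
  have hω := h.one_le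
  obtain ⟨P, k, C, hC, hP⟩ := exists_multipliesWithin h
  obtain ⟨K, hK⟩ := P.exists_pcBound
  set B := ⌈C⌉₊ with hB
  have hB1 : 1 ≤ B := Nat.one_le_ceil_iff.2 (by linarith)
  set e := 2 * k + K + B + 10 with he
  have hbd : ∀ x : EdgeListGraph, _ := fun x => bounds_le_pow (n := x.n) (m := x.m) he.ge
  -- With X ≤ B * 2m for m ≥ 1, there are enough rounds, since 2X ≤ 4Bm < 2 ^ (4Bm).
  refine solvableInTime_of_wp (containment P (4 * B)) (fun x => (x.n + x.m + 2) ^ e) e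
    (((8 * (simStep P 0).cost + 10 * (4 * B) + 90000 : ℕ) : ℝ) * (12 * C)) (fun x => le_rfl)
    (fun x => ?_) (fun x => ?_) (fun x => ?_) (fun x => ?_) (fun x a ha => ?_) fun x => ?_
  · exact Real.one_le_rpow (le_max_right _ _) (div_nonneg (by linarith) (by linarith))
  · rw [x.rawSize_encode, EdgeListGraph.length_encode]
    have := Nat.zero_le (x.n * x.n)
    omega
  · simp [rawSize]
  · rw [x.rawSize_encode]; exact (hbd x).1
  · exact (EdgeListGraph.le_of_mem_encode ha).trans (hbd x).2.1
  · obtain ⟨b1, b2, b3, b4, b5, b6⟩ := hbd x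
    have hL : x.darts.L = 2 * x.m := congrArg (2 * ·) EdgeListGraph.length_edges
    have hlow : (State.start x.encode).low 1 = x.m := EdgeListGraph.length_edges
    set X := sufficientDegree C ω (2 * x.m) with hX
    have hXle := sufficientDegree_le hC hω (2 * x.m)
    rw [← hX, ← hB] at hXle
    have hX4 : 4 * X ≤ 4 * (B * (2 * x.m + 1)) :=
      Nat.mul_le_mul_left 4 (hXle.trans (Nat.mul_le_mul_left B (by omega)))
    refine Stmt.wp_mono ?_ (containment_wp (R := 4 * B) (X := X)
      (EdgeListGraph.encodes (by rw [x.rawSize_encode]; omega) (le_trans (by omega) b2) b3) rfl rfl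
      hP (hK.mono b5) (by rw [hL]; exact b4) ?_ (one_le_sufficientDegree hC hω _) ?_
      (hX4.trans b6) ?_)
    · rintro τ ⟨h0, hti⟩
      refine ⟨?_, fun i hi => ?_⟩
      · have h1 : (τ.time : ℝ) ≤ ((8 * (simStep P 0).cost + 10 * (4 * B) + 90000 : ℕ) : ℝ) *
            (((2 * x.m + 1 : ℕ) : ℝ) * X) := by
          rw [hL] at hti
          have : (State.start x.encode).time = 0 := rfl
          rw [this, Nat.zero_add] at hti
          exact_mod_cast hti
        refine h1.trans ?_
        rw [mul_assoc]
        exact mul_le_mul_of_nonneg_left (mul_sufficientDegree_le hC hω x.m) (by positivity)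
      · obtain rfl : i = 0 := by simpa using hi
        simp only [List.getElem_cons_zero, h0]
        exact if_congr EdgeListGraph.hasClosedNbhdContainment_iff.symm rfl rfl
    · intro hpos D N hD hN
      refine mul_rpow_le_mul hC hω hpos (le_trans ?_ (Nat.cast_le.2 hD)) hN
      rw [hX, ← hL]
      refine le_trans (le_of_eq ?_) (Nat.le_ceil _)
      rw [max_eq_left (by exact_mod_cast hpos)]
    · intro hpos
      rw [hlow]
      refine lt_of_le_of_lt ?_ Nat.lt_two_pow_self
      rw [max_eq_left (by omega)] at hXle
      nlinarith
    · rw [hlow]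
      calc x.m * (4 * B) = 4 * (B * x.m) := by ring
        _ ≤ 4 * (B * (2 * x.m + 1)) := by gcongr; omega
        _ ≤ _ := b6

/-- The function 2t / (t + 1) has derivative 2 / (t + 1)², which is at most 2 for t ≥ 0. -/
theorem div_add_one_le {a b : ℝ} (ha : 0 ≤ a) (hab : a ≤ b) :
    2 * b / (b + 1) ≤ 2 * a / (a + 1) + 2 * (b - a) := by
  rw [div_add' _ _ _ (by linarith), div_le_div_iff₀ (by linarith) (by linarith)]
  nlinarith [mul_nonneg ha (sub_nonneg.2 hab),
    mul_nonneg (mul_nonneg ha (sub_nonneg.2 hab)) (ha.trans hab),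
    mul_nonneg (ha.trans hab) (sub_nonneg.2 hab)]

theorem closedNbhdContainmentInTime_matMulOmega {ε : ℝ} (hε : 0 < ε) :
    ClosedNbhdContainmentInTime (2 * matMulOmega / (matMulOmega + 1) + ε) := by
  have hbdd : 1 ≤ matMulOmega :=
    le_csInf ⟨3, isMatMulExponent_three⟩ fun τ hτ => IsMatMulExponent.one_le hτ
  -- A feasible exponent within ε / 2 of the infimum; the Lipschitz constant 2 turns this into a
  -- loss of at most ε.
  obtain ⟨τ, hτ, hlt⟩ := exists_lt_of_csInf_lt (s := {τ : ℝ | IsMatMulExponent τ})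
    ⟨3, isMatMulExponent_three⟩ (show matMulOmega < matMulOmega + ε / 2 by linarith)
  have hle : matMulOmega ≤ τ := csInf_le ⟨1, fun τ hτ => IsMatMulExponent.one_le hτ⟩ hτ
  refine (IsMatMulExponent.closedNbhdContainmentInTime hτ).mono ?_
  have := div_add_one_le (by linarith) hle
  linarith

end

/-- Closed neighbourhood containment is decidable in time `O(m ^ (2ω/(ω+1)))`: with exactly this
bound for every exponent `ω` for which matrices can be multiplied in time `O(n ^ ω)`, and, for
the infimum `ω` of these exponents, up to an arbitrarily small `ε > 0` in the exponent. -/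
theorem mainTheorem12 :
    (∀ ω : ℝ, IsMatMulExponent ω → ClosedNbhdContainmentInTime (2 * ω / (ω + 1))) ∧
    (∀ ε : ℝ, 0 < ε →
      ClosedNbhdContainmentInTime (2 * matMulOmega / (matMulOmega + 1) + ε)) := by
  exact ⟨fun _ h => h.closedNbhdContainmentInTime,
    fun _ hε => closedNbhdContainmentInTime_matMulOmega hε⟩
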